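/- Let $d,n\ge 1$. Let $\Psi,\Phi^1,\dots,\Phi^n\in\mathcal S(\mathbb R^d)$, where $\widehat\Psi$ is supported in a corona $\{a\le|\xi|\le b\}$, $0<a<b$, and each $\widehat{\Phi^i}$ has bounded support. For a bounded measurable $L:(0,\infty)\to\mathbb C$, $\lambda\in(\mathbb R\setminus\{0\})^n$ and $\rho\in(0,1]^n$ put $$U_{\rho,\lambda,L}(f_1,\dots,f_n)(x)=\int_0^\infty L(t)\int_{\mathbb R^d}\Psi_t(y)\prod_{i=1}^n\left[\Phi^i_{\lambda_it}*f_i\right](x-\rho_i\lambda_iy)\,dy\,\frac{dt}{t},\qquad \zeta_t(x)=|t|^{-d}\zeta(t^{-1}x).$$ A continuous linear operator $T:\mathcal S(\mathbb R^d)\to\mathcal S'(\mathbb R^d)$ is called a Calderón–Zygmund operator of order $N$, with kernel constants $A_{\alpha,\beta}$, if it extends to a bounded operator on $L^2(\mathbb R^d)$ and there is a function $K$ of class $C^{2N}$ on $\{(x,y):x\ne y\}$ such that $$|\partial_x^\alpha\partial_y^\beta K(x,y)|\le A_{\alpha,\beta}\,|x-y|^{-d-|\alpha|-|\beta|}\qquad(x\neq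 y,\ \alpha,\beta\in\mathbb N^d,\ |\alpha|,|\beta|\le N)$$ and, for every $f\in C_c^\infty(\mathbb R^d)$, the distribution $Tf$ coincides off $\operatorname{supp} f$ with the function $x\mapsto\int K(x,y)f(y)\,dy$. **Proposition.** Let $f_1,\dots,f_{n-1}$ be bounded $C^\infty$ functions on $\mathbb R^d$. For every $f_n\in\mathcal S(\mathbb R^d)$ and $x\in\mathbb R^d$ the integrals defining $U_{\rho,\lambda,L}(f_1,\dots,f_n)(x)$ converge absolutely (as iterated integrals), and the map $$V:f_n\longmapsto U_{\rho,\lambda,L}(f_1,\dots,f_n)$$ is a continuous linear operator $\mathcal S(\mathbb R^d)\to\mathcal S'(\mathbb R^d)$ which is a Calderón–Zygmund operator of order $N$ for every $N\in\mathbb N$. Its kernel constants $(A_{\alpha,\beta})$ may be chosen independent of $N$ and such that, for every $\beta\in\mathbb N^d$, $$A_{0,\beta}\le C_\beta\,\|L\|_\infty\prod_{j=1}^{n-1}\|f_j\|_\infty,$$ where $C_\beta$ depends only on $\beta$, $d$, $n$, $\Psi$ and the $\Phi^i$; in particular the constants $A_{0,\beta}$ are bounded uniformly in $\lambda\in(\mathbb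 R\setminus\{0\})^n$ and $\rho\in(0,1]^n$. -/

import Mathlib

open MeasureTheory Set
open scoped SchwartzMap FourierTransform ContDiff

noncomputable section

namespace Paraproduct

/-- `ℝ^d` with its Euclidean norm and Lebesgue measure. -/
abbrev Space (d : ℕ) : Type := EuclideanSpace ℝ (Fin d)

/-! ### Calderón–Zygmund operators of order `N` -/

/-- A multi-index `α ∈ ℕ^d`. -/
abbrev MultiIndex (d : ℕ) : Type := Fin d → ℕ

/-- The length `|α| = α_1 + ⋯ + α_d`. -/
def length {d : ℕ} (α : MultiIndex d) : ℕ := ∑ i, α i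

/-- The first order partial derivative `∂_i g`. -/
def partialD {d : ℕ} (i : Fin d) (g : Space d → ℂ) : Space d → ℂ :=
  fun x => fderiv ℝ g x (EuclideanSpace.single i 1)

/-- The partial derivative `∂^α g = ∂_1^{α_1} ⋯ ∂_d^{α_d} g`. -/
def mixedPartial {d : ℕ} (α : MultiIndex d) (g : Space d → ℂ) : Space d → ℂ :=
  (List.finRange d).foldr (fun i h => (partialD i)^[α i] h) g

/-- `∂_x^α ∂_y^β K (x, y)`. -/
def kernelDeriv {d : ℕ} (α β : MultiIndex d) (K : Space d → Space d → ℂ) (x y : Space d) : ℂ :=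
  mixedPartial α (fun x' => mixedPartial β (K x') y) x

/-- `K` is a standard kernel of order `N` with constants `A α β`. The smoothness off the diagonal
makes every derivative occurring in the bound a genuine one. -/
structure IsStandardKernel {d : ℕ} (N : ℕ) (A : MultiIndex d → MultiIndex d → ℝ)
    (K : Space d → Space d → ℂ) : Prop where
  contDiffOn : ContDiffOn ℝ ((2 * N : ℕ) : ℕ∞) (fun p : Space d × Space d => K p.1 p.2)
    {p | p.1 ≠ p.2}
  bound : ∀ α β : MultiIndex d, length α ≤ N → length β ≤ N → ∀ x y : Space d, x ≠ y →
    ‖kernelDeriv α β K x y‖ ≤ A α β * (1 / ‖x - y‖ ^ (d + length β + length α))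

/-- For every `f ∈ C_c^∞`, the distribution `T f` is, on the complement of the support of `f`, the
function `x ↦ ∫ K (x, y) f y dy`. -/
def IsAssociated {d : ℕ} (T : 𝓢(Space d, ℂ) →L[ℂ] 𝓢'(Space d, ℂ))
    (K : Space d → Space d → ℂ) : Prop :=
  ∀ f h : 𝓢(Space d, ℂ), HasCompactSupport f → HasCompactSupport h →
    Disjoint (tsupport f) (tsupport h) →
    T f h = ∫ x, h x * ∫ y, K x y * f y

/-- `T` is bounded on `L^2`: it is the restriction to `𝓢` of a bounded operator of `L^2`. -/
def IsBoundedL2 {d : ℕ} (T : 𝓢(Space d, ℂ) →L[ℂ] 𝓢'(Space d, ℂ)) : Prop :=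
  ∃ S : Lp ℂ 2 (volume : Measure (Space d)) →L[ℂ] Lp ℂ 2 (volume : Measure (Space d)),
    ∀ f : 𝓢(Space d, ℂ), T f = Lp.toTemperedDistribution (S (f.toLp 2))

/-- `T` is a Calderón–Zygmund operator of order `N`, with kernel constants `A α β`. -/
structure IsCalderonZygmund {d : ℕ} (N : ℕ) (A : MultiIndex d → MultiIndex d → ℝ)
    (T : 𝓢(Space d, ℂ) →L[ℂ] 𝓢'(Space d, ℂ)) : Prop where
  boundedL2 : IsBoundedL2 T
  exists_kernel : ∃ K : Space d → Space d → ℂ, IsStandardKernel N A K ∧ IsAssociated T K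

/-- The distribution `D` is the function `u`. -/
def IsGivenBy {d : ℕ} (D : 𝓢'(Space d, ℂ)) (u : Space d → ℂ) : Prop :=
  ∀ h : 𝓢(Space d, ℂ), Integrable (fun x => h x * u x) ∧ D h = ∫ x, h x * u x

/-! ### The model operator -/

/-- `ζ_t (x) = |t|^{-d} ζ (t^{-1} x)`. -/
def dil {d : ℕ} (t : ℝ) (ζ : Space d → ℂ) (x : Space d) : ℂ :=
  ((1 / |t| ^ d : ℝ) : ℂ) * ζ (t⁻¹ • x)

/-- The convolution `g ∗ f (x) = ∫ g y * f (x - y) dy`. -/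
def conv {d : ℕ} (g f : Space d → ℂ) : Space d → ℂ :=
  convolution g f (ContinuousLinearMap.mul ℝ ℂ) volume

/-- `Ψ_t (y) ∏ i, [Φ^i_{lam_i t} ∗ f_i] (x - ρ_i lam_i y)`. -/
def innerIntegrand {d n : ℕ} (Ψ : 𝓢(Space d, ℂ)) (Φ : Fin n → 𝓢(Space d, ℂ)) (ρ lam : Fin n → ℝ)
    (f : Fin n → Space d → ℂ) (x : Space d) (t : ℝ) (y : Space d) : ℂ :=
  dil t Ψ y * ∏ i, conv (dil (lam i * t) (Φ i)) (f i) (x - (ρ i * lam i) • y)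

/-- The integrand `L (t) (∫ Ψ_t (y) ∏ i, [Φ^i_{lam_i t} ∗ f_i] (x - ρ_i lam_i y) dy) / t`. -/
def outerIntegrand {d n : ℕ} (Ψ : 𝓢(Space d, ℂ)) (Φ : Fin n → 𝓢(Space d, ℂ)) (ρ lam : Fin n → ℝ)
    (L : ℝ → ℂ) (f : Fin n → Space d → ℂ) (x : Space d) (t : ℝ) : ℂ :=
  L t * (∫ y, innerIntegrand Ψ Φ ρ lam f x t y) / (t : ℂ)

/-- `U_{ρ,lam,L} (f_1, …, f_n) (x)`. -/
def modelU {d n : ℕ} (Ψ : 𝓢(Space d, ℂ)) (Φ : Fin n → 𝓢(Space d, ℂ)) (ρ lam : Fin n → ℝ)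
    (L : ℝ → ℂ) (f : Fin n → Space d → ℂ) (x : Space d) : ℂ :=
  ∫ t in Ioi (0 : ℝ), outerIntegrand Ψ Φ ρ lam L f x t

/-- Every integral in the definition of `U_{ρ,lam,L} (f_1, …, f_n) (x)` converges absolutely. -/
structure ModelConverges {d n : ℕ} (Ψ : 𝓢(Space d, ℂ)) (Φ : Fin n → 𝓢(Space d, ℂ))
    (ρ lam : Fin n → ℝ) (L : ℝ → ℂ) (f : Fin n → Space d → ℂ) (x : Space d) : Prop where
  conv : ∀ t > 0, ∀ i, ConvolutionExists (dil (lam i * t) (Φ i)) (f i)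
    (ContinuousLinearMap.mul ℝ ℂ) volume
  inner : ∀ t > 0, Integrable (innerIntegrand Ψ Φ ρ lam f x t)
  outer : IntegrableOn (outerIntegrand Ψ Φ ρ lam L f x) (Ioi 0)

/-- The spectrum of `Ψ` is contained in a corona around `0`. -/
def SpectrumInCorona {d : ℕ} (Ψ : 𝓢(Space d, ℂ)) : Prop :=
  ∃ a b : ℝ, 0 < a ∧ a < b ∧ tsupport (𝓕 Ψ : 𝓢(Space d, ℂ)) ⊆ {ξ | a ≤ ‖ξ‖ ∧ ‖ξ‖ ≤ b}

/-- The spectrum of `Φ` is bounded. -/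
def SpectrumBounded {d : ℕ} (Φ : 𝓢(Space d, ℂ)) : Prop :=
  ∃ R : ℝ, tsupport (𝓕 Φ : 𝓢(Space d, ℂ)) ⊆ Metric.closedBall 0 R

end Paraproduct

end

/-! After the substitution y = tu the operator is ∫ L(t) S_t(x) dt/t. Here S_t (`slice`) integrates
Ψ(u) against the product of the averages of f_i with the kernels φ_i = (Φ^i)_{λ_i} at scale t,
evaluated at x − c_i t u with c_i = ρ_i λ_i. Three things are needed: convergence, an L² bound in
the last entry, and kernel estimates. Only the constants A_{0,β} must be uniform in λ and ρ; the L²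
bound may depend on all the data.

Convergence (`integrableOn_slice`). Since ∫ Ψ = 0 and the entries are differentiable at x, S_t(x) =
O(t) near t = 0; since the last entry is integrable, S_t(x) = O(t^{-d}) for large t.

L² bound. Pair S_t with a test function h. The product of the averages has spectrum in a ball of
radius O(1/t), so h may be replaced by an average of itself at scale t. This gives a form with one
more factor, in which two entries are in L² and the others are bounded (`exists_sum_pairing_le`).
Each kernel is then cut into a low and a high frequency part. A term with at most one high factor
vanishes (`form_eq_zero`): if the exceptional factor is also fairly low, the u-integral is zero
because Ψ has no low frequencies; otherwise the x-integral is zero because one frequency cannot be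
balanced by the others. A term with two high factors is estimated by Cauchy–Schwarz
(`exists_sum_form_le_of_high`), each high factor being matched with one of the two L² entries. If
the factor is that of the L² entry itself, Plancherel suffices; if it belongs to a bounded entry,
Carleson's embedding is needed (`exists_carleson_embedding`).

The embedding is obtained by a convexity argument. For Gaussian averages f_t, g_t with |f| ≤ A, the
quantity ∫ (2|f_t|²|g_t|² + 16A²|g_t|²) decreases when t is doubled, and up to the factor 2^d the
loss dominates the term to be summed (`carleson_step`); hence the dyadic sum telescopes. A kernel
with spectrum in a corona is an average of differences of Gaussians, which gives the general case.
Integrating the dyadic sums over one octave bounds the integral against dt/t; duality, Fatou's lemma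
and density of Schwartz functions then give a bounded operator of L².

Kernel. Writing out the last average produces the explicit kernel `ker`. The decay of the Schwartz
kernel κ of that average replaces t^{-(k+1)} by (t + |x − z|)^{-(k+1)}, whose integral in t is of
order |x − z|^{-k}. A derivative in x or z falls on Schwartz kernels, never on the f_j, costs one
factor 1/t and yields a sum of kernels of the same shape, so all orders follow by induction
(`kerSpan_fderiv`). A derivative in z falls on κ alone. The bound for A_{0,β} therefore involves
only the sup norms of the f_j and the L¹ norms of the φ_j, which are invariant under dilation. The
powers of λ_n cancel by homogeneity, and ρ_n ≤ 1 controls the shift of κ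
(`exists_norm_kernelDeriv_zero_le`). -/

noncomputable section

open scoped ENNReal LineDeriv

namespace Paraproduct

/-! ### Averages at scale t: integrability, composition, Fourier representation -/

section

variable {d : ℕ}

/-- The average `∫ κ w * f (x - t w) dw`, that is `κ_t ∗ f` for `t ≠ 0`. -/
def moll (κ f : Space d → ℂ) (t : ℝ) (x : Space d) : ℂ := ∫ w, κ w * f (x - t • w)

theorem integrable_mul_bounded {κ f : Space d → ℂ} {M : ℝ} (hκ : Integrable κ) (hf : Measurable f)
    (hM : ∀ x, ‖f x‖ ≤ M) (t : ℝ) (x : Space d) : Integrable fun w => κ w * f (x - t • w) := by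
  refine hκ.mul_bdd (c := M) ?_ (Filter.Eventually.of_forall fun w => hM _)
  exact (hf.comp (by fun_prop)).aestronglyMeasurable

theorem norm_moll_le {κ f : Space d → ℂ} {M : ℝ} (hκ : Integrable κ)
    (hM : ∀ x, ‖f x‖ ≤ M) (t : ℝ) (x : Space d) : ‖moll κ f t x‖ ≤ (∫ w, ‖κ w‖) * M := by
  rw [moll, ← integral_mul_const]
  refine norm_integral_le_of_norm_le (hκ.norm.mul_const _) (Filter.Eventually.of_forall fun w => ?_)
  rw [norm_mul]
  exact mul_le_mul_of_nonneg_left (hM _) (norm_nonneg _)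

theorem measurable_moll {κ f : Space d → ℂ} (hκ : Measurable κ) (hf : Measurable f) :
    Measurable fun p : ℝ × Space d => moll κ f p.1 p.2 := by
  have : StronglyMeasurable fun q : (ℝ × Space d) × Space d => κ q.2 * f (q.1.2 - q.1.1 • q.2) := by
    refine Measurable.stronglyMeasurable ?_
    exact (hκ.comp measurable_snd).mul (hf.comp (by fun_prop))
  exact this.integral_prod_right.measurable

theorem measurable_moll_right {κ f : Space d → ℂ} (hκ : Measurable κ) (hf : Measurable f) (t : ℝ) :
    Measurable (moll κ f t) :=
  (measurable_moll hκ hf).comp (by fun_prop : Measurable fun x : Space d => (t, x))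

theorem moll_add {κ κ' f : Space d → ℂ} {M : ℝ} (hκ : Integrable κ) (hκ' : Integrable κ')
    (hf : Measurable f) (hM : ∀ x, ‖f x‖ ≤ M) (t : ℝ) (x : Space d) :
    moll (fun w => κ w + κ' w) f t x = moll κ f t x + moll κ' f t x := by
  simp only [moll, add_mul]
  exact integral_add (integrable_mul_bounded hκ hf hM t x) (integrable_mul_bounded hκ' hf hM t x)

theorem moll_sub {κ κ' f : Space d → ℂ} {M : ℝ} (hκ : Integrable κ) (hκ' : Integrable κ')
    (hf : Measurable f) (hM : ∀ x, ‖f x‖ ≤ M) (t : ℝ) (x : Space d) :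
    moll (fun w => κ w - κ' w) f t x = moll κ f t x - moll κ' f t x := by
  simp only [moll, sub_mul]
  exact integral_sub (integrable_mul_bounded hκ hf hM t x) (integrable_mul_bounded hκ' hf hM t x)

theorem moll_const_mul (c : ℂ) (κ f : Space d → ℂ) (t : ℝ) (x : Space d) :
    moll (fun w => c * κ w) f t x = c * moll κ f t x := by
  simp only [moll, mul_assoc]
  exact integral_const_mul _ _

/-- Translating the kernel translates the average. -/
theorem moll_comp_sub (κ f : Space d → ℂ) (v : Space d) (t : ℝ) (x : Space d) :
    moll (fun w => κ (w - v)) f t x = moll κ f t (x - t • v) := by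
  simp only [moll]
  rw [← integral_sub_right_eq_self (fun w => κ w * f (x - t • v - t • w)) v]
  congr 1; ext w; congr 2; module

/-- The shear (x, w) ↦ (x − t w, w) preserves the product measure and carries the tensor product of
f and κ to this function. This is what justifies the later uses of Fubini. -/
theorem integrable_prod_moll {κ f : Space d → ℂ} (hκ : Integrable κ) (hf : Integrable f)
    (t : ℝ) : Integrable (fun q : Space d × Space d => κ q.2 * f (q.1 - t • q.2))
      (volume.prod volume) := by
  have h1 : Integrable (fun q : Space d × Space d => f q.1 * κ q.2) (volume.prod volume) :=
    hf.mul_prod hκ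
  have h2 : MeasurePreserving (fun q : Space d × Space d => (q.1 - t • q.2, q.2))
      (volume.prod volume) (volume.prod volume) := by
    have h3 : MeasurePreserving (fun q : Space d × Space d => (q.1, q.2 - t • q.1))
        (volume.prod volume) (volume.prod volume) := by
      refine MeasurePreserving.skew_product (f := id) (g := fun a b => b - t • a)
        (MeasurePreserving.id _) (by fun_prop) (Filter.Eventually.of_forall fun a => ?_)
      exact (measurePreserving_sub_right volume (t • a)).map_eq
    exact (Measure.measurePreserving_swap.comp h3).comp Measure.measurePreserving_swap
  have := h2.integrable_comp_of_integrable h1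
  refine this.congr (Filter.Eventually.of_forall fun q => ?_)
  simp [mul_comm]

theorem integrable_moll {κ f : Space d → ℂ} (hκ : Integrable κ) (hf : Integrable f)
    (t : ℝ) : Integrable (moll κ f t) :=
  (integrable_prod_moll hκ hf t).integral_prod_left

/-- Iterated averages. -/
theorem moll_moll {η κ f : Space d → ℂ} {M : ℝ} (hη : Integrable η) (hκ : Integrable κ)
    (hf : Measurable f) (hM : ∀ x, ‖f x‖ ≤ M) (r t : ℝ) (x : Space d) :
    moll η (moll κ f (r * t)) t x = moll (moll κ η r) f t x := by
  have h1 : Integrable (fun q : Space d × Space d => κ q.2 * η (q.1 - r • q.2) * f (x - t • q.1))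
      (volume.prod volume) := by
    refine (integrable_prod_moll hκ hη r).mul_bdd (c := M) ?_
      (Filter.Eventually.of_forall fun w => hM _)
    exact (hf.comp (by fun_prop)).aestronglyMeasurable
  calc moll η (moll κ f (r * t)) t x
      = ∫ w, ∫ w', κ w' * η w * f (x - t • (w + r • w')) := by
        simp only [moll, ← integral_const_mul]
        congr 1; ext w; congr 1; ext w'
        rw [show x - t • w - (r * t) • w' = x - t • (w + r • w') by module]; ring
    _ = ∫ w', ∫ w, κ w' * η w * f (x - t • (w + r • w')) := by
        refine integral_integral_swap ?_
        have h2 : Integrable (fun q : Space d × Space d => η q.1 * κ q.2) (volume.prod volume) :=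
          hη.mul_prod hκ
        refine ((h2.mul_bdd (c := M) (g := fun q => f (x - t • (q.1 + r • q.2))) ?_
          (Filter.Eventually.of_forall fun w => hM _))).congr
            (Filter.Eventually.of_forall fun q => ?_)
        · exact (hf.comp (by fun_prop)).aestronglyMeasurable
        · simp [Function.uncurry, mul_comm]
    _ = ∫ w', ∫ w, κ w' * η (w - r • w') * f (x - t • w) := by
        congr 1; ext w'
        rw [← integral_sub_right_eq_self (fun w => κ w' * η w * f (x - t • (w + r • w'))) (r • w')]
        simp
    _ = ∫ w, ∫ w', κ w' * η (w - r • w') * f (x - t • w) :=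
        (integral_integral_swap h1).symm
    _ = moll (moll κ η r) f t x := by
        simp only [moll, integral_mul_const]

/-- Fourier inversion is inserted for g only, so κ need not be more than integrable; the exchange of
integrals is the multiplication formula for the pairing t⟨w, ξ⟩. -/
theorem moll_eq_fourierInv {κ : Space d → ℂ} (hκ : Integrable κ) (g : 𝓢(Space d, ℂ)) (t : ℝ)
    (x : Space d) :
    moll κ g t x = 𝓕⁻ (fun ξ => 𝓕 κ (t • ξ) * 𝓕 g ξ) x := by
  have hG : Integrable (fun ξ : Space d => Real.fourierChar (inner ℝ ξ x) • 𝓕 g ξ) := by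
    have := (Real.fourierIntegral_convergent_iff (V := Space d) (-x)).2
      (SchwartzMap.integrable (μ := volume) (𝓕 g : 𝓢(Space d, ℂ)))
    simpa using this
  have key := VectorFourier.integral_fourierIntegral_smul_eq_flip (e := Real.fourierChar)
    (L := t • innerₗ (Space d)) (μ := volume) (ν := volume) Real.continuous_fourierChar
    (by simp only [LinearMap.smul_apply, innerₗ_apply_apply]; fun_prop) hκ hG
  rw [Real.fourierInv_eq]
  trans ∫ ξ, VectorFourier.fourierIntegral Real.fourierChar volume (t • innerₗ (Space d)) κ ξ •
    (Real.fourierChar (inner ℝ ξ x) • 𝓕 g ξ)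
  · rw [key]
    simp only [moll]
    congr 1; ext w
    rw [smul_eq_mul]; congr 1
    have h0 : g (x - t • w) = 𝓕⁻ (𝓕 g : 𝓢(Space d, ℂ)) (x - t • w) := by
      simp
    rw [h0, SchwartzMap.fourierInv_coe, Real.fourierInv_eq]
    simp only [VectorFourier.fourierIntegral, LinearMap.flip_apply, LinearMap.smul_apply,
      innerₗ_apply_apply]
    congr 1; ext ξ
    rw [smul_smul, ← AddChar.map_add_eq_mul]
    congr 2
    rw [inner_sub_right, inner_smul_right, smul_eq_mul, real_inner_comm w]; ring
  · congr 1; ext ξ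
    have : VectorFourier.fourierIntegral Real.fourierChar volume (t • innerₗ (Space d)) κ ξ =
        𝓕 κ (t • ξ) := by
      rw [Real.fourier_eq]
      simp only [VectorFourier.fourierIntegral, LinearMap.smul_apply,
        innerₗ_apply_apply, inner_smul_right, smul_eq_mul]
    rw [this, smul_eq_mul, mul_smul_comm]

end

/-! ### Spectra of bounded functions, defined by duality -/

section

variable {d : ℕ}

theorem moll_translate (κ f : Space d → ℂ) (a : Space d) (t : ℝ) (x : Space d) :
    moll κ f t (x - a) = moll κ (fun y => f (y - a)) t x := by
  simp only [moll]
  congr 1; ext w; congr 2; module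

theorem fourier_modulate (ϕ : Space d → ℂ) (ξ η : Space d) :
    𝓕 (fun x => (Real.fourierChar (-inner ℝ x ξ) : ℂ) * ϕ x) η = 𝓕 ϕ (η + ξ) := by
  simp only [Real.fourier_eq]
  congr 1; ext x
  rw [inner_add_right, neg_add, AddChar.map_add_eq_mul, mul_smul]
  simp [Circle.smul_def]

theorem integrable_modulate {ϕ : Space d → ℂ} (h : Integrable ϕ) (ξ : Space d) :
    Integrable (fun x => (Real.fourierChar (-inner ℝ x ξ) : ℂ) * ϕ x) := by
  have := (Real.fourierIntegral_convergent_iff (V := Space d) ξ).2 h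
  simpa [Circle.smul_def] using this

theorem fourier_moll {κ f : Space d → ℂ} (hκ : Integrable κ) (hf : Integrable f) (t : ℝ)
    (ξ : Space d) : 𝓕 (moll κ f t) ξ = 𝓕 κ (t • ξ) * 𝓕 f ξ := by
  have h1 : Integrable (fun q : Space d × Space d =>
      (Real.fourierChar (-inner ℝ q.1 ξ) : ℂ) * (κ q.2 * f (q.1 - t • q.2)))
      (volume.prod volume) := by
    refine (integrable_prod_moll hκ hf t).bdd_mul (c := 1) ?_
      (Filter.Eventually.of_forall fun q => (Circle.norm_coe _).le)
    exact (continuous_subtype_val.comp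
      (Real.continuous_fourierChar.comp (by fun_prop))).aestronglyMeasurable
  calc 𝓕 (moll κ f t) ξ
      = ∫ x, ∫ w, (Real.fourierChar (-inner ℝ x ξ) : ℂ) * (κ w * f (x - t • w)) := by
        rw [Real.fourier_eq]
        congr 1; ext x
        rw [Circle.smul_def, smul_eq_mul, moll, ← integral_const_mul]
    _ = ∫ w, ∫ x, (Real.fourierChar (-inner ℝ x ξ) : ℂ) * (κ w * f (x - t • w)) :=
        integral_integral_swap h1
    _ = ∫ w, ∫ x, ((Real.fourierChar (-inner ℝ w (t • ξ)) : ℂ) * κ w) *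
          ((Real.fourierChar (-inner ℝ x ξ) : ℂ) * f x) := by
        congr 1; ext w
        rw [← integral_sub_right_eq_self (fun x => ((Real.fourierChar (-inner ℝ w (t • ξ)) : ℂ) *
          κ w) * ((Real.fourierChar (-inner ℝ x ξ) : ℂ) * f x)) (t • w)]
        congr 1; ext x
        have : (Real.fourierChar (-inner ℝ x ξ) : ℂ) = Real.fourierChar (-inner ℝ w (t • ξ)) *
            Real.fourierChar (-inner ℝ (x - t • w) ξ) := by
          rw [← Circle.coe_mul, ← AddChar.map_add_eq_mul]
          congr 2
          rw [inner_sub_left, inner_smul_left, inner_smul_right]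
          simp only [conj_trivial]; ring
        rw [this]; ring
    _ = 𝓕 κ (t • ξ) * 𝓕 f ξ := by
        simp only [integral_const_mul, integral_mul_const, Real.fourier_eq, Circle.smul_def,
          smul_eq_mul]

/-- Averages whose kernel has no frequency in common with an integrable function are orthogonal
to it. -/
theorem integral_moll_mul_eq_zero {κ : 𝓢(Space d, ℂ)} {f ϕ : Space d → ℂ} {M : ℝ}
    (hf : Measurable f) (hM : ∀ x, ‖f x‖ ≤ M) (hϕ : Integrable ϕ) {t : ℝ} (ht : 0 < t)
    (h : ∀ ξ, 𝓕 κ (t • ξ) = 0 ∨ 𝓕 ϕ (-ξ) = 0) :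
    ∫ x, moll κ f t x * ϕ x = 0 := by
  -- Writing κ as the inverse transform of 𝓕κ and applying the multiplication formula turns this
  -- into ∫ of 𝓕κ times a modulated rescaling of 𝓕ϕ at opposite frequencies, where one factor always
  -- vanishes.
  have hin : ∀ z, ∫ w, ϕ (z + t • w) * κ w = 0 := by
    intro z
    have hϕz : Integrable fun w => ϕ (z + t • w) :=
      (hϕ.comp_add_left z).comp_smul ht.ne'
    have key := VectorFourier.integral_fourierIntegral_smul_eq_flip (e := Real.fourierChar)
      (L := -innerₗ (Space d)) (μ := volume) (ν := volume) Real.continuous_fourierChar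
      (by simp only [LinearMap.neg_apply, innerₗ_apply_apply]; fun_prop) hϕz
      (SchwartzMap.integrable (μ := volume) (𝓕 κ : 𝓢(Space d, ℂ)))
    have e1 : ∀ w, VectorFourier.fourierIntegral Real.fourierChar volume (-innerₗ (Space d)).flip
        (𝓕 κ : 𝓢(Space d, ℂ)) w = κ w := by
      intro w
      have h0 : κ w = 𝓕⁻ (𝓕 κ : 𝓢(Space d, ℂ)) w := by simp
      rw [h0, SchwartzMap.fourierInv_coe, Real.fourierInv_eq]
      simp only [VectorFourier.fourierIntegral, LinearMap.flip_apply, LinearMap.neg_apply,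
        innerₗ_apply_apply, neg_neg]
      congr 1; ext ξ; rw [real_inner_comm]
    simp only [e1, smul_eq_mul] at key
    rw [← key]
    refine integral_eq_zero_of_ae (Filter.Eventually.of_forall fun η => ?_)
    rcases h (t⁻¹ • η) with h | h
    · rw [smul_smul, mul_inv_cancel₀ ht.ne', one_smul] at h
      simp [h]
    · have e2 : VectorFourier.fourierIntegral Real.fourierChar volume (-innerₗ (Space d))
          (fun w => ϕ (z + t • w)) η = 0 := by
        simp only [VectorFourier.fourierIntegral, LinearMap.neg_apply, innerₗ_apply_apply, neg_neg]
        have e3 : (fun w => Real.fourierChar (inner ℝ w η) • ϕ (z + t • w)) = fun w =>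
            (fun y => Real.fourierChar (inner ℝ (y - z) (t⁻¹ • η)) • ϕ y) (z + t • w) := by
          ext w
          simp only [add_sub_cancel_left, inner_smul_left, inner_smul_right]
          congr 3
          simp only [conj_trivial]
          field_simp
        rw [e3, Measure.integral_comp_smul volume (fun w' =>
          (fun y => Real.fourierChar (inner ℝ (y - z) (t⁻¹ • η)) • ϕ y) (z + w')) t,
          integral_add_left_eq_self
            (fun y => Real.fourierChar (inner ℝ (y - z) (t⁻¹ • η)) • ϕ y) z]
        have e4 : ∀ y, Real.fourierChar (inner ℝ (y - z) (t⁻¹ • η)) • ϕ y =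
            (Real.fourierChar (-inner ℝ z (t⁻¹ • η)) : ℂ) *
              (Real.fourierChar (-inner ℝ y (-(t⁻¹ • η))) • ϕ y) := by
          intro y
          rw [inner_sub_left, sub_eq_neg_add, AddChar.map_add_eq_mul, inner_neg_right, neg_neg,
            mul_smul, Circle.smul_def, smul_eq_mul]
        simp only [e4, integral_const_mul]
        rw [← Real.fourier_eq, h]; simp
      simp [e2]
  have h1 : Integrable (fun q : Space d × Space d => f q.1 * (ϕ (q.1 + t • q.2) * κ q.2))
      (volume.prod volume) := by
    refine Integrable.bdd_mul (c := M) ?_ (hf.comp measurable_fst).aestronglyMeasurable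
      (Filter.Eventually.of_forall fun w => hM _)
    have := integrable_prod_moll (SchwartzMap.integrable (μ := volume) κ) hϕ (-t)
    refine this.congr (Filter.Eventually.of_forall fun q => ?_)
    simp [mul_comm]
  have h2 : Integrable (fun q : Space d × Space d => f (q.1 - t • q.2) * (ϕ q.1 * κ q.2))
      (volume.prod volume) := by
    refine Integrable.bdd_mul (c := M) (hϕ.mul_prod (SchwartzMap.integrable (μ := volume) κ))
      (hf.comp (by fun_prop)).aestronglyMeasurable (Filter.Eventually.of_forall fun w => hM _)
  calc ∫ x, moll κ f t x * ϕ x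
      = ∫ x, ∫ w, f (x - t • w) * (ϕ x * κ w) := by
        simp only [moll, ← integral_mul_const]
        congr 1; ext x; congr 1; ext w; ring
    _ = ∫ w, ∫ x, f (x - t • w) * (ϕ x * κ w) := integral_integral_swap h2
    _ = ∫ w, ∫ x, f x * (ϕ (x + t • w) * κ w) := by
        congr 1; ext w
        rw [← integral_sub_right_eq_self (fun x => f x * (ϕ (x + t • w) * κ w)) (t • w)]
        simp
    _ = ∫ x, ∫ w, f x * (ϕ (x + t • w) * κ w) := (integral_integral_swap h1).symm
    _ = 0 := by simp [integral_const_mul, hin]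

/-- The bounded function `F` has its spectrum in the closed ball of radius `R`: it is orthogonal
to the integrable functions whose Fourier transform vanishes on this ball. -/
def HasSpec (R : ℝ) (F : Space d → ℂ) : Prop :=
  ∀ ϕ : Space d → ℂ, Integrable ϕ → (∀ ξ, ‖ξ‖ ≤ R → 𝓕 ϕ ξ = 0) → ∫ x, F x * ϕ x = 0

/-- A test function whose transform vanishes on the ball of radius R/t shares no frequency with the
kernel at scale t. The ball is symmetric, so the reflection ξ ↦ −ξ is harmless. -/
theorem hasSpec_moll {κ : 𝓢(Space d, ℂ)} {f : Space d → ℂ} {M R : ℝ}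
    (hf : Measurable f) (hM : ∀ x, ‖f x‖ ≤ M) {t : ℝ} (ht : 0 < t)
    (hκ : ∀ ξ, R < ‖ξ‖ → 𝓕 κ ξ = 0) : HasSpec (R / t) (moll κ f t) := by
  intro ϕ hϕ h
  refine integral_moll_mul_eq_zero hf hM hϕ ht fun ξ => ?_
  rcases le_or_gt ‖ξ‖ (R / t) with h' | h'
  · right; apply h; simpa using h'
  · left; apply hκ; rw [norm_smul, Real.norm_of_nonneg ht.le, mul_comm]
    rwa [div_lt_iff₀ ht] at h'

theorem HasSpec.mono {R R' : ℝ} {F : Space d → ℂ} (h : HasSpec R F) (hR : R ≤ R') :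
    HasSpec R' F := fun ϕ hϕ h' => h ϕ hϕ fun ξ hξ => h' ξ (hξ.trans hR)

theorem integral_eq_fourier_zero (ϕ : Space d → ℂ) : ∫ x, ϕ x = 𝓕 ϕ 0 := by
  simp [Real.fourier_eq]

/-- For c ≠ 0 the dilation is moved to the test function. For c = 0 the function is constant, and
the test function has integral zero because the ball of radius 0 contains the origin. -/
theorem HasSpec.comp_affine {R : ℝ} {F : Space d → ℂ} (h : HasSpec R F) (x : Space d) (c : ℝ) :
    HasSpec (|c| * R) fun u => F (x - c • u) := by
  intro ϕ hϕ h'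
  rcases eq_or_ne c 0 with rfl | hc
  · have : ∫ x, ϕ x = 0 := by rw [integral_eq_fourier_zero]; apply h'; simp
    simp [integral_const_mul, this]
  have e1 : (fun u => F (x - c • u) * ϕ u) = fun u =>
      (fun y => F (x - y) * ϕ (c⁻¹ • y)) (c • u) := by
    ext u; simp [smul_smul, inv_mul_cancel₀ hc]
  rw [e1, Measure.integral_comp_smul volume (fun y => F (x - y) * ϕ (c⁻¹ • y)) c]
  have e2 : ∫ y, F (x - y) * ϕ (c⁻¹ • y) = ∫ y, F y * ϕ (c⁻¹ • (x - y)) := by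
    rw [← integral_sub_left_eq_self (fun y => F y * ϕ (c⁻¹ • (x - y))) _ x]
    simp
  rw [e2, h, smul_zero]
  · exact (hϕ.comp_smul (inv_ne_zero hc)).comp_sub_left x
  intro ξ hξ
  rw [Real.fourier_eq]
  rw [← integral_sub_left_eq_self _ _ x]
  have e3 : (fun y => Real.fourierChar (-inner ℝ (x - y) ξ) • ϕ (c⁻¹ • (x - (x - y)))) = fun y =>
      (fun z => (Real.fourierChar (-inner ℝ x ξ) : ℂ) *
        (Real.fourierChar (-inner ℝ z (-(c • ξ))) • ϕ z)) (c⁻¹ • y) := by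
    ext y
    simp only [sub_sub_cancel, inner_sub_left, inner_neg_right, inner_smul_left, inner_smul_right,
      neg_neg, neg_sub]
    rw [sub_eq_neg_add, AddChar.map_add_eq_mul, mul_smul, Circle.smul_def, smul_eq_mul]
    congr 4
    simp only [conj_trivial]
    field_simp
  rw [e3, Measure.integral_comp_smul volume (fun z => (Real.fourierChar (-inner ℝ x ξ) : ℂ) *
        (Real.fourierChar (-inner ℝ z (-(c • ξ))) • ϕ z)) c⁻¹, integral_const_mul,
    ← Real.fourier_eq, h']
  · simp
  · rw [norm_neg, norm_smul, Real.norm_eq_abs]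
    exact mul_le_mul_of_nonneg_left hξ (abs_nonneg c)

/-- Frequencies add. Testing F against Gϕ requires 𝓕(Gϕ)(ξ) = 0 for |ξ| ≤ R. This value is G tested
against a modulation of ϕ, whose transform η ↦ 𝓕ϕ(η + ξ) vanishes for |η| ≤ R'. -/
theorem HasSpec.mul {R R' M : ℝ} {F G : Space d → ℂ} (hF : HasSpec R F) (hG : HasSpec R' G)
    (hGm : Measurable G) (hGM : ∀ x, ‖G x‖ ≤ M) : HasSpec (R + R') fun x => F x * G x := by
  intro ϕ hϕ h
  have hi : Integrable fun x => G x * ϕ x :=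
    hϕ.bdd_mul hGm.aestronglyMeasurable (Filter.Eventually.of_forall hGM)
  have := hF _ hi fun ξ hξ => by
    have e1 : 𝓕 (fun x => G x * ϕ x) ξ =
        ∫ x, G x * ((Real.fourierChar (-inner ℝ x ξ) : ℂ) * ϕ x) := by
      rw [Real.fourier_eq]; congr 1; ext x; rw [Circle.smul_def, smul_eq_mul]; ring
    rw [e1]
    refine hG _ (integrable_modulate hϕ ξ) fun η hη => ?_
    rw [fourier_modulate]
    apply h
    calc ‖η + ξ‖ ≤ ‖η‖ + ‖ξ‖ := norm_add_le _ _
      _ ≤ R + R' := by linarith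
  rw [← this]; congr 1; ext x; ring

theorem hasSpec_prod {ι : Type*} (s : Finset ι) {R M : ι → ℝ} {F : ι → Space d → ℂ}
    (h : ∀ i ∈ s, HasSpec (R i) (F i)) (hm : ∀ i ∈ s, Measurable (F i))
    (hM : ∀ i ∈ s, ∀ x, ‖F i x‖ ≤ M i) :
    HasSpec (∑ i ∈ s, R i) fun x => ∏ i ∈ s, F i x := by
  classical
  induction s using Finset.induction_on with
  | empty =>
    intro ϕ hϕ h'
    simp only [Finset.prod_empty, one_mul]
    rw [integral_eq_fourier_zero]; apply h'; simp
  | insert a s ha ih =>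
    simp only [Finset.prod_insert ha, Finset.sum_insert ha]
    refine HasSpec.mul (M := ∏ i ∈ s, M i) (h a (by simp)) (ih (fun i hi => h i (by simp [hi]))
      (fun i hi => hm i (by simp [hi])) (fun i hi => hM i (by simp [hi])))
      (Finset.measurable_fun_prod _ fun i hi => hm i (by simp [hi])) fun x => ?_
    rw [norm_prod]
    exact Finset.prod_le_prod (fun _ _ => norm_nonneg _) fun i hi => hM i (by simp [hi]) x

end

/-! ### Frequency splitting and vanishing of the low frequency forms -/

section

variable {d : ℕ}

/-- Splitting of a Schwartz function into a low and a high frequency part. -/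
theorem exists_low_high (φ : 𝓢(Space d, ℂ)) {r : ℝ} (hr : 0 < r) :
    ∃ lo hi : 𝓢(Space d, ℂ), (∀ x, φ x = lo x + hi x) ∧ (∀ ξ, 2 * r < ‖ξ‖ → 𝓕 lo ξ = 0) ∧
      (∀ ξ, ‖ξ‖ ≤ r → 𝓕 hi ξ = 0) ∧ (∀ ξ, 𝓕 φ ξ = 0 → 𝓕 hi ξ = 0) ∧
      (∀ ξ, 𝓕 φ ξ = 0 → 𝓕 lo ξ = 0) := by
  let χ : ContDiffBump (0 : Space d) := ⟨r, 2 * r, hr, by linarith⟩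
  have hχ : Function.HasTemperateGrowth (χ : Space d → ℝ) :=
    χ.hasCompactSupport.hasTemperateGrowth χ.contDiff
  let lo : 𝓢(Space d, ℂ) := SchwartzMap.fourierMultiplierCLM ℂ (χ : Space d → ℝ) φ
  have hlo : ∀ ξ, 𝓕 lo ξ = χ ξ • 𝓕 φ ξ := by
    intro ξ
    simp only [lo, SchwartzMap.fourierMultiplierCLM_apply, FourierTransform.fourier_fourierInv_eq]
    rw [SchwartzMap.smulLeftCLM_apply_apply hχ]
  have hhi : ∀ ξ, 𝓕 (φ - lo) ξ = 𝓕 φ ξ - χ ξ • 𝓕 φ ξ := by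
    intro ξ
    rw [← hlo]
    have := map_sub (FourierTransform.fourierCLM ℂ 𝓢(Space d, ℂ)) φ lo
    simp only [FourierTransform.fourierCLM_apply] at this
    rw [this]; rfl
  refine ⟨lo, φ - lo, fun x => by simp, fun ξ hξ => ?_, fun ξ hξ => ?_, fun ξ hξ => ?_,
    fun ξ hξ => ?_⟩
  · rw [hlo, χ.zero_of_le_dist (by simpa [χ] using hξ.le), zero_smul]
  · rw [hhi, χ.one_of_mem_closedBall (by simpa [χ] using hξ), one_smul, sub_self]
  · rw [hhi, hξ]; simp
  · rw [hlo, hξ]; simp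

variable {ι : Type*} [Fintype ι]

/-- As a function of u, the i-th factor is dilated by c_i t, which changes its spectral radius r_i/t
into |c_i| r_i, independent of t. The product then lives on frequencies at which 𝓕Ψ vanishes. -/
theorem integral_prod_moll_eq_zero {Ψ : 𝓢(Space d, ℂ)} {φ : ι → 𝓢(Space d, ℂ)}
    {f : ι → Space d → ℂ} {M r : ι → ℝ} {a : ℝ}
    (hf : ∀ i, Measurable (f i)) (hM : ∀ i x, ‖f i x‖ ≤ M i)
    (hΨ : ∀ ξ, ‖ξ‖ ≤ a → 𝓕 Ψ ξ = 0) (hφ : ∀ i ξ, r i < ‖ξ‖ → 𝓕 (φ i) ξ = 0)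
    (c : ι → ℝ) (ha : ∑ i, |c i| * r i ≤ a) {t : ℝ} (ht : 0 < t) (x : Space d) :
    ∫ u, Ψ u * ∏ i, moll (φ i) (f i) t (x - (c i * t) • u) = 0 := by
  have h1 : HasSpec (∑ i, |c i| * r i)
      (fun u => ∏ i, moll (φ i) (f i) t (x - (c i * t) • u)) := by
    refine hasSpec_prod _ (M := fun i => (∫ w, ‖φ i w‖) * M i) (fun i _ => ?_) (fun i _ => ?_)
      (fun i _ u => ?_)
    · have := (hasSpec_moll (hf i) (hM i) ht (hφ i)).comp_affine x (c i * t)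
      refine this.mono (le_of_eq ?_)
      rw [abs_mul, abs_of_pos ht]; field_simp
    · exact (measurable_moll_right (φ i).continuous.measurable (hf i) t).comp (by fun_prop)
    · exact norm_moll_le (φ i).integrable (hM i) t _
  have := (h1.mono ha) Ψ Ψ.integrable (fun ξ hξ => hΨ ξ hξ)
  rw [← this]; congr 1; ext u; ring

variable [DecidableEq ι]

theorem integrable_form {Ψ : Space d → ℂ} {F : ι → Space d → ℂ} {M : ι → ℝ} {l : ι}
    (hΨ : Integrable Ψ) (hF : ∀ i, Measurable (F i)) (hM : ∀ i x, ‖F i x‖ ≤ M i)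
    (hl : Integrable (F l)) (c : ι → ℝ) :
    Integrable (fun q : Space d × Space d => Ψ q.2 * ∏ i, F i (q.1 - c i • q.2))
      (volume.prod volume) := by
  have h1 := integrable_prod_moll hΨ hl (c l)
  have := h1.mul_bdd (c := ∏ i ∈ Finset.univ.erase l, M i)
    (g := fun q => ∏ i ∈ Finset.univ.erase l, F i (q.1 - c i • q.2))
    (Finset.measurable_fun_prod _ fun i _ => (hF i).comp (by fun_prop)).aestronglyMeasurable
    (Filter.Eventually.of_forall fun q => by
      rw [norm_prod]
      exact Finset.prod_le_prod (fun _ _ => norm_nonneg _) fun i hi => hM i _)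
  refine this.congr (Filter.Eventually.of_forall fun q => ?_)
  simp only
  rw [mul_assoc, Finset.mul_prod_erase _ (fun i => F i (q.1 - c i • q.2)) (Finset.mem_univ l)]

/-- The frequencies of the factors must sum to zero, which is impossible if the j-th one exceeds all
the others together. The entry l ≠ j is integrable, so the product of the factors other than j is an
admissible test function. -/
theorem integral_prod_moll_translate_eq_zero {φ : ι → 𝓢(Space d, ℂ)}
    {f : ι → Space d → ℂ} {M r : ι → ℝ} {j l : ι} (hlj : l ≠ j)
    (hf : ∀ i, Measurable (f i)) (hM : ∀ i x, ‖f i x‖ ≤ M i) (hl : Integrable (f l))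
    (hφ : ∀ i, i ≠ j → ∀ ξ, r i < ‖ξ‖ → 𝓕 (φ i) ξ = 0)
    (hj : ∀ ξ, ‖ξ‖ ≤ ∑ i ∈ Finset.univ.erase j, r i → 𝓕 (φ j) ξ = 0)
    {t : ℝ} (ht : 0 < t) (b : ι → Space d) :
    ∫ x, ∏ i, moll (φ i) (f i) t (x - b i) = 0 := by
  set F : ι → Space d → ℂ := fun i x => moll (φ i) (f i) t (x - b i) with hF
  have hFm : ∀ i, Measurable (F i) := fun i =>
    (measurable_moll_right (φ i).continuous.measurable (hf i) t).comp (by fun_prop)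
  have hFb : ∀ i x, ‖F i x‖ ≤ (∫ w, ‖φ i w‖) * M i := fun i x =>
    norm_moll_le (φ i).integrable (hM i) t _
  have hFl : Integrable (F l) :=
    (integrable_moll (φ l).integrable hl t).comp_sub_right (b l)
  set s := (Finset.univ.erase j).erase l with hs
  have hlmem : l ∈ Finset.univ.erase j := by simp [hlj]
  set ϕ : Space d → ℂ := fun x => (∏ i ∈ s, F i x) * F l x with hϕ
  have hsb : ∀ x, ‖∏ i ∈ s, F i x‖ ≤ ∏ i ∈ s, ((∫ w, ‖φ i w‖) * M i) := fun x => by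
    rw [norm_prod]
    exact Finset.prod_le_prod (fun _ _ => norm_nonneg _) fun i hi => hFb i x
  have hϕi : Integrable ϕ := hFl.bdd_mul
    (Finset.measurable_fun_prod _ fun i _ => hFm i).aestronglyMeasurable
    (Filter.Eventually.of_forall hsb)
  have hspec : HasSpec (∑ i ∈ s, r i / t) (fun x => ∏ i ∈ s, F i x) := by
    refine hasSpec_prod _ (M := fun i => (∫ w, ‖φ i w‖) * M i) (fun i hi => ?_) (fun i _ => hFm i)
      (fun i _ => hFb i)
    have hij : i ≠ j := by
      rw [hs] at hi
      exact (Finset.mem_erase.1 (Finset.mem_erase.1 hi).2).1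
    have := (hasSpec_moll ((hf i).comp (measurable_id.sub_const (b i))) (fun x => hM i _) ht
      (hφ i hij))
    simp only [hF]
    convert this using 1
    ext x
    rw [moll_translate]; rfl
  have e1 : ∀ x, ∏ i, F i x = moll (φ j) (fun y => f j (y - b j)) t x * ϕ x := by
    intro x
    rw [← Finset.mul_prod_erase _ _ (Finset.mem_univ j), ← Finset.mul_prod_erase _ _ hlmem, hϕ]
    simp only [hF]
    rw [moll_translate (φ j)]; ring
  simp only [hF] at e1
  simp only [e1]
  refine integral_moll_mul_eq_zero (M := M j) ((hf j).comp (by fun_prop)) (fun x => hM j _) hϕi ht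
    fun ξ => ?_
  -- At a low frequency the kernel φ_j vanishes. At a high one the product of the other factors has
  -- no component, by the triangle inequality applied to the l-th frequency and the sum of the
  -- remaining ones.
  rcases le_or_gt ‖t • ξ‖ (∑ i ∈ Finset.univ.erase j, r i) with h | h
  · left; exact hj _ h
  right
  have e2 : 𝓕 ϕ (-ξ) = ∫ x, (∏ i ∈ s, F i x) *
      ((Real.fourierChar (-inner ℝ x (-ξ)) : ℂ) * F l x) := by
    rw [Real.fourier_eq]; congr 1; ext x; rw [Circle.smul_def, smul_eq_mul, hϕ]; ring
  rw [e2]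
  refine hspec _ (integrable_modulate hFl (-ξ)) fun η hη => ?_
  rw [fourier_modulate]
  have e3 : F l = moll (φ l) (fun y => f l (y - b l)) t := by
    ext x; simp only [hF]; rw [moll_translate]
  rw [e3, fourier_moll (φ l).integrable (hl.comp_sub_right (b l))]
  have : 𝓕 (φ l : Space d → ℂ) (t • (η + -ξ)) = 0 := by
    refine hφ l hlj _ ?_
    have h1 : ‖t • ξ‖ ≤ ‖t • (η + -ξ)‖ + ‖t • η‖ := by
      have : t • ξ = t • η - t • (η + -ξ) := by module
      rw [this]; refine (norm_sub_le _ _).trans (by linarith)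
    rw [← Finset.add_sum_erase _ _ hlmem] at h
    have h2 : ‖t • η‖ ≤ ∑ i ∈ s, r i := by
      rw [norm_smul, Real.norm_of_nonneg ht.le]
      calc t * ‖η‖ ≤ t * ∑ i ∈ s, r i / t := mul_le_mul_of_nonneg_left hη ht.le
        _ = _ := by rw [← Finset.sum_div]; field_simp
    linarith
  rw [this, zero_mul]

/-- A term of the multilinear form with at most one high frequency factor vanishes. -/
theorem form_eq_zero {Ψ : 𝓢(Space d, ℂ)} {φ : ι → 𝓢(Space d, ℂ)}
    {f : ι → Space d → ℂ} {M : ι → ℝ} {a ε : ℝ} {j l : ι} (hlj : l ≠ j) (hε : 0 < ε)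
    (hf : ∀ i, Measurable (f i)) (hM : ∀ i x, ‖f i x‖ ≤ M i) (hl : Integrable (f l))
    (hΨ : ∀ ξ, ‖ξ‖ ≤ a → 𝓕 Ψ ξ = 0) (hφ : ∀ i, i ≠ j → ∀ ξ, ε < ‖ξ‖ → 𝓕 (φ i) ξ = 0)
    (c : ι → ℝ) (ha : (∑ i, |c i|) * (2 * (Fintype.card ι * ε)) ≤ a) {t : ℝ} (ht : 0 < t) :
    ∫ x, ∫ u, Ψ u * ∏ i, moll (φ i) (f i) t (x - (c i * t) • u) = 0 := by
  have hcard : (1 : ℝ) ≤ Fintype.card ι := by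
    exact_mod_cast Fintype.card_pos_iff.2 ⟨j⟩
  -- The factor j is cut at card ι · ε: below twice this threshold all factors are low enough for
  -- the u-integral to vanish, above it the factor j outweighs the others and the x-integral
  -- vanishes.
  obtain ⟨lo, hi, hadd, hlo, hhi, -, -⟩ := exists_low_high (φ j)
    (r := Fintype.card ι * ε) (by positivity)
  have hint : ∀ φ' : ι → 𝓢(Space d, ℂ), Integrable (fun q : Space d × Space d =>
      Ψ q.2 * ∏ i, moll (φ' i) (f i) t (q.1 - (c i * t) • q.2)) (volume.prod volume) := fun φ' =>
    integrable_form (l := l) (M := fun i => (∫ w, ‖φ' i w‖) * M i) Ψ.integrable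
      (fun i => measurable_moll_right (φ' i).continuous.measurable (hf i) t)
      (fun i x => norm_moll_le (φ' i).integrable (hM i) t _)
      (integrable_moll (φ' l).integrable hl t) _
  have hsplit : ∀ x u, Ψ u * ∏ i, moll (φ i) (f i) t (x - (c i * t) • u) =
      Ψ u * ∏ i, moll (Function.update φ j lo i) (f i) t (x - (c i * t) • u) +
      Ψ u * ∏ i, moll (Function.update φ j hi i) (f i) t (x - (c i * t) • u) := by
    intro x u
    rw [← Finset.mul_prod_erase _ _ (Finset.mem_univ j),
      ← Finset.mul_prod_erase _ _ (Finset.mem_univ j), ← Finset.mul_prod_erase _ _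
      (Finset.mem_univ j)]
    have e1 : ∀ ψ : 𝓢(Space d, ℂ), ∏ i ∈ Finset.univ.erase j,
        moll (Function.update φ j ψ i) (f i) t (x - (c i * t) • u) =
        ∏ i ∈ Finset.univ.erase j, moll (φ i) (f i) t (x - (c i * t) • u) := fun ψ =>
      Finset.prod_congr rfl fun i hi => by
        rw [Function.update_of_ne (Finset.ne_of_mem_erase hi)]
    rw [e1, e1, Function.update_self, Function.update_self]
    have e2 : (φ j : Space d → ℂ) = fun w => lo w + hi w := funext hadd
    rw [e2, moll_add lo.integrable hi.integrable (hf j) (hM j)]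
    ring
  have hlo0 : ∀ x, ∫ u, Ψ u * ∏ i, moll (Function.update φ j lo i) (f i) t (x - (c i * t) • u)
      = 0 := by
    intro x
    refine integral_prod_moll_eq_zero (r := fun _ => 2 * (Fintype.card ι * ε)) hf hM hΨ
      (fun i ξ hξ => ?_) c (by rwa [← Finset.sum_mul]) ht x
    by_cases hij : i = j
    · subst hij; rw [Function.update_self]; exact hlo ξ hξ
    · rw [Function.update_of_ne hij]; refine hφ i hij ξ (lt_of_le_of_lt ?_ hξ)
      nlinarith
  have hhi0 : ∀ u, ∫ x, Ψ u * ∏ i, moll (Function.update φ j hi i) (f i) t (x - (c i * t) • u)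
      = 0 := by
    intro u
    rw [integral_const_mul, integral_prod_moll_translate_eq_zero (r := fun _ => ε) hlj hf hM hl
      _ _ ht, mul_zero]
    · intro i hij; rw [Function.update_of_ne hij]; exact hφ i hij
    · intro ξ hξ; rw [Function.update_self]
      refine hhi ξ (hξ.trans ?_)
      rw [Finset.sum_const, nsmul_eq_mul]
      refine mul_le_mul_of_nonneg_right ?_ hε.le
      exact_mod_cast Finset.card_le_univ _
  have h1 : ∫ x, ∫ u, (Ψ u * ∏ i, moll (φ i) (f i) t (x - (c i * t) • u)) =
      (∫ x, ∫ u, Ψ u * ∏ i, moll (Function.update φ j lo i) (f i) t (x - (c i * t) • u)) +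
      ∫ x, ∫ u, Ψ u * ∏ i, moll (Function.update φ j hi i) (f i) t (x - (c i * t) • u) := by
    simp only [hsplit]
    exact integral_integral_add (hint (Function.update φ j lo)) (hint (Function.update φ j hi))
  rw [h1]
  simp only [hlo0]
  rw [integral_integral_swap (hint (Function.update φ j hi))]
  simp [hhi0]

end

/-! ### Dyadic square functions on L² -/

section

variable {d : ℕ}

theorem sum_min_sq_le {x : ℝ} (hx : 0 ≤ x) (K : ℕ) :
    ∑ i ∈ Finset.range K, (min (2 ^ i * x) (2 ^ i * x)⁻¹) ^ 2 ≤ 4 := by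
  -- H takes values between 0 and 1, so its increments over dyadic steps telescope to at most 1;
  -- four such increments dominate the terms of the sum.
  let H : ℝ → ℝ := fun y => y ^ 2 / (1 + y ^ 2)
  have hH : ∀ y : ℝ, 0 ≤ y → (min y y⁻¹) ^ 2 ≤ 4 * (H (2 * y) - H y) := by
    intro y hy
    have e : H (2 * y) - H y = 3 * y ^ 2 / ((1 + 4 * y ^ 2) * (1 + y ^ 2)) := by
      simp only [H]
      rw [div_sub_div _ _ (by positivity) (by positivity)]
      congr 1 <;> ring
    rw [e, ← mul_div_assoc, le_div_iff₀ (by positivity)]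
    rcases le_or_gt y 1 with h | h
    · have h1 : min y y⁻¹ ^ 2 ≤ y ^ 2 :=
        pow_le_pow_left₀ (le_min hy (inv_nonneg.2 hy)) (min_le_left _ _) 2
      have h2 : y ^ 2 ≤ 1 := pow_le_one₀ hy h
      have h3 : (1 + 4 * y ^ 2) * (1 + y ^ 2) ≤ 10 := by nlinarith [sq_nonneg y]
      calc _ ≤ y ^ 2 * 10 := mul_le_mul h1 h3 (by positivity) (by positivity)
        _ ≤ _ := by nlinarith [sq_nonneg y]
    · have hy0 : 0 < y := by linarith
      have h1 : min y y⁻¹ ^ 2 ≤ y⁻¹ ^ 2 :=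
        pow_le_pow_left₀ (le_min hy (inv_nonneg.2 hy)) (min_le_right _ _) 2
      have h2 : 1 ≤ y ^ 2 := one_le_pow₀ h.le
      have h3 : (1 + 4 * y ^ 2) * (1 + y ^ 2) ≤ 10 * (y ^ 2 * y ^ 2) := by nlinarith [sq_nonneg y]
      calc _ ≤ y⁻¹ ^ 2 * (10 * (y ^ 2 * y ^ 2)) := mul_le_mul h1 h3 (by positivity) (by positivity)
        _ = 10 * y ^ 2 := by field_simp
        _ ≤ _ := by nlinarith [sq_nonneg y]
  calc _ ≤ ∑ i ∈ Finset.range K, (4 * H (2 ^ (i + 1) * x) - 4 * H (2 ^ i * x)) := by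
        refine Finset.sum_le_sum fun i _ => ?_
        refine (hH (2 ^ i * x) (by positivity)).trans (le_of_eq ?_)
        rw [pow_succ]; ring_nf
    _ = 4 * H (2 ^ K * x) - 4 * H (2 ^ 0 * x) :=
        Finset.sum_range_sub (fun i => 4 * H (2 ^ i * x)) K
    _ ≤ 4 := by
        have h1 : H (2 ^ K * x) ≤ 1 := by
          simp only [H]; rw [div_le_one (by positivity)]; linarith
        have h2 : 0 ≤ H (2 ^ 0 * x) := by simp only [H]; positivity
        linarith

theorem lintegral_enorm_sq_fourier (s : 𝓢(Space d, ℂ)) :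
    ∫⁻ ξ, ‖𝓕 s ξ‖ₑ ^ 2 = ∫⁻ x, ‖s x‖ₑ ^ 2 := by
  have key : ∀ u : 𝓢(Space d, ℂ), ∫⁻ x, ‖u x‖ₑ ^ 2 = ENNReal.ofReal (∫ x, ‖u x‖ ^ 2) := by
    intro u
    rw [ofReal_integral_eq_lintegral_ofReal ((u.memLp 2 volume).integrable_norm_pow (by norm_num))
      (Filter.Eventually.of_forall fun x => by positivity)]
    congr 1; ext x
    rw [ENNReal.ofReal_pow (norm_nonneg _), ofReal_norm]
  rw [key, key, SchwartzMap.integral_norm_sq_fourier]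

/-- The average is realised as a Fourier multiplier acting on Schwartz functions, so that Plancherel
applies to a genuine Schwartz function. -/
theorem lintegral_moll_sq (κ g : 𝓢(Space d, ℂ)) (t : ℝ) :
    ∫⁻ x, ‖moll κ g t x‖ₑ ^ 2 = ∫⁻ ξ, ‖𝓕 κ (t • ξ)‖ₑ ^ 2 * ‖𝓕 g ξ‖ₑ ^ 2 := by
  have hm : Function.HasTemperateGrowth (fun ξ : Space d => 𝓕 κ (t • ξ)) :=
    (𝓕 κ : 𝓢(Space d, ℂ)).hasTemperateGrowth.comp
      (t • ContinuousLinearMap.id ℝ (Space d)).hasTemperateGrowth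
  set s : 𝓢(Space d, ℂ) := SchwartzMap.fourierMultiplierCLM ℂ (fun ξ => 𝓕 κ (t • ξ)) g with hs
  have hF : ∀ ξ, 𝓕 s ξ = 𝓕 κ (t • ξ) * 𝓕 g ξ := by
    intro ξ
    simp only [hs, SchwartzMap.fourierMultiplierCLM_apply, FourierTransform.fourier_fourierInv_eq]
    rw [SchwartzMap.smulLeftCLM_apply_apply hm, smul_eq_mul]
  have e : ∀ x, moll κ g t x = s x := by
    intro x
    rw [moll_eq_fourierInv κ.integrable]
    have h0 : s x = 𝓕⁻ (𝓕 s : 𝓢(Space d, ℂ)) x := by simp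
    rw [h0, SchwartzMap.fourierInv_coe]
    exact congrArg (fun F : Space d → ℂ => 𝓕⁻ F x) (funext fun ξ => (hF ξ).symm)
  simp only [e]
  rw [← lintegral_enorm_sq_fourier]
  simp only [hF, enorm_mul, mul_pow]

/-- On the frequency side the sum is pointwise: at each ξ the symbols at the scales 2^i τ are small
both near the origin and near infinity, hence square summable with a bound free of τ and K. -/
theorem sum_lintegral_moll_sq_le (κ : 𝓢(Space d, ℂ)) {C : ℝ}
    (hκ : ∀ ξ, ‖𝓕 κ ξ‖ ≤ C * min ‖ξ‖ ‖ξ‖⁻¹) (g : 𝓢(Space d, ℂ)) {τ : ℝ} (hτ : 0 < τ) (K : ℕ) :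
    ∑ i ∈ Finset.range K, ∫⁻ x, ‖moll κ g (2 ^ i * τ) x‖ₑ ^ 2 ≤
      ENNReal.ofReal (4 * C ^ 2) * ∫⁻ x, ‖g x‖ₑ ^ 2 := by
  simp only [lintegral_moll_sq]
  rw [← lintegral_finsetSum]
  swap
  · intro i _
    have h1 : Continuous fun ξ => 𝓕 κ ((2 ^ i * τ) • ξ) :=
      (𝓕 κ : 𝓢(Space d, ℂ)).continuous.comp (by fun_prop)
    have h2 : Continuous fun ξ => 𝓕 g ξ := (𝓕 g : 𝓢(Space d, ℂ)).continuous
    exact (h1.measurable.enorm.pow_const 2).mul (h2.measurable.enorm.pow_const 2)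
  rw [← lintegral_enorm_sq_fourier, ← lintegral_const_mul' _ _ ENNReal.ofReal_ne_top]
  refine lintegral_mono fun ξ => ?_
  rw [← Finset.sum_mul]
  refine mul_le_mul_left ?_ _
  have h1 : ∀ i, ‖𝓕 κ ((2 ^ i * τ) • ξ)‖ₑ ^ 2 ≤
      ENNReal.ofReal (C ^ 2 * (min (2 ^ i * (τ * ‖ξ‖)) (2 ^ i * (τ * ‖ξ‖))⁻¹) ^ 2) := by
    intro i
    rw [← ofReal_norm, ← ENNReal.ofReal_pow (norm_nonneg _)]
    refine ENNReal.ofReal_le_ofReal ?_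
    rw [← mul_pow]
    refine pow_le_pow_left₀ (norm_nonneg _) ((hκ _).trans (le_of_eq ?_)) 2
    rw [norm_smul, Real.norm_of_nonneg (by positivity), mul_assoc]
  calc _ ≤ ∑ i ∈ Finset.range K, ENNReal.ofReal
        (C ^ 2 * (min (2 ^ i * (τ * ‖ξ‖)) (2 ^ i * (τ * ‖ξ‖))⁻¹) ^ 2) :=
        Finset.sum_le_sum fun i _ => h1 i
    _ = ENNReal.ofReal (C ^ 2 * ∑ i ∈ Finset.range K,
          (min (2 ^ i * (τ * ‖ξ‖)) (2 ^ i * (τ * ‖ξ‖))⁻¹) ^ 2) := by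
        rw [Finset.mul_sum, ENNReal.ofReal_sum_of_nonneg fun i _ => by positivity]
    _ ≤ _ := by
        refine ENNReal.ofReal_le_ofReal ?_
        have := sum_min_sq_le (x := τ * ‖ξ‖) (by positivity) K
        nlinarith [sq_nonneg C]

/-- A Schwartz function vanishing at the origin. -/
theorem exists_norm_le_min (m : 𝓢(Space d, ℂ)) (h0 : m 0 = 0) :
    ∃ C, 0 ≤ C ∧ ∀ ξ, ‖m ξ‖ ≤ C * min ‖ξ‖ ‖ξ‖⁻¹ := by
  obtain ⟨C1, hC1, h1⟩ := m.decay 0 1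
  obtain ⟨C2, hC2, h2⟩ := m.decay 1 0
  refine ⟨max C1 C2, (hC1.trans_le (le_max_left _ _)).le, fun ξ => ?_⟩
  rcases eq_or_ne ξ 0 with rfl | hξ
  · simp [h0]
  have hξ' : 0 < ‖ξ‖ := norm_pos_iff.2 hξ
  rw [mul_min_of_nonneg _ _ (hC1.trans_le (le_max_left _ _)).le]
  refine le_min ?_ ?_
  · have := (convex_univ (𝕜 := ℝ) (E := Space d)).norm_image_sub_le_of_norm_fderiv_le (f := m)
      (C := C1) (x := 0) (y := ξ) (fun x _ => m.differentiableAt)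
      (fun x _ => by simpa [norm_iteratedFDeriv_one] using h1 x) trivial trivial
    rw [h0, sub_zero, sub_zero] at this
    exact this.trans (mul_le_mul_of_nonneg_right (le_max_left _ _) hξ'.le)
  · have := h2 ξ
    simp only [pow_one, norm_iteratedFDeriv_zero] at this
    rw [← div_eq_mul_inv, le_div_iff₀ hξ', mul_comm]
    exact this.trans (le_max_right _ _)

theorem fourier_comp_sub (φ : Space d → ℂ) (v ξ : Space d) :
    𝓕 (fun x => φ (x - v)) ξ = (Real.fourierChar (-inner ℝ v ξ) : ℂ) * 𝓕 φ ξ := by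
  simp only [Real.fourier_eq]
  rw [← integral_const_mul, ← integral_sub_right_eq_self (fun x =>
    (Real.fourierChar (-inner ℝ v ξ) : ℂ) * Real.fourierChar (-inner ℝ x ξ) • φ x) v]
  congr 1; ext x
  rw [inner_sub_left, Circle.smul_def, Circle.smul_def, smul_eq_mul, smul_eq_mul, ← mul_assoc,
    ← Circle.coe_mul, ← AddChar.map_add_eq_mul]
  congr 3; ring

theorem norm_fourierChar_sub_one_le (s : ℝ) :
    ‖(Real.fourierChar s : ℂ) - 1‖ ≤ 2 * Real.pi * |s| := by
  rw [Real.fourierChar_apply, mul_comm _ Complex.I]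
  refine (Real.norm_exp_I_mul_ofReal_sub_one_le (x := 2 * Real.pi * s)).trans (le_of_eq ?_)
  rw [Real.norm_eq_abs, abs_mul, abs_of_pos Real.two_pi_pos]

/-- Translation by v multiplies 𝓕φ by a phase. The difference of transforms is 𝓕(φ − γ), which
vanishes at the origin, plus (phase − 1)𝓕φ, where |phase − 1| ≤ 2π|v||ξ|; hence the loss is only
linear in v. -/
theorem exists_norm_fourier_comp_sub_sub_le (φ γ : 𝓢(Space d, ℂ)) (h0 : 𝓕 φ 0 = 𝓕 γ 0) :
    ∃ C, 0 ≤ C ∧ ∀ v ξ, ‖𝓕 (SchwartzMap.compSubConstCLM ℂ v φ - γ) ξ‖ ≤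
      (C * (1 + ‖v‖)) * min ‖ξ‖ ‖ξ‖⁻¹ := by
  have hsub : ∀ a b : 𝓢(Space d, ℂ), ∀ ξ, 𝓕 (a - b) ξ = 𝓕 a ξ - 𝓕 b ξ := by
    intro a b ξ
    have := map_sub (FourierTransform.fourierCLM ℂ 𝓢(Space d, ℂ)) a b
    simp only [FourierTransform.fourierCLM_apply] at this
    rw [this]; rfl
  obtain ⟨C1, hC1, h1⟩ := exists_norm_le_min (𝓕 (φ - γ)) (by rw [hsub, h0, sub_self])
  obtain ⟨C2, hC2, h2⟩ := (𝓕 φ : 𝓢(Space d, ℂ)).decay 0 0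
  obtain ⟨C3, hC3, h3⟩ := (𝓕 φ : 𝓢(Space d, ℂ)).decay 2 0
  simp only [pow_zero, one_mul, norm_iteratedFDeriv_zero] at h2 h3
  set D := 2 * Real.pi * (max C2 C3) with hD
  have hD0 : 0 ≤ D := by have := hC2.trans_le (le_max_left C2 C3); positivity
  refine ⟨max C1 D, hC1.trans (le_max_left _ _), fun v ξ => ?_⟩
  have e1 : 𝓕 (SchwartzMap.compSubConstCLM ℂ v φ - γ) ξ =
      𝓕 (φ - γ) ξ + ((Real.fourierChar (-inner ℝ v ξ) : ℂ) - 1) * 𝓕 φ ξ := by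
    rw [hsub, hsub]
    have : 𝓕 (SchwartzMap.compSubConstCLM ℂ v φ) ξ =
        (Real.fourierChar (-inner ℝ v ξ) : ℂ) * 𝓕 φ ξ := by
      rw [SchwartzMap.fourier_coe, SchwartzMap.fourier_coe, ← fourier_comp_sub]
      rfl
    rw [this]; ring
  have h4 : ‖ξ‖ * ‖𝓕 φ ξ‖ ≤ max C2 C3 * min ‖ξ‖ ‖ξ‖⁻¹ := by
    rcases eq_or_ne ξ 0 with rfl | hξ
    · simp
    have hξ' : 0 < ‖ξ‖ := norm_pos_iff.2 hξ
    rw [mul_min_of_nonneg _ _ (hC2.trans_le (le_max_left _ _)).le]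
    refine le_min ?_ ?_
    · rw [mul_comm]
      exact mul_le_mul_of_nonneg_right ((h2 ξ).trans (le_max_left _ _)) hξ'.le
    · rw [← div_eq_mul_inv, le_div_iff₀ hξ']
      calc _ = ‖ξ‖ ^ 2 * ‖𝓕 φ ξ‖ := by ring
        _ ≤ _ := (h3 ξ).trans (le_max_right _ _)
  have hmin : 0 ≤ min ‖ξ‖ ‖ξ‖⁻¹ := le_min (norm_nonneg _) (inv_nonneg.2 (norm_nonneg _))
  calc _ ≤ ‖𝓕 (φ - γ) ξ‖ + ‖(Real.fourierChar (-inner ℝ v ξ) : ℂ) - 1‖ * ‖𝓕 φ ξ‖ := by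
        rw [e1, ← norm_mul]; exact norm_add_le _ _
    _ ≤ C1 * min ‖ξ‖ ‖ξ‖⁻¹ + (2 * Real.pi * (‖v‖ * ‖ξ‖)) * ‖𝓕 φ ξ‖ := by
        refine add_le_add (h1 ξ) (mul_le_mul_of_nonneg_right ?_ (norm_nonneg _))
        refine (norm_fourierChar_sub_one_le _).trans ?_
        rw [abs_neg]
        exact mul_le_mul_of_nonneg_left (abs_real_inner_le_norm _ _) (by positivity)
    _ = C1 * min ‖ξ‖ ‖ξ‖⁻¹ + (2 * Real.pi * ‖v‖) * (‖ξ‖ * ‖𝓕 φ ξ‖) := by ring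
    _ ≤ C1 * min ‖ξ‖ ‖ξ‖⁻¹ + (2 * Real.pi * ‖v‖) * (max C2 C3 * min ‖ξ‖ ‖ξ‖⁻¹) := by
        gcongr
    _ = (C1 + D * ‖v‖) * min ‖ξ‖ ‖ξ‖⁻¹ := by rw [hD]; ring
    _ ≤ _ := by
        refine mul_le_mul_of_nonneg_right ?_ hmin
        have h5 := le_max_left C1 D
        have h6 := mul_le_mul_of_nonneg_right (le_max_right C1 D) (norm_nonneg v)
        linarith

theorem exists_sum_lintegral_moll_sq_le (κ : 𝓢(Space d, ℂ)) (h0 : 𝓕 κ 0 = 0) :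
    ∃ C, 0 ≤ C ∧ ∀ (g : 𝓢(Space d, ℂ)) (τ : ℝ) (K : ℕ), 0 < τ →
      ∑ i ∈ Finset.range K, ∫⁻ x, ‖moll κ g (2 ^ i * τ) x‖ₑ ^ 2 ≤
        ENNReal.ofReal C * ∫⁻ x, ‖g x‖ₑ ^ 2 := by
  obtain ⟨C, hC, h⟩ := exists_norm_le_min (𝓕 κ) h0
  exact ⟨4 * C ^ 2, by positivity, fun g τ K hτ => sum_lintegral_moll_sq_le κ h g hτ K⟩

theorem exists_sum_lintegral_moll_sub_sq_le (φ γ : 𝓢(Space d, ℂ)) (h0 : 𝓕 φ 0 = 𝓕 γ 0) :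
    ∃ C, 0 ≤ C ∧ ∀ (v : Space d) (g : 𝓢(Space d, ℂ)) (τ : ℝ) (K : ℕ), 0 < τ →
      ∑ i ∈ Finset.range K,
        ∫⁻ x, ‖moll φ g (2 ^ i * τ) (x - (2 ^ i * τ) • v) - moll γ g (2 ^ i * τ) x‖ₑ ^ 2 ≤
        ENNReal.ofReal (C * (1 + ‖v‖) ^ 2) * ∫⁻ x, ‖g x‖ₑ ^ 2 := by
  obtain ⟨C, hC, h⟩ := exists_norm_fourier_comp_sub_sub_le φ γ h0
  refine ⟨4 * C ^ 2, by positivity, fun v g τ K hτ => ?_⟩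
  have := sum_lintegral_moll_sq_le _ (h v) g hτ K
  rw [mul_pow, ← mul_assoc] at this
  refine le_trans (le_of_eq ?_) this
  refine Finset.sum_congr rfl fun i _ => ?_
  congr 1; ext x
  obtain ⟨M, -, hM⟩ := g.decay 0 0
  simp only [pow_zero, one_mul, norm_iteratedFDeriv_zero] at hM
  have := moll_sub (SchwartzMap.integrable (μ := volume) (SchwartzMap.compSubConstCLM ℂ v φ))
    γ.integrable g.continuous.measurable hM (2 ^ i * τ) x
  rw [← moll_comp_sub]
  exact congrArg (fun z => ‖z‖ₑ ^ 2) this.symm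

end

/-! ### The Gaussian and its semigroup property -/

section

variable {d : ℕ}

/-- Uses (1 + r)^p ≤ p! e^{1+r} and 1 + r − πr² ≤ 2. -/
theorem pow_mul_exp_neg_le {r : ℝ} (hr : 0 ≤ r) (p : ℕ) :
    (1 + r) ^ p * Real.exp (-Real.pi * r ^ 2) ≤ p.factorial * Real.exp 2 := by
  have h1 : (1 + r) ^ p ≤ p.factorial * Real.exp (1 + r) := by
    have := Real.pow_div_factorial_le_exp (1 + r) (by positivity) p
    rwa [div_le_iff₀ (by positivity), mul_comm] at this
  calc _ ≤ p.factorial * Real.exp (1 + r) * Real.exp (-Real.pi * r ^ 2) := by gcongr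
    _ = p.factorial * Real.exp (1 + r + -Real.pi * r ^ 2) := by rw [mul_assoc, ← Real.exp_add]
    _ ≤ _ := by
      gcongr
      nlinarith [Real.pi_gt_three, sq_nonneg (r - 1), sq_nonneg r]

/-- The Gaussian `exp (-π |x|^2)` as a real Schwartz function. -/
def gaussR (d : ℕ) : 𝓢(Space d, ℝ) where
  toFun x := Real.exp (-Real.pi * ‖x‖ ^ 2)
  smooth' := by
    have : ContDiff ℝ ∞ fun x : Space d => ‖x‖ ^ 2 := contDiff_norm_sq ℝ
    fun_prop
  decay' := by
    intro k n
    have hN : Function.HasTemperateGrowth (fun x : Space d => ‖x‖ ^ 2) :=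
      Function.hasTemperateGrowth_norm_sq _
    obtain ⟨m, C, hC, h⟩ := hN.norm_iteratedFDeriv_le_uniform n
    refine ⟨n.factorial * Real.pi ^ n * (1 + C) ^ n * ((k + m * n).factorial * Real.exp 2),
      fun x => ?_⟩
    have hx : (1 : ℝ) ≤ 1 + ‖x‖ := by linarith [norm_nonneg x]
    have hD : (1 : ℝ) ≤ (1 + C) * (1 + ‖x‖) ^ m := by
      have := one_le_pow₀ (n := m) hx
      nlinarith
    -- Faà di Bruno bound: the derivatives of the exponential of order at most n cost πⁿ, and since
    -- D ≥ 1 its powers dominate the polynomial growth of every derivative of |x|².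
    have key := norm_iteratedFDeriv_comp_le (𝕜 := ℝ) (g := fun s : ℝ => Real.exp (-Real.pi * s))
      (f := fun x : Space d => ‖x‖ ^ 2) (n := n) (N := ∞) (by fun_prop) (contDiff_norm_sq ℝ)
      (by exact_mod_cast le_top) x (C := Real.pi ^ n * Real.exp (-Real.pi * ‖x‖ ^ 2))
      (D := (1 + C) * (1 + ‖x‖) ^ m) ?_ ?_
    · calc _ ≤ ‖x‖ ^ k * (n.factorial * (Real.pi ^ n * Real.exp (-Real.pi * ‖x‖ ^ 2)) *
            ((1 + C) * (1 + ‖x‖) ^ m) ^ n) := mul_le_mul_of_nonneg_left key (by positivity)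
        _ ≤ (1 + ‖x‖) ^ k * (n.factorial * (Real.pi ^ n * Real.exp (-Real.pi * ‖x‖ ^ 2)) *
            ((1 + C) * (1 + ‖x‖) ^ m) ^ n) := by gcongr; linarith
        _ = n.factorial * Real.pi ^ n * (1 + C) ^ n *
            ((1 + ‖x‖) ^ (k + m * n) * Real.exp (-Real.pi * ‖x‖ ^ 2)) := by
          rw [mul_pow, ← pow_mul, pow_add]; ring
        _ ≤ _ := by
          exact mul_le_mul_of_nonneg_left (pow_mul_exp_neg_le (norm_nonneg x) _) (by positivity)
    · intro i hi
      rw [norm_iteratedFDeriv_eq_norm_iteratedDeriv]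
      have : iteratedDeriv i (fun s : ℝ => Real.exp (-Real.pi * s)) =
          fun s => (-Real.pi) ^ i * Real.exp (-Real.pi * s) := by
        have := iteratedDeriv_comp_const_mul (n := i) (f := Real.exp) (by fun_prop) (-Real.pi)
        rw [this]
        simp [iteratedDeriv_eq_iterate, Real.iter_deriv_exp]
      rw [this, norm_mul, norm_pow, norm_neg, Real.norm_of_nonneg Real.pi_pos.le,
        Real.norm_of_nonneg (Real.exp_pos _).le]
      gcongr
      linarith [Real.pi_gt_three]
    · intro i h1 hi
      calc _ ≤ C * (1 + ‖x‖) ^ m := h i hi x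
        _ ≤ (1 + C) * (1 + ‖x‖) ^ m := by gcongr; linarith
        _ ≤ _ := le_self_pow₀ hD (by omega)

theorem gaussR_apply (x : Space d) : gaussR d x = Real.exp (-Real.pi * ‖x‖ ^ 2) := rfl

/-- The Gaussian `exp (-π |x|^2)`. -/
def gauss (d : ℕ) : 𝓢(Space d, ℂ) := SchwartzMap.postcompCLM Complex.ofRealCLM (gaussR d)

theorem gauss_apply (x : Space d) : gauss d x = (gaussR d x : ℂ) := rfl

theorem fourier_gauss (ξ : Space d) : 𝓕 (gauss d) ξ = gauss d ξ := by
  have h := fourier_gaussian_innerProductSpace (V := Space d) (b := (Real.pi : ℂ))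
    (by simpa using Real.pi_pos) ξ
  have hπ : (Real.pi : ℂ) ≠ 0 := by exact_mod_cast Real.pi_pos.ne'
  rw [div_self hπ, Complex.one_cpow, one_mul] at h
  have e : (gauss d : Space d → ℂ) = fun v => Complex.exp (-(Real.pi : ℂ) * (‖v‖ : ℂ) ^ 2) := by
    ext v; rw [gauss_apply, gaussR_apply]; push_cast; rfl
  rw [SchwartzMap.fourier_coe, e, h]
  congr 1
  field_simp

theorem fourierInv_gauss (ξ : Space d) : 𝓕⁻ (gauss d : Space d → ℂ) ξ = gauss d ξ := by
  rw [Real.fourierInv_eq_fourier_neg, ← SchwartzMap.fourier_coe, fourier_gauss, gauss_apply,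
    gauss_apply, gaussR_apply, gaussR_apply, norm_neg]

theorem integral_gaussR : ∫ x, gaussR d x = 1 := by
  have h : ∫ x, (gauss d x : ℂ) = 1 := by
    rw [integral_eq_fourier_zero, ← SchwartzMap.fourier_coe, fourier_gauss, gauss_apply,
      gaussR_apply]
    simp
  have h2 : ∫ x, (gauss d x : ℂ) = ((∫ x, gaussR d x : ℝ) : ℂ) := by
    simp only [gauss_apply]; exact integral_ofReal
  rw [h2] at h
  exact_mod_cast h

theorem gauss_smul_mul_gauss {r s m : ℝ} (h : r ^ 2 + s ^ 2 = m ^ 2) (ξ : Space d) :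
    gauss d (r • ξ) * gauss d (s • ξ) = gauss d (m • ξ) := by
  simp only [gauss_apply, gaussR_apply]
  rw [← Complex.ofReal_mul, ← Real.exp_add]
  congr 2
  simp only [norm_smul, mul_pow, Real.norm_eq_abs, sq_abs]
  rw [← h]; ring

/-- Dilating the kernel only changes the scale, so the parameters λ_i can be absorbed in the
kernels. Negative parameters are allowed. -/
theorem moll_dil {κ f : Space d → ℂ} {lam : ℝ} (hlam : lam ≠ 0) (t : ℝ) (x : Space d) :
    moll (dil lam κ) f t x = moll κ f (t * lam) x := by
  have e : ∀ w, dil lam κ w * f (x - t • w) =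
      ((1 / |lam| ^ d : ℝ) : ℂ) * (fun w => κ w * f (x - (t * lam) • w)) (lam⁻¹ • w) := by
    intro w
    simp only [dil, smul_smul, mul_assoc, mul_inv_cancel₀ hlam, mul_one]
  simp only [moll]
  rw [integral_congr_ae (Filter.Eventually.of_forall e), integral_const_mul,
    Measure.integral_comp_inv_smul volume (fun w => κ w * f (x - (t * lam) • w)) lam]
  simp only [finrank_euclideanSpace, Fintype.card_fin, Complex.real_smul]
  rw [← mul_assoc, ← Complex.ofReal_mul, abs_pow]
  rw [one_div, inv_mul_cancel₀ (by positivity)]; simp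

theorem conv_dil {κ f : Space d → ℂ} {lam : ℝ} (hlam : lam ≠ 0) (x : Space d) :
    conv (dil lam κ) f x = moll κ f lam x := by
  have := moll_dil (κ := κ) (f := f) hlam 1 x
  rw [one_mul] at this
  rw [← this]
  simp [conv, convolution, moll]

theorem fourierInv_comp_smul (F : Space d → ℂ) {m : ℝ} (hm : 0 < m) (w : Space d) :
    𝓕⁻ (fun ξ => F (m • ξ)) w = dil m (𝓕⁻ F) w := by
  simp only [Real.fourierInv_eq, dil]
  have e : ∀ ξ : Space d, Real.fourierChar (inner ℝ ξ w) • F (m • ξ) =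
      (fun η => Real.fourierChar (inner ℝ η (m⁻¹ • w)) • F η) (m • ξ) := by
    intro ξ
    simp only [inner_smul_left, inner_smul_right]
    congr 2
    simp only [conj_trivial]
    field_simp
  rw [integral_congr_ae (Filter.Eventually.of_forall e), Measure.integral_comp_smul volume
    (fun η => Real.fourierChar (inner ℝ η (m⁻¹ • w)) • F η) m]
  simp [finrank_euclideanSpace, abs_of_pos hm]

/-- Semigroup property of the Gaussian averages. -/
theorem moll_gauss_moll_gauss {f : Space d → ℂ} {M : ℝ} (hf : Measurable f) (hM : ∀ x, ‖f x‖ ≤ M)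
    {r s m : ℝ} (hr : 0 < r) (hm : 0 < m) (h : r ^ 2 + s ^ 2 = m ^ 2) (x : Space d) :
    moll (gauss d) (moll (gauss d) f s) r x = moll (gauss d) f m x := by
  have h1 := moll_moll (gauss d).integrable (gauss d).integrable hf hM (s / r) r x
  rw [div_mul_cancel₀ _ hr.ne'] at h1
  rw [h1]
  have h2 : moll (gauss d) (gauss d) (s / r) = dil (m / r) (gauss d) := by
    ext w
    rw [moll_eq_fourierInv (gauss d).integrable]
    have e : (fun ξ => 𝓕 (gauss d : Space d → ℂ) ((s / r) • ξ) * 𝓕 (gauss d) ξ) =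
        fun ξ => gauss d ((m / r) • ξ) := by
      ext ξ
      rw [← SchwartzMap.fourier_coe, fourier_gauss, fourier_gauss]
      have := gauss_smul_mul_gauss (d := d) (r := s / r) (s := 1) (m := m / r)
        (by rw [div_pow, div_pow, ← h]; field_simp; ring) ξ
      rwa [one_smul] at this
    rw [e, fourierInv_comp_smul _ (by positivity)]
    simp only [dil, fourierInv_gauss]
  rw [h2, moll_dil (by positivity)]
  congr 1; field_simp

end

/-! ### Carleson's embedding for Gaussian averages -/

section

variable {d : ℕ}

/-- The density in the Carleson estimate: `2 |a|^2 |b|^2 + 16 A^2 |b|^2`. -/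
def carlesonDensity (A : ℝ) (a b : ℂ) : ℝ := 2 * ‖a‖ ^ 2 * ‖b‖ ^ 2 + 16 * A ^ 2 * ‖b‖ ^ 2

theorem norm_sq_eq_add (a p : ℂ) :
    ‖a‖ ^ 2 = ‖p‖ ^ 2 + 2 * ((starRingEnd ℂ) p * (a - p)).re + ‖a - p‖ ^ 2 := by
  simp only [← Complex.normSq_eq_norm_sq, Complex.normSq_apply, Complex.mul_re, Complex.conj_re,
    Complex.conj_im, Complex.sub_re, Complex.sub_im]
  ring

/-- Quantitative convexity: the bracket is the differential of the density at (p, q), and the excess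
over the tangent plane still dominates |a − p|²|q|². The product |a|²|b|² alone is not convex; the
term 16A²|b|² repairs this as long as the first variable is bounded by A. -/
theorem carlesonDensity_pointwise {A : ℝ} {a p b q : ℂ} (ha : ‖a‖ ≤ A) (hp : ‖p‖ ≤ A) :
    ‖a - p‖ ^ 2 * ‖q‖ ^ 2 + carlesonDensity A p q +
      (4 * ‖q‖ ^ 2 * ((starRingEnd ℂ) p * (a - p)).re +
        (4 * ‖p‖ ^ 2 + 32 * A ^ 2) * ((starRingEnd ℂ) q * (b - q)).re) ≤
      carlesonDensity A a b := by
  have h1 := norm_sq_eq_add a p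
  have h2 := norm_sq_eq_add b q
  set δ := ‖a - p‖
  set e := ‖b - q‖
  set s := ((starRingEnd ℂ) p * (a - p)).re
  set T := ((starRingEnd ℂ) q * (b - q)).re with hT
  have hTe : |T| ≤ ‖q‖ * e := by
    refine (Complex.abs_re_le_norm _).trans (le_of_eq ?_)
    rw [norm_mul, RCLike.norm_conj]
  have hA : 0 ≤ A := (norm_nonneg _).trans ha
  have hδ : |‖a‖ ^ 2 - ‖p‖ ^ 2| ≤ 2 * A * δ := by
    rw [sq_sub_sq, abs_mul, abs_of_nonneg (by positivity)]
    exact mul_le_mul (by linarith) (abs_norm_sub_norm_le _ _) (abs_nonneg _) (by positivity)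
  have hST : -(2 * A * δ * (‖q‖ * e)) ≤ (‖a‖ ^ 2 - ‖p‖ ^ 2) * T := by
    have := mul_le_mul hδ hTe (abs_nonneg _) (by positivity)
    rw [← abs_mul] at this
    exact (abs_le.1 this).1
  have e1 : carlesonDensity A a b - (δ ^ 2 * ‖q‖ ^ 2 + carlesonDensity A p q +
      (4 * ‖q‖ ^ 2 * s + (4 * ‖p‖ ^ 2 + 32 * A ^ 2) * T)) =
      4 * ((‖a‖ ^ 2 - ‖p‖ ^ 2) * T) + 2 * ‖a‖ ^ 2 * e ^ 2 + 16 * A ^ 2 * e ^ 2 +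
        ‖q‖ ^ 2 * δ ^ 2 := by
    have hs : s = (‖a‖ ^ 2 - ‖p‖ ^ 2 - δ ^ 2) / 2 := by linarith
    simp only [carlesonDensity]
    rw [h2, hs]; ring
  have : 0 ≤ 2 * ‖a‖ ^ 2 * e ^ 2 := by positivity
  -- The only term without a sign is at least −8Aδ‖q‖e, which is absorbed by 16A²e² + ‖q‖²δ².
  nlinarith [sq_nonneg (4 * A * e - ‖q‖ * δ)]

/-- Jensen's inequality with its gain retained: p and q are the means, so the linear terms of the
convexity inequality integrate to zero and the variance of a remains. -/
theorem integral_carlesonDensity {wt : Space d → ℝ} {a b : Space d → ℂ} {A B : ℝ}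
    (hwt : Integrable wt) (hwt0 : ∀ w, 0 ≤ wt w) (hwt1 : ∫ w, wt w = 1)
    (ha : Measurable a) (hA : ∀ w, ‖a w‖ ≤ A) (hb : Measurable b) (hB : ∀ w, ‖b w‖ ≤ B) {p q : ℂ}
    (hp : p = ∫ w, (wt w : ℂ) * a w) (hq : q = ∫ w, (wt w : ℂ) * b w) :
    (∫ w, wt w * ‖a w - p‖ ^ 2) * ‖q‖ ^ 2 + carlesonDensity A p q ≤
      ∫ w, wt w * carlesonDensity A (a w) (b w) := by
  have hwtc : Integrable fun w => (wt w : ℂ) := hwt.ofReal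
  have hpA : ‖p‖ ≤ A := by
    rw [hp, ← mul_one A, ← hwt1, ← integral_const_mul]
    refine norm_integral_le_of_norm_le (hwt.const_mul _) (Filter.Eventually.of_forall fun w => ?_)
    rw [norm_mul, Complex.norm_real, Real.norm_of_nonneg (hwt0 w), mul_comm]
    exact mul_le_mul_of_nonneg_right (hA w) (hwt0 w)
  have zero : ∀ (z : Space d → ℂ) (r : ℂ) (k : ℝ) (D : ℝ), Measurable z → (∀ w, ‖z w‖ ≤ D) →
      (r = ∫ w, (wt w : ℂ) * z w) →
      Integrable (fun w => wt w * (k * ((starRingEnd ℂ) r * (z w - r)).re)) ∧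
      ∫ w, wt w * (k * ((starRingEnd ℂ) r * (z w - r)).re) = 0 := by
    intro z r k D hz hD hr
    have h1 : Integrable fun w => (wt w : ℂ) * z w :=
      hwtc.mul_bdd hz.aestronglyMeasurable (Filter.Eventually.of_forall hD)
    have h2 : Integrable fun w => (k * (starRingEnd ℂ) r) * ((wt w : ℂ) * z w - (wt w : ℂ) * r) :=
      (h1.sub (hwtc.mul_const r)).const_mul _
    have e : ∀ w, wt w * (k * ((starRingEnd ℂ) r * (z w - r)).re) =
        RCLike.re ((k * (starRingEnd ℂ) r) * ((wt w : ℂ) * z w - (wt w : ℂ) * r)) := by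
      intro w
      simp [Complex.mul_re, Complex.mul_im]; ring
    simp only [e]
    refine ⟨h2.re, ?_⟩
    rw [integral_re h2, integral_const_mul, integral_sub h1 (hwtc.mul_const r), integral_mul_const,
      ← hr, integral_complex_ofReal, hwt1]
    simp
  obtain ⟨i1, z1⟩ := zero a p (4 * ‖q‖ ^ 2) A ha hA hp
  obtain ⟨i2, z2⟩ := zero b q (4 * ‖p‖ ^ 2 + 32 * A ^ 2) B hb hB hq
  have i3 : Integrable fun w => wt w * ‖a w - p‖ ^ 2 := by
    refine hwt.mul_bdd (c := (A + ‖p‖) ^ 2)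
      (((ha.sub_const p).norm.pow_const 2).aestronglyMeasurable)
      (Filter.Eventually.of_forall fun w => ?_)
    rw [norm_pow, norm_norm]
    exact pow_le_pow_left₀ (norm_nonneg _) ((norm_sub_le _ _).trans (by linarith [hA w])) 2
  have i4 : Integrable fun w => wt w * carlesonDensity A (a w) (b w) := by
    refine hwt.mul_bdd (c := 2 * A ^ 2 * B ^ 2 + 16 * A ^ 2 * B ^ 2) ?_
      (Filter.Eventually.of_forall fun w => ?_)
    · unfold carlesonDensity
      exact Measurable.aestronglyMeasurable (by fun_prop)
    · unfold carlesonDensity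
      rw [Real.norm_of_nonneg (by positivity)]
      have := hA w; have := hB w
      gcongr
  have i5 : Integrable fun w => wt w * carlesonDensity A p q := hwt.mul_const _
  have i6 : Integrable fun w => wt w * ‖a w - p‖ ^ 2 * ‖q‖ ^ 2 := i3.mul_const _
  have i7 : Integrable fun w => wt w * ‖a w - p‖ ^ 2 * ‖q‖ ^ 2 + wt w * carlesonDensity A p q :=
    i6.add i5
  have i8 : Integrable fun w => wt w * (4 * ‖q‖ ^ 2 * ((starRingEnd ℂ) p * (a w - p)).re) +
      wt w * ((4 * ‖p‖ ^ 2 + 32 * A ^ 2) * ((starRingEnd ℂ) q * (b w - q)).re) := i1.add i2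
  calc _ = ∫ w, (wt w * ‖a w - p‖ ^ 2 * ‖q‖ ^ 2 + wt w * carlesonDensity A p q +
        (wt w * (4 * ‖q‖ ^ 2 * ((starRingEnd ℂ) p * (a w - p)).re) +
          wt w * ((4 * ‖p‖ ^ 2 + 32 * A ^ 2) * ((starRingEnd ℂ) q * (b w - q)).re))) := by
        rw [integral_add i7 i8, integral_add i6 i5, integral_add i1 i2, z1, z2, integral_mul_const,
          integral_mul_const, hwt1]
        ring
    _ ≤ _ := by
        refine integral_mono (i7.add i8) i4 fun w => ?_
        have := mul_le_mul_of_nonneg_left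
          (carlesonDensity_pointwise (b := b w) (q := q) (hA w) hpA) (hwt0 w)
        simp only
        linarith

theorem gaussR_nonneg (x : Space d) : 0 ≤ gaussR d x := (Real.exp_pos _).le

theorem norm_gauss (x : Space d) : ‖gauss d x‖ = gaussR d x := by
  rw [gauss_apply, Complex.norm_real, Real.norm_of_nonneg (gaussR_nonneg x)]

theorem integral_norm_gauss : ∫ x, ‖gauss d x‖ = 1 := by
  simp only [norm_gauss]; exact integral_gaussR

theorem norm_moll_gauss_le {f : Space d → ℂ} {A : ℝ} (hA : ∀ x, ‖f x‖ ≤ A) (t : ℝ) (x : Space d) :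
    ‖moll (gauss d) f t x‖ ≤ A := by
  have := norm_moll_le (gauss d).integrable hA t x
  rwa [integral_norm_gauss, one_mul] at this

/-- Jensen for the Gaussian at scale t, which is then dominated by (√3)^d ≤ 2^d times the wider
Gaussian at scale √3 t. The wider one is the weight in the variance estimate. -/
theorem norm_moll_gauss_sub_sq_le {u : Space d → ℂ} {A : ℝ} (hu : Measurable u)
    (hA : ∀ x, ‖u x‖ ≤ A) (t : ℝ) (y : Space d) (p : ℂ) :
    ‖moll (gauss d) u t y - p‖ ^ 2 ≤
      2 ^ d * ∫ w, gaussR d w * ‖u (y - (√3 * t) • w) - p‖ ^ 2 := by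
  have hm : ∀ s : ℝ, Measurable fun w : Space d => u (y - s • w) - p := fun s =>
    (hu.comp (by fun_prop)).sub_const p
  have hi : ∀ wt : Space d → ℝ, Integrable wt → ∀ s : ℝ,
      Integrable fun w => wt w * ‖u (y - s • w) - p‖ ^ 2 := fun wt hwt s => by
    refine hwt.mul_bdd (c := (A + ‖p‖) ^ 2) ((hm s).norm.pow_const 2).aestronglyMeasurable
      (Filter.Eventually.of_forall fun w => ?_)
    rw [norm_pow, norm_norm]
    exact pow_le_pow_left₀ (norm_nonneg _)
      ((norm_sub_le _ _).trans (by linarith [hA (y - s • w)])) 2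
  have hi1 : Integrable fun w => gaussR d w * ‖u (y - t • w) - p‖ := by
    refine (gaussR d).integrable.mul_bdd (c := A + ‖p‖) (hm t).norm.aestronglyMeasurable
      (Filter.Eventually.of_forall fun w => ?_)
    rw [norm_norm]
    exact (norm_sub_le _ _).trans (by linarith [hA (y - t • w)])
  have h1 : ‖moll (gauss d) u t y - p‖ ≤ ∫ w, gaussR d w * ‖u (y - t • w) - p‖ := by
    have e : moll (gauss d) u t y - p = ∫ w, gauss d w * (u (y - t • w) - p) := by
      simp only [mul_sub]
      rw [integral_sub (integrable_mul_bounded (gauss d).integrable hu hA t y)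
        ((gauss d).integrable.mul_const p), integral_mul_const]
      have : ∫ w, gauss d w = 1 := by
        simp only [gauss_apply]
        rw [integral_complex_ofReal, integral_gaussR, Complex.ofReal_one]
      rw [this, one_mul]; rfl
    rw [e]
    refine (norm_integral_le_integral_norm _).trans (le_of_eq ?_)
    simp only [norm_mul, norm_gauss]
  set I := ∫ w, gaussR d w * ‖u (y - t • w) - p‖ with hI
  have h2 : I ^ 2 ≤ ∫ w, gaussR d w * ‖u (y - t • w) - p‖ ^ 2 := by
    have h3 : 0 ≤ ∫ w, gaussR d w * (‖u (y - t • w) - p‖ - I) ^ 2 :=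
      integral_nonneg fun w => mul_nonneg (gaussR_nonneg w) (sq_nonneg _)
    have e : ∀ w, gaussR d w * (‖u (y - t • w) - p‖ - I) ^ 2 =
        gaussR d w * ‖u (y - t • w) - p‖ ^ 2 - 2 * I * (gaussR d w * ‖u (y - t • w) - p‖) +
          I ^ 2 * gaussR d w := fun w => by ring
    simp only [e] at h3
    have j1 := hi _ (gaussR d).integrable t
    have j2 : Integrable fun w => 2 * I * (gaussR d w * ‖u (y - t • w) - p‖) := hi1.const_mul _
    have j3 : Integrable fun w => I ^ 2 * gaussR d w := (gaussR d).integrable.const_mul _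
    have j4 : Integrable fun w => gaussR d w * ‖u (y - t • w) - p‖ ^ 2 -
        2 * I * (gaussR d w * ‖u (y - t • w) - p‖) := j1.sub j2
    rw [integral_add j4 j3, integral_sub j1 j2, integral_const_mul, integral_const_mul,
      integral_gaussR, ← hI] at h3
    nlinarith
  have hs3 : (0 : ℝ) < √3 := by positivity
  have h4 : ∫ w, gaussR d w * ‖u (y - t • w) - p‖ ^ 2 =
      √3 ^ d * ∫ w, gaussR d (√3 • w) * ‖u (y - (√3 * t) • w) - p‖ ^ 2 := by
    have e : ∀ w, gaussR d (√3 • w) * ‖u (y - (√3 * t) • w) - p‖ ^ 2 =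
        (fun w => gaussR d w * ‖u (y - t • w) - p‖ ^ 2) (√3 • w) := fun w => by
      simp only [smul_smul, mul_comm]
    rw [integral_congr_ae (Filter.Eventually.of_forall e), Measure.integral_comp_smul volume
      (fun w => gaussR d w * ‖u (y - t • w) - p‖ ^ 2) √3]
    simp only [finrank_euclideanSpace, Fintype.card_fin, smul_eq_mul]
    rw [abs_of_pos (by positivity), ← mul_assoc, mul_inv_cancel₀ (by positivity), one_mul]
  have hle : ∀ w, gaussR d (√3 • w) ≤ gaussR d w := fun w => by
    simp only [gaussR_apply, norm_smul, mul_pow, Real.norm_eq_abs, sq_abs]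
    rw [Real.sq_sqrt (by norm_num)]
    refine Real.exp_le_exp.2 ?_
    nlinarith [Real.pi_pos, sq_nonneg ‖w‖, mul_nonneg Real.pi_pos.le (sq_nonneg ‖w‖)]
  have hs2 : √3 ≤ 2 := by rw [Real.sqrt_le_left (by norm_num)]; norm_num
  calc _ ≤ I ^ 2 := pow_le_pow_left₀ (norm_nonneg _) h1 2
    _ ≤ _ := h2
    _ = _ := h4
    _ ≤ 2 ^ d * ∫ w, gaussR d w * ‖u (y - (√3 * t) • w) - p‖ ^ 2 := by
        refine mul_le_mul (pow_le_pow_left₀ hs3.le hs2 d) ?_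
          (integral_nonneg fun w => mul_nonneg (gaussR_nonneg _) (sq_nonneg _)) (by positivity)
        refine integral_mono (hi _ ((gaussR d).integrable.comp_smul hs3.ne') _)
          (hi _ (gaussR d).integrable _) fun w => ?_
        exact mul_le_mul_of_nonneg_right (hle w) (sq_nonneg _)

theorem carlesonDensity_nonneg (A : ℝ) (a b : ℂ) : 0 ≤ carlesonDensity A a b := by
  unfold carlesonDensity; positivity

theorem lintegral_average {wt : Space d → ℝ≥0∞} {G : Space d → ℝ≥0∞} (hwt : Measurable wt)
    (hG : Measurable G) (s : ℝ) :
    ∫⁻ y, ∫⁻ w, wt w * G (y - s • w) = (∫⁻ w, wt w) * ∫⁻ y, G y := by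
  rw [lintegral_lintegral_swap]
  · have : ∀ w : Space d, ∫⁻ y, wt w * G (y - s • w) = wt w * ∫⁻ y, G y := fun w => by
      rw [lintegral_const_mul _ (by fun_prop), lintegral_sub_right_eq_self G (s • w)]
    simp only [this]
    rw [lintegral_mul_const _ hwt]
  · exact ((hwt.comp measurable_snd).mul (hG.comp (by fun_prop))).aemeasurable

/-- With u, v the averages at scale t, the scales 2t and √2 t are reached from u, v by averaging at
scales √3 t and t. The variance of u at scale √3 t dominates the squared difference and is the gain
in Jensen's inequality; integrating in y uses that the Gaussian has mass one. -/
theorem carleson_step {f g : Space d → ℂ} {A B : ℝ} (hf : Measurable f) (hA : ∀ x, ‖f x‖ ≤ A)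
    (hg : Measurable g) (hB : ∀ x, ‖g x‖ ≤ B) {t : ℝ} (ht : 0 < t) :
    (∫⁻ y, ENNReal.ofReal (‖moll (gauss d) f (√2 * t) y - moll (gauss d) f (2 * t) y‖ ^ 2 *
        ‖moll (gauss d) g (2 * t) y‖ ^ 2)) +
      2 ^ d * ∫⁻ y, ENNReal.ofReal
        (carlesonDensity A (moll (gauss d) f (2 * t) y) (moll (gauss d) g (2 * t) y)) ≤
      2 ^ d * ∫⁻ y, ENNReal.ofReal
        (carlesonDensity A (moll (gauss d) f t y) (moll (gauss d) g t y)) := by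
  have hγ := (gauss d).continuous.measurable
  set u := moll (gauss d) f t
  set v := moll (gauss d) g t
  have hu : Measurable u := measurable_moll_right hγ hf t
  have hv : Measurable v := measurable_moll_right hγ hg t
  have huA : ∀ x, ‖u x‖ ≤ A := norm_moll_gauss_le hA t
  have hvB : ∀ x, ‖v x‖ ≤ B := norm_moll_gauss_le hB t
  have hs : 0 < √3 * t := by positivity
  -- Squares of scales add under the Gaussian semigroup.
  have e3 : (√3 * t) ^ 2 + t ^ 2 = (2 * t) ^ 2 := by
    rw [mul_pow, Real.sq_sqrt (by norm_num)]; ring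
  have e2 : t ^ 2 + t ^ 2 = (√2 * t) ^ 2 := by
    rw [mul_pow, Real.sq_sqrt (by norm_num)]; ring
  have hfy : ∀ y, moll (gauss d) f (2 * t) y = moll (gauss d) u (√3 * t) y := fun y =>
    (moll_gauss_moll_gauss hf hA hs (by positivity) e3 y).symm
  have hgy : ∀ y, moll (gauss d) g (2 * t) y = moll (gauss d) v (√3 * t) y := fun y =>
    (moll_gauss_moll_gauss hg hB hs (by positivity) e3 y).symm
  have hJy : ∀ y, moll (gauss d) f (√2 * t) y = moll (gauss d) u t y := fun y =>
    (moll_gauss_moll_gauss hf hA ht (by positivity) e2 y).symm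
  simp only [hfy, hgy, hJy]
  have key : ∀ y, ENNReal.ofReal (‖moll (gauss d) u t y - moll (gauss d) u (√3 * t) y‖ ^ 2 *
        ‖moll (gauss d) v (√3 * t) y‖ ^ 2) + 2 ^ d * ENNReal.ofReal
        (carlesonDensity A (moll (gauss d) u (√3 * t) y) (moll (gauss d) v (√3 * t) y)) ≤
      2 ^ d * ∫⁻ w, ENNReal.ofReal (gaussR d w) * ENNReal.ofReal (carlesonDensity A
        (u (y - (√3 * t) • w)) (v (y - (√3 * t) • w))) := by
    intro y
    have h1 := integral_carlesonDensity (wt := gaussR d) (a := fun w => u (y - (√3 * t) • w))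
      (b := fun w => v (y - (√3 * t) • w)) (gaussR d).integrable gaussR_nonneg integral_gaussR
      (hu.comp (by fun_prop)) (fun w => huA _) (hv.comp (by fun_prop)) (fun w => hvB _)
      (p := moll (gauss d) u (√3 * t) y) (q := moll (gauss d) v (√3 * t) y) rfl rfl
    have h2 := norm_moll_gauss_sub_sq_le hu huA t y (moll (gauss d) u (√3 * t) y)
    have h3 : ‖moll (gauss d) u t y - moll (gauss d) u (√3 * t) y‖ ^ 2 *
        ‖moll (gauss d) v (√3 * t) y‖ ^ 2 + 2 ^ d *
        (carlesonDensity A (moll (gauss d) u (√3 * t) y) (moll (gauss d) v (√3 * t) y)) ≤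
        2 ^ d * ∫ w, gaussR d w * carlesonDensity A
          (u (y - (√3 * t) • w)) (v (y - (√3 * t) • w)) := by
      have h4 := mul_le_mul_of_nonneg_right h2 (sq_nonneg ‖moll (gauss d) v (√3 * t) y‖)
      have h5 := mul_le_mul_of_nonneg_left h1 (by positivity : (0 : ℝ) ≤ 2 ^ d)
      rw [mul_add] at h5
      linarith
    have h2d : (2 : ℝ≥0∞) ^ d = ENNReal.ofReal (2 ^ d) := by
      rw [ENNReal.ofReal_pow (by norm_num)]; simp
    rw [h2d, ← ENNReal.ofReal_mul (by positivity),
      ← ENNReal.ofReal_add (by positivity)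
        (mul_nonneg (by positivity) (carlesonDensity_nonneg _ _ _))]
    refine (ENNReal.ofReal_le_ofReal h3).trans (le_of_eq ?_)
    rw [ENNReal.ofReal_mul (by positivity)]
    congr 1
    rw [ofReal_integral_eq_lintegral_ofReal]
    · congr 1; ext w; rw [ENNReal.ofReal_mul (gaussR_nonneg w)]
    · refine (gaussR d).integrable.mul_bdd (c := 2 * A ^ 2 * B ^ 2 + 16 * A ^ 2 * B ^ 2) ?_
        (Filter.Eventually.of_forall fun w => ?_)
      · unfold carlesonDensity
        have h6 : Measurable fun w => u (y - (√3 * t) • w) := hu.comp (by fun_prop)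
        have h7 : Measurable fun w => v (y - (√3 * t) • w) := hv.comp (by fun_prop)
        exact Measurable.aestronglyMeasurable (by fun_prop)
      · unfold carlesonDensity
        rw [Real.norm_of_nonneg (by positivity)]
        have := huA (y - (√3 * t) • w); have := hvB (y - (√3 * t) • w)
        gcongr
    · exact Filter.Eventually.of_forall fun w =>
        mul_nonneg (gaussR_nonneg w) (carlesonDensity_nonneg _ _ _)
  have hGm : Measurable fun y => ENNReal.ofReal (carlesonDensity A (u y) (v y)) := by
    unfold carlesonDensity; fun_prop
  have hm1 := measurable_moll_right hγ hu (√3 * t)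
  have hm2 := measurable_moll_right hγ hv (√3 * t)
  have hm3 := measurable_moll_right hγ hu t
  rw [← lintegral_const_mul' _ _ (by simp), ← lintegral_add_left (by fun_prop)]
  refine (lintegral_mono key).trans (le_of_eq ?_)
  rw [lintegral_const_mul' _ _ (by simp),
    lintegral_average (gaussR d).continuous.measurable.ennreal_ofReal hGm,
    ← ofReal_integral_eq_lintegral_ofReal (gaussR d).integrable
      (Filter.Eventually.of_forall gaussR_nonneg), integral_gaussR, ENNReal.ofReal_one, one_mul]

/-- Carleson's embedding for Gaussian averages. -/
theorem sum_lintegral_gauss_le {f : Space d → ℂ} {A : ℝ} (hf : Measurable f)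
    (hA : ∀ x, ‖f x‖ ≤ A) (g : 𝓢(Space d, ℂ)) {τ : ℝ} (hτ : 0 < τ) (K : ℕ) :
    ∑ i ∈ Finset.range K, ∫⁻ y, ENNReal.ofReal (‖moll (gauss d) f (√2 * (2 ^ i * τ)) y -
      moll (gauss d) f (2 * (2 ^ i * τ)) y‖ ^ 2 * ‖moll (gauss d) g (2 * (2 ^ i * τ)) y‖ ^ 2) ≤
      ENNReal.ofReal (2 ^ d * (18 * A ^ 2)) * ∫⁻ x, ‖g x‖ₑ ^ 2 := by
  obtain ⟨B, -, hB⟩ := g.decay 0 0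
  simp only [pow_zero, one_mul, norm_iteratedFDeriv_zero] at hB
  -- The telescoping quantity: each summand is at most its drop from one dyadic scale to the next.
  set N : ℝ → ℝ≥0∞ := fun t => 2 ^ d * ∫⁻ y, ENNReal.ofReal
        (carlesonDensity A (moll (gauss d) f t y) (moll (gauss d) g t y))
  have h1 : ∀ K : ℕ, (∑ i ∈ Finset.range K, ∫⁻ y, ENNReal.ofReal
      (‖moll (gauss d) f (√2 * (2 ^ i * τ)) y - moll (gauss d) f (2 * (2 ^ i * τ)) y‖ ^ 2 *
        ‖moll (gauss d) g (2 * (2 ^ i * τ)) y‖ ^ 2)) + N (2 ^ K * τ) ≤ N τ := by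
    intro K
    induction K with
    | zero => simp
    | succ K ih =>
      rw [Finset.sum_range_succ, add_assoc]
      refine le_trans ?_ ih
      gcongr
      have := carleson_step hf hA g.continuous.measurable hB (t := 2 ^ K * τ) (by positivity)
      rw [show (2 : ℝ) ^ (K + 1) * τ = 2 * (2 ^ K * τ) by ring]
      exact this
  refine (le_self_add.trans (h1 K)).trans ?_
  have hA0 : 0 ≤ A := (norm_nonneg _).trans (hA 0)
  -- The constant 18 is 2 + 16, the two coefficients of the density when the first average is
  -- bounded by A.
  have h2 : ∫⁻ y, ENNReal.ofReal
      (carlesonDensity A (moll (gauss d) f τ y) (moll (gauss d) g τ y)) ≤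
      ENNReal.ofReal (18 * A ^ 2) * ∫⁻ y, ‖moll (gauss d) g τ y‖ₑ ^ 2 := by
    rw [← lintegral_const_mul' _ _ ENNReal.ofReal_ne_top]
    refine lintegral_mono fun y => ?_
    rw [← ofReal_norm, ← ENNReal.ofReal_pow (norm_nonneg _),
      ← ENNReal.ofReal_mul (by positivity)]
    refine ENNReal.ofReal_le_ofReal ?_
    unfold carlesonDensity
    have := norm_moll_gauss_le hA τ y
    have : ‖moll (gauss d) f τ y‖ ^ 2 ≤ A ^ 2 := pow_le_pow_left₀ (norm_nonneg _) this 2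
    nlinarith [sq_nonneg ‖moll (gauss d) g τ y‖]
  have h3 : ∫⁻ y, ‖moll (gauss d) g τ y‖ₑ ^ 2 ≤ ∫⁻ x, ‖g x‖ₑ ^ 2 := by
    rw [lintegral_moll_sq, ← lintegral_enorm_sq_fourier g]
    refine lintegral_mono fun ξ => ?_
    refine mul_le_of_le_one_left' (pow_le_one₀ (by simp) ?_)
    rw [fourier_gauss, ← ofReal_norm, norm_gauss, ENNReal.ofReal_le_one, gaussR_apply]
    refine Real.exp_le_one_iff.2 ?_
    have := mul_nonneg Real.pi_pos.le (sq_nonneg ‖τ • ξ‖)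
    linarith
  have h2d : (2 : ℝ≥0∞) ^ d = ENNReal.ofReal (2 ^ d) := by
    rw [ENNReal.ofReal_pow (by norm_num)]; simp
  rw [ENNReal.ofReal_mul (by positivity), mul_assoc, ← h2d]
  simp only [N]
  gcongr
  exact h2.trans (by gcongr)

end

/-! ### Carleson's embedding for kernels with spectrum in a corona -/

section

variable {d : ℕ}

theorem fourier_dil (κ : Space d → ℂ) {m : ℝ} (hm : m ≠ 0) (ξ : Space d) :
    𝓕 (dil m κ) ξ = 𝓕 κ (m • ξ) := by
  simp only [Real.fourier_eq]
  have e : ∀ v : Space d, Real.fourierChar (-inner ℝ v ξ) • dil m κ v =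
      ((1 / |m| ^ d : ℝ) : ℂ) *
        (fun v => Real.fourierChar (-inner ℝ v (m • ξ)) • κ v) (m⁻¹ • v) := by
    intro v
    have hi : inner ℝ (m⁻¹ • v) (m • ξ) = inner ℝ v ξ := by
      rw [inner_smul_left, inner_smul_right, conj_trivial, inv_mul_cancel_left₀ hm]
    simp only [dil, hi, Circle.smul_def, smul_eq_mul]
    ring
  rw [integral_congr_ae (Filter.Eventually.of_forall e), integral_const_mul,
    Measure.integral_comp_inv_smul volume
      (fun v => Real.fourierChar (-inner ℝ v (m • ξ)) • κ v) m]
  simp only [finrank_euclideanSpace, Fintype.card_fin, Complex.real_smul]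
  rw [← mul_assoc, ← Complex.ofReal_mul, abs_pow, one_div, inv_mul_cancel₀ (by positivity)]
  simp

theorem exists_schwartz_dil (κ : 𝓢(Space d, ℂ)) {m : ℝ} (hm : m ≠ 0) :
    ∃ κ' : 𝓢(Space d, ℂ), (κ' : Space d → ℂ) = dil m κ := by
  let e : Space d ≃L[ℝ] Space d := ContinuousLinearEquiv.smulLeft (Units.mk0 m⁻¹ (inv_ne_zero hm))
  refine ⟨((1 / |m| ^ d : ℝ) : ℂ) • SchwartzMap.compCLMOfContinuousLinearEquiv ℂ e κ, ?_⟩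
  ext x
  rfl

/-- A Schwartz function with spectrum in a corona is an average of differences of Gaussians. -/
theorem exists_moll_eq_moll_gauss_sub (ζ : 𝓢(Space d, ℂ)) {r R : ℝ} (hr : 0 < r)
    (hζr : ∀ ξ, ‖ξ‖ ≤ r → 𝓕 ζ ξ = 0) (hζR : ∀ ξ, R < ‖ξ‖ → 𝓕 ζ ξ = 0) :
    ∃ η : 𝓢(Space d, ℂ), ∀ (f : Space d → ℂ) (A : ℝ), Measurable f → (∀ x, ‖f x‖ ≤ A) → ∀ t x,
      moll ζ f t x =
        moll η (fun y => moll (gauss d) f (√2 * t) y - moll (gauss d) f (2 * t) y) t x := by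
  -- The symbol of the difference of the Gaussians at scales √2 and 2. It vanishes only at the
  -- origin, so division by it is smooth on the corona.
  let D : Space d → ℂ := fun ξ => gauss d (√2 • ξ) - gauss d ((2 : ℝ) • ξ)
  have hD : ∀ ξ, ξ ≠ 0 → D ξ ≠ 0 := by
    intro ξ hξ h
    simp only [D, gauss_apply, gaussR_apply] at h
    rw [sub_eq_zero, Complex.ofReal_inj, Real.exp_eq_exp] at h
    simp only [norm_smul, mul_pow, Real.norm_eq_abs, sq_abs] at h
    rw [Real.sq_sqrt (by norm_num)] at h
    have : 0 < Real.pi * ‖ξ‖ ^ 2 := by have := norm_pos_iff.2 hξ; positivity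
    linarith
  have hDs : ContDiff ℝ ∞ D :=
    (((gauss d).smooth ⊤).comp (by fun_prop)).sub (((gauss d).smooth ⊤).comp (by fun_prop))
  let m : Space d → ℂ := fun ξ => 𝓕 ζ ξ / D ξ
  have hts : tsupport m ⊆ {ξ | r ≤ ‖ξ‖ ∧ ‖ξ‖ ≤ R} := by
    refine closure_minimal (fun ξ hξ => ?_)
      ((isClosed_le continuous_const continuous_norm).inter
        (isClosed_le continuous_norm continuous_const))
    refine ⟨?_, ?_⟩
    · by_contra h; exact hξ (by simp only [m]; rw [hζr ξ (not_le.1 h).le, zero_div])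
    · by_contra h; exact hξ (by simp only [m]; rw [hζR ξ (not_le.1 h), zero_div])
  have hmc : HasCompactSupport m := by
    refine HasCompactSupport.intro (isCompact_closedBall (0 : Space d) R) fun ξ hξ => ?_
    simp only [m]
    rw [hζR ξ (by simpa using hξ), zero_div]
  have hms : ContDiff ℝ ∞ m := by
    refine contDiff_iff_contDiffAt.2 fun ξ => ?_
    by_cases hξ : ξ ∈ tsupport m
    swap
    · exact contDiffAt_const.congr_of_eventuallyEq (notMem_tsupport_iff_eventuallyEq.1 hξ)
    have hξ0 : ξ ≠ 0 := by
      rintro rfl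
      have := (hts hξ).1
      simp only [norm_zero] at this; linarith
    simp only [m, div_eq_mul_inv]
    exact ((𝓕 ζ : 𝓢(Space d, ℂ)).smooth ⊤).contDiffAt.mul (hDs.contDiffAt.inv (hD ξ hξ0))
  let mS : 𝓢(Space d, ℂ) := hmc.toSchwartzMap hms
  have hmS : ∀ ξ, mS ξ = m ξ := fun ξ => rfl
  refine ⟨𝓕⁻ mS, fun f A hf hA t x => ?_⟩
  have hg : ∀ s : ℝ, Function.HasTemperateGrowth fun ξ : Space d => gauss d (s • ξ) := fun s =>
    (gauss d).hasTemperateGrowth.comp (s • ContinuousLinearMap.id ℝ (Space d)).hasTemperateGrowth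
  have h1 : ∀ s : ℝ, moll (gauss d) (𝓕⁻ mS : 𝓢(Space d, ℂ)) s =
      (𝓕⁻ (SchwartzMap.smulLeftCLM ℂ (fun ξ => gauss d (s • ξ)) mS) : 𝓢(Space d, ℂ)) := by
    intro s; ext w
    rw [moll_eq_fourierInv (gauss d).integrable, SchwartzMap.fourierInv_coe]
    refine congrArg (fun F : Space d → ℂ => 𝓕⁻ F w) (funext fun ξ => ?_)
    rw [SchwartzMap.smulLeftCLM_apply_apply (hg s), smul_eq_mul, ← SchwartzMap.fourier_coe,
      fourier_gauss, FourierTransform.fourier_fourierInv_eq]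
  have h2 : SchwartzMap.smulLeftCLM ℂ (fun ξ => gauss d (√2 • ξ)) mS -
      SchwartzMap.smulLeftCLM ℂ (fun ξ => gauss d ((2 : ℝ) • ξ)) mS = 𝓕 ζ := by
    ext ξ
    rw [sub_apply, SchwartzMap.smulLeftCLM_apply_apply (hg _),
      SchwartzMap.smulLeftCLM_apply_apply (hg _), smul_eq_mul, smul_eq_mul, ← sub_mul, hmS]
    change D ξ * (𝓕 ζ ξ / D ξ) = 𝓕 ζ ξ
    rcases eq_or_ne ξ 0 with rfl | hξ
    · rw [hζr 0 (by simpa using hr.le)]; simp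
    · rw [mul_div_cancel₀ _ (hD ξ hξ)]
  have h3 : ∀ w, ζ w = moll (gauss d) (𝓕⁻ mS : 𝓢(Space d, ℂ)) √2 w -
      moll (gauss d) (𝓕⁻ mS : 𝓢(Space d, ℂ)) 2 w := by
    intro w
    rw [h1, h1, ← sub_apply]
    have := map_sub (FourierTransform.fourierInvCLM ℂ 𝓢(Space d, ℂ))
      (SchwartzMap.smulLeftCLM ℂ (fun ξ => gauss d (√2 • ξ)) mS)
      (SchwartzMap.smulLeftCLM ℂ (fun ξ => gauss d ((2 : ℝ) • ξ)) mS)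
    simp only [FourierTransform.fourierInvCLM_apply] at this
    rw [← this, h2, FourierTransform.fourierInv_fourier_eq]
  have hη : Integrable (𝓕⁻ mS : 𝓢(Space d, ℂ)) := SchwartzMap.integrable (μ := volume) _
  have hγ : Integrable (gauss d) := (gauss d).integrable
  have h4 : (ζ : Space d → ℂ) = fun w => moll (gauss d) (𝓕⁻ mS : 𝓢(Space d, ℂ)) √2 w -
      moll (gauss d) (𝓕⁻ mS : 𝓢(Space d, ℂ)) 2 w := funext h3
  rw [h4, moll_sub (integrable_moll hγ hη _) (integrable_moll hγ hη _) hf hA,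
    ← moll_moll hη hγ hf hA, ← moll_moll hη hγ hf hA]
  simp only [moll, mul_sub]
  rw [integral_sub]
  · exact integrable_mul_bounded hη
      (measurable_moll_right (gauss d).continuous.measurable hf _) (norm_moll_gauss_le hA _) _ _
  · exact integrable_mul_bounded hη
      (measurable_moll_right (gauss d).continuous.measurable hf _) (norm_moll_gauss_le hA _) _ _

/-- Cauchy–Schwarz with weight |η|, read off from ∫ |η| (a|J| − I)² ≥ 0 with a the mass of the
weight. If a = 0, then I = 0 since J is bounded. -/
theorem enorm_moll_sq_le (η : 𝓢(Space d, ℂ)) {J : Space d → ℂ} {A : ℝ} (hJ : Measurable J)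
    (hA : ∀ x, ‖J x‖ ≤ A) (t : ℝ) (x : Space d) :
    ‖moll η J t x‖ₑ ^ 2 ≤ ENNReal.ofReal (∫ w, ‖η w‖) *
      ∫⁻ w, ‖η w‖ₑ * ‖J (x - t • w)‖ₑ ^ 2 := by
  have hm : Measurable fun w : Space d => J (x - t • w) := hJ.comp (by fun_prop)
  set a := ∫ w, ‖η w‖ with ha
  have hη : Integrable fun w => ‖η w‖ := η.integrable.norm
  have ha0 : 0 ≤ a := integral_nonneg fun w => norm_nonneg _
  have i1 : Integrable fun w => ‖η w‖ * ‖J (x - t • w)‖ :=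
    hη.mul_bdd (c := A) hm.norm.aestronglyMeasurable
      (Filter.Eventually.of_forall fun w => by rw [norm_norm]; exact hA _)
  have i2 : Integrable fun w => ‖η w‖ * ‖J (x - t • w)‖ ^ 2 :=
    hη.mul_bdd (c := A ^ 2) (hm.norm.pow_const 2).aestronglyMeasurable
      (Filter.Eventually.of_forall fun w => by
        rw [norm_pow, norm_norm]; exact pow_le_pow_left₀ (norm_nonneg _) (hA _) 2)
  set I := ∫ w, ‖η w‖ * ‖J (x - t • w)‖ with hI
  set Q := ∫ w, ‖η w‖ * ‖J (x - t • w)‖ ^ 2 with hQ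
  have hIQ : I ^ 2 ≤ a * Q := by
    have h3 : 0 ≤ ∫ w, ‖η w‖ * (a * ‖J (x - t • w)‖ - I) ^ 2 :=
      integral_nonneg fun w => by positivity
    have e : ∀ w, ‖η w‖ * (a * ‖J (x - t • w)‖ - I) ^ 2 =
        a ^ 2 * (‖η w‖ * ‖J (x - t • w)‖ ^ 2) - 2 * a * I * (‖η w‖ * ‖J (x - t • w)‖) +
          I ^ 2 * ‖η w‖ := fun w => by ring
    have j1 : Integrable fun w => a ^ 2 * (‖η w‖ * ‖J (x - t • w)‖ ^ 2) := i2.const_mul _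
    have j2 : Integrable fun w => 2 * a * I * (‖η w‖ * ‖J (x - t • w)‖) := i1.const_mul _
    have j3 : Integrable fun w => a ^ 2 * (‖η w‖ * ‖J (x - t • w)‖ ^ 2) -
        2 * a * I * (‖η w‖ * ‖J (x - t • w)‖) := j1.sub j2
    simp only [e] at h3
    rw [integral_add j3 (hη.const_mul _), integral_sub j1 j2, integral_const_mul,
      integral_const_mul, integral_const_mul, ← hI, ← hQ, ← ha] at h3
    rcases ha0.eq_or_lt with h | h
    · have h5 : I ≤ a * A := by
        rw [hI, ha, ← integral_mul_const]
        exact integral_mono i1 (hη.mul_const _) fun w =>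
          mul_le_mul_of_nonneg_left (hA _) (norm_nonneg _)
      have h6 : 0 ≤ I := integral_nonneg fun w => by positivity
      rw [← h] at h5 ⊢
      have : I = 0 := by linarith
      rw [this]; simp
    · by_contra hcon
      have : a * (a * Q - I ^ 2) < 0 := mul_neg_of_pos_of_neg h (by linarith)
      nlinarith
  have h1 : ‖moll η J t x‖ ≤ I := by
    refine (norm_integral_le_integral_norm _).trans (le_of_eq ?_)
    simp only [norm_mul, hI]
  have h2 : ∫⁻ w, ‖η w‖ₑ * ‖J (x - t • w)‖ₑ ^ 2 = ENNReal.ofReal Q := by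
    rw [hQ, ofReal_integral_eq_lintegral_ofReal i2
      (Filter.Eventually.of_forall fun w => by positivity)]
    congr 1; ext w
    rw [ENNReal.ofReal_mul (norm_nonneg _), ENNReal.ofReal_pow (norm_nonneg _), ofReal_norm,
      ofReal_norm]
  rw [h2, ← ENNReal.ofReal_mul ha0, ← ofReal_norm, ← ENNReal.ofReal_pow (norm_nonneg _)]
  exact ENNReal.ofReal_le_ofReal ((pow_le_pow_left₀ (norm_nonneg _) h1 2).trans hIQ)

theorem enorm_sq_le_two_mul (a b : ℂ) : ‖a‖ₑ ^ 2 ≤ 2 * ‖a - b‖ₑ ^ 2 + 2 * ‖b‖ₑ ^ 2 := by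
  have h : ‖a‖ ^ 2 ≤ 2 * ‖a - b‖ ^ 2 + 2 * ‖b‖ ^ 2 := by
    have h1 : ‖a‖ ≤ ‖a - b‖ + ‖b‖ := by simpa using norm_add_le (a - b) b
    nlinarith [sq_nonneg (‖a - b‖ - ‖b‖), norm_nonneg a]
  have := ENNReal.ofReal_le_ofReal h
  rw [ENNReal.ofReal_add (by positivity) (by positivity), ENNReal.ofReal_mul (by norm_num),
    ENNReal.ofReal_mul (by norm_num)] at this
  simpa [ENNReal.ofReal_pow] using this

theorem lintegral_enorm_mul_one_add_sq_lt_top (η : 𝓢(Space d, ℂ)) :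
    ∫⁻ w, ‖η w‖ₑ * ENNReal.ofReal ((1 + ‖w‖) ^ 2) < (⊤ : ℝ≥0∞) := by
  have h : Integrable fun w => ‖w‖ ^ 0 * ‖η w‖ + 2 * (‖w‖ ^ 1 * ‖η w‖) + ‖w‖ ^ 2 * ‖η w‖ :=
    ((η.integrable_pow_mul volume 0).add ((η.integrable_pow_mul volume 1).const_mul 2)).add
      (η.integrable_pow_mul volume 2)
  have h2 := h.hasFiniteIntegral
  refine lt_of_le_of_lt (lintegral_mono fun w => ?_) h2
  rw [← ofReal_norm, ← ENNReal.ofReal_mul (norm_nonneg _), ← ofReal_norm]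
  refine ENNReal.ofReal_le_ofReal ?_
  rw [Real.norm_of_nonneg (by positivity)]
  refine le_of_eq ?_; ring

/-- Carleson's embedding: the square function of a bounded function defines a Carleson measure. -/
theorem exists_carleson_embedding (ζ φ : 𝓢(Space d, ℂ)) {r R : ℝ} (hr : 0 < r)
    (hζr : ∀ ξ, ‖ξ‖ ≤ r → 𝓕 ζ ξ = 0) (hζR : ∀ ξ, R < ‖ξ‖ → 𝓕 ζ ξ = 0) :
    ∃ C, 0 ≤ C ∧ ∀ (f : Space d → ℂ) (A : ℝ), Measurable f → (∀ x, ‖f x‖ ≤ A) →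
      ∀ (g : 𝓢(Space d, ℂ)) (v : Space d) (τ : ℝ) (K : ℕ), 0 < τ →
      ∑ i ∈ Finset.range K, ∫⁻ x, ‖moll ζ f (2 ^ i * τ) x‖ₑ ^ 2 *
        ‖moll φ g (2 ^ i * τ) (x - (2 ^ i * τ) • v)‖ₑ ^ 2 ≤
        ENNReal.ofReal (C * A ^ 2 * (1 + ‖v‖) ^ 2) * ∫⁻ x, ‖g x‖ₑ ^ 2 := by
  obtain ⟨η, hη⟩ := exists_moll_eq_moll_gauss_sub ζ hr hζr hζR
  -- The kernel φ is compared with the multiple of the Gaussian at scale 2 that has the same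
  -- integral: the difference, even after a translation, is controlled by the square function, and
  -- the Gaussian part by the Gaussian embedding.
  set c := 𝓕 φ 0 with hc
  obtain ⟨γ₀, hγ₀⟩ := exists_schwartz_dil (gauss d) (two_ne_zero (α := ℝ))
  set γ : 𝓢(Space d, ℂ) := c • γ₀ with hγ
  have hγm : ∀ (g : Space d → ℂ) (t : ℝ) (x : Space d),
      moll γ g t x = c * moll (gauss d) g (2 * t) x := by
    intro g t x
    have : (γ : Space d → ℂ) = fun w => c * dil 2 (gauss d) w := by rw [← hγ₀]; rfl
    rw [this, moll_const_mul, moll_dil two_ne_zero, mul_comm t]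
  have hγ0 : 𝓕 φ 0 = 𝓕 γ 0 := by
    have e : ∀ x, γ x = c * γ₀ x := fun x => rfl
    rw [SchwartzMap.fourier_coe γ, ← integral_eq_fourier_zero]
    simp only [e]
    rw [integral_const_mul, hγ₀, integral_eq_fourier_zero, fourier_dil _ two_ne_zero, smul_zero,
      ← SchwartzMap.fourier_coe, fourier_gauss, gauss_apply, gaussR_apply]
    simp [hc]
  obtain ⟨C1, hC1, h1⟩ := exists_sum_lintegral_moll_sub_sq_le φ γ hγ0
  -- Here 8 = 2 · 4: a factor 2 from splitting the square, and |J|² ≤ 4A². The second summand is the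
  -- Gaussian embedding constant times 2|c|².
  set C2 : ℝ := 8 * C1 + 2 * ‖c‖ ^ 2 * (2 ^ d * 18) with hC2
  have hC20 : 0 ≤ C2 := by positivity
  set a := ∫ w, ‖η w‖ with ha
  have ha0 : 0 ≤ a := integral_nonneg fun w => norm_nonneg _
  set E := ∫⁻ w, ‖η w‖ₑ * ENNReal.ofReal ((1 + ‖w‖) ^ 2) with hE
  have hEtop : E ≠ (⊤ : ℝ≥0∞) := (lintegral_enorm_mul_one_add_sq_lt_top η).ne
  have hE' : E = ENNReal.ofReal E.toReal := (ENNReal.ofReal_toReal hEtop).symm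
  refine ⟨a * E.toReal * C2, by positivity, fun f A hf hA g v τ K hτ => ?_⟩
  have hA0 : 0 ≤ A := (norm_nonneg _).trans (hA 0)
  have hγmeas := (gauss d).continuous.measurable
  set J : ℝ → Space d → ℂ := fun t y =>
    moll (gauss d) f (√2 * t) y - moll (gauss d) f (2 * t) y with hJ
  have hJm : ∀ t, Measurable (J t) := fun t =>
    (measurable_moll_right hγmeas hf _).sub (measurable_moll_right hγmeas hf _)
  have hJA : ∀ t x, ‖J t x‖ ≤ 2 * A := fun t x => (norm_sub_le _ _).trans (by
    have := norm_moll_gauss_le hA (√2 * t) x; have := norm_moll_gauss_le hA (2 * t) x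
    linarith)
  have hGm : ∀ t, Measurable (moll φ g t) := fun t =>
    measurable_moll_right φ.continuous.measurable g.continuous.measurable t
  have hgm : ∀ t, Measurable (moll (gauss d) g t) := fun t =>
    measurable_moll_right hγmeas g.continuous.measurable t
  set S := ∫⁻ x, ‖g x‖ₑ ^ 2 with hS
  -- the estimate for the Gaussian differences
  have base : ∀ v' : Space d, ∑ i ∈ Finset.range K, ∫⁻ x, ‖J (2 ^ i * τ) x‖ₑ ^ 2 *
      ‖moll φ g (2 ^ i * τ) (x - (2 ^ i * τ) • v')‖ₑ ^ 2 ≤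
      ENNReal.ofReal (C2 * A ^ 2 * (1 + ‖v'‖) ^ 2) * S := by
    intro v'
    have hterm : ∀ i ∈ Finset.range K, ∫⁻ x, ‖J (2 ^ i * τ) x‖ₑ ^ 2 *
        ‖moll φ g (2 ^ i * τ) (x - (2 ^ i * τ) • v')‖ₑ ^ 2 ≤
        ENNReal.ofReal (8 * A ^ 2) * (∫⁻ x, ‖moll φ g (2 ^ i * τ) (x - (2 ^ i * τ) • v') -
            moll γ g (2 ^ i * τ) x‖ₑ ^ 2) +
          ENNReal.ofReal (2 * ‖c‖ ^ 2) * ∫⁻ y, ENNReal.ofReal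
            (‖moll (gauss d) f (√2 * (2 ^ i * τ)) y - moll (gauss d) f (2 * (2 ^ i * τ)) y‖ ^ 2 *
              ‖moll (gauss d) g (2 * (2 ^ i * τ)) y‖ ^ 2) := by
      intro i _
      set t := 2 ^ i * τ
      have m1 : Measurable fun y => ENNReal.ofReal
          (‖moll (gauss d) f (√2 * t) y - moll (gauss d) f (2 * t) y‖ ^ 2 *
            ‖moll (gauss d) g (2 * t) y‖ ^ 2) :=
        (((hJm t).norm.pow_const 2).mul ((hgm (2 * t)).norm.pow_const 2)).ennreal_ofReal
      rw [← lintegral_const_mul' _ _ ENNReal.ofReal_ne_top, ← lintegral_const_mul _ m1,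
        ← lintegral_add_right _ (m1.const_mul _)]
      refine lintegral_mono fun x => ?_
      refine (mul_le_mul_right (enorm_sq_le_two_mul _ (moll γ g t x)) _).trans ?_
      rw [mul_add]
      refine add_le_add ?_ (le_of_eq ?_)
      · rw [← mul_assoc]
        refine mul_le_mul_left ?_ _
        have : ‖J t x‖ₑ ^ 2 * 2 = ENNReal.ofReal (‖J t x‖ ^ 2 * 2) := by
          rw [ENNReal.ofReal_mul (by positivity), ENNReal.ofReal_pow (norm_nonneg _), ofReal_norm]
          simp
        rw [this]
        refine ENNReal.ofReal_le_ofReal ?_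
        have := pow_le_pow_left₀ (norm_nonneg _) (hJA t x) 2
        nlinarith
      · rw [hγm, enorm_mul, ENNReal.ofReal_mul (by positivity), ENNReal.ofReal_mul (by positivity),
          ENNReal.ofReal_pow (norm_nonneg _), ENNReal.ofReal_pow (norm_nonneg _),
          ENNReal.ofReal_pow (norm_nonneg _), ofReal_norm, ofReal_norm, ofReal_norm]
        simp only [hJ, ENNReal.ofReal_ofNat]
        ring
    refine (Finset.sum_le_sum hterm).trans ?_
    rw [Finset.sum_add_distrib, ← Finset.mul_sum, ← Finset.mul_sum]
    refine (add_le_add (mul_le_mul_right (h1 v' g τ K hτ) _)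
      (mul_le_mul_right (sum_lintegral_gauss_le hf hA g hτ K) _)).trans ?_
    rw [← mul_assoc, ← mul_assoc, ← ENNReal.ofReal_mul (by positivity),
      ← ENNReal.ofReal_mul (by positivity), ← add_mul,
      ← ENNReal.ofReal_add (by positivity) (by positivity)]
    refine mul_le_mul_left (ENNReal.ofReal_le_ofReal ?_) _
    have hv1 : 1 ≤ (1 + ‖v'‖) ^ 2 := one_le_pow₀ (by linarith [norm_nonneg v'])
    have : 2 * ‖c‖ ^ 2 * (2 ^ d * 18) * A ^ 2 ≤
        2 * ‖c‖ ^ 2 * (2 ^ d * 18) * A ^ 2 * (1 + ‖v'‖) ^ 2 :=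
      le_mul_of_one_le_right (by positivity) hv1
    rw [hC2]
    linarith
  have hterm2 : ∀ i ∈ Finset.range K, ∫⁻ x, ‖moll ζ f (2 ^ i * τ) x‖ₑ ^ 2 *
        ‖moll φ g (2 ^ i * τ) (x - (2 ^ i * τ) • v)‖ₑ ^ 2 ≤
      ENNReal.ofReal a * ∫⁻ w, ‖η w‖ₑ * ∫⁻ x, ‖J (2 ^ i * τ) x‖ₑ ^ 2 *
      ‖moll φ g (2 ^ i * τ) (x - (2 ^ i * τ) • (v - w))‖ₑ ^ 2 := by
    intro i _
    set t := 2 ^ i * τ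
    have hηm : Measurable fun w => ‖η w‖ₑ := η.continuous.measurable.enorm
    calc _ ≤ ∫⁻ x, ENNReal.ofReal a * ∫⁻ w, ‖η w‖ₑ * (‖J t (x - t • w)‖ₑ ^ 2 *
          ‖moll φ g t (x - t • v)‖ₑ ^ 2) := by
          refine lintegral_mono fun x => ?_
          have := enorm_moll_sq_le η (hJm t) (hJA t) t x
          rw [hη f A hf hA t x]
          refine (mul_le_mul_left this _).trans (le_of_eq ?_)
          rw [mul_assoc, ← lintegral_mul_const]
          · simp only [mul_assoc, ha]
          · have := hJm t; fun_prop
      _ = ENNReal.ofReal a * ∫⁻ x, ∫⁻ w, ‖η w‖ₑ * (‖J t (x - t • w)‖ₑ ^ 2 *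
          ‖moll φ g t (x - t • v)‖ₑ ^ 2) := lintegral_const_mul' _ _ ENNReal.ofReal_ne_top
      _ = ENNReal.ofReal a * ∫⁻ w, ∫⁻ x, ‖η w‖ₑ * (‖J t (x - t • w)‖ₑ ^ 2 *
          ‖moll φ g t (x - t • v)‖ₑ ^ 2) := by
          rw [lintegral_lintegral_swap]
          have := hJm t; have := hGm t
          have := η.continuous.measurable
          exact Measurable.aemeasurable (by fun_prop)
      _ = _ := by
          congr 1; congr 1; ext w
          rw [lintegral_const_mul]
          · congr 1
            rw [← lintegral_sub_right_eq_self (fun x => ‖J t x‖ₑ ^ 2 *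
              ‖moll φ g t (x - t • (v - w))‖ₑ ^ 2) (t • w)]
            congr 1; ext x
            rw [show x - t • w - t • (v - w) = x - t • v by module]
          · have := hJm t; have := hGm t
            fun_prop
  refine (Finset.sum_le_sum hterm2).trans ?_
  rw [← Finset.mul_sum, ← lintegral_finsetSum']
  swap
  · intro i _
    have m1 := hJm (2 ^ i * τ)
    have m2 := hGm (2 ^ i * τ)
    have m3 := η.continuous.measurable
    have : Measurable fun w => ∫⁻ x, ‖J (2 ^ i * τ) x‖ₑ ^ 2 *
      ‖moll φ g (2 ^ i * τ) (x - (2 ^ i * τ) • (v - w))‖ₑ ^ 2 :=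
      Measurable.lintegral_prod_right' (f := fun q : Space d × Space d =>
        ‖J (2 ^ i * τ) q.2‖ₑ ^ 2 *
          ‖moll φ g (2 ^ i * τ) (q.2 - (2 ^ i * τ) • (v - q.1))‖ₑ ^ 2) (by fun_prop)
    exact (m3.enorm.mul this).aemeasurable
  have hw : ∀ w, ∑ i ∈ Finset.range K, ‖η w‖ₑ * ∫⁻ x, ‖J (2 ^ i * τ) x‖ₑ ^ 2 *
      ‖moll φ g (2 ^ i * τ) (x - (2 ^ i * τ) • (v - w))‖ₑ ^ 2 ≤
      ‖η w‖ₑ * ENNReal.ofReal ((1 + ‖w‖) ^ 2) *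
        (ENNReal.ofReal (C2 * A ^ 2 * (1 + ‖v‖) ^ 2) * S) := by
    intro w
    rw [← Finset.mul_sum, mul_assoc, ← mul_assoc (ENNReal.ofReal _) _ S,
      ← ENNReal.ofReal_mul (by positivity)]
    refine mul_le_mul_right ((base (v - w)).trans ?_) _
    refine mul_le_mul_left (ENNReal.ofReal_le_ofReal ?_) _
    have h2 : 1 + ‖v - w‖ ≤ (1 + ‖w‖) * (1 + ‖v‖) := by
      have := norm_sub_le v w
      nlinarith [norm_nonneg v, norm_nonneg w]
    have h3 := pow_le_pow_left₀ (by positivity) h2 2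
    rw [mul_pow] at h3
    have := mul_le_mul_of_nonneg_left h3 (by positivity : 0 ≤ C2 * A ^ 2)
    linarith
  refine (mul_le_mul_right (lintegral_mono hw) _).trans ?_
  rw [lintegral_mul_const, ← hE, hE', ← mul_assoc, ← mul_assoc,
    ← ENNReal.ofReal_mul ha0, ← ENNReal.ofReal_mul (by positivity),
    ENNReal.toReal_ofReal ENNReal.toReal_nonneg]
  · refine mul_le_mul_left (ENNReal.ofReal_le_ofReal (le_of_eq ?_)) _
    ring
  · have := η.continuous.measurable
    fun_prop

end

/-! ### Dyadic sums of the multilinear form -/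

section

variable {d : ℕ} {ι : Type*}

/-- One half of the Cauchy–Schwarz estimate: a high frequency factor j against an L² entry p. If j =
p the pair collapses to a singleton and Plancherel applies; otherwise this is Carleson's embedding
with relative shift (c_p − c_j)u. -/
theorem exists_sum_lintegral_pair_le [DecidableEq ι] {χ : ι → 𝓢(Space d, ℂ)} {p j : ι}
    {r R : ℝ} (hr : 0 < r)
    (hlow : ∀ ξ, ‖ξ‖ ≤ r → 𝓕 (χ j) ξ = 0) (hhigh : ∀ ξ, R < ‖ξ‖ → 𝓕 (χ j) ξ = 0) (c : ι → ℝ)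
    (M : ℝ) :
    ∃ C, 0 ≤ C ∧ ∀ (f : ι → Space d → ℂ) (g : 𝓢(Space d, ℂ)), Measurable (f j) →
      (j ≠ p → ∀ x, ‖f j x‖ ≤ M) → f p = g → ∀ (τ : ℝ) (K : ℕ) (u : Space d), 0 < τ →
      ∑ k ∈ Finset.range K, ∫⁻ x, ∏ i ∈ {p, j},
        ‖moll (χ i) (f i) (2 ^ k * τ) (x - (c i * (2 ^ k * τ)) • u)‖ₑ ^ 2 ≤
        ENNReal.ofReal (C * (1 + ‖u‖) ^ 2) * ∫⁻ x, ‖g x‖ₑ ^ 2 := by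
  rcases eq_or_ne j p with rfl | hjp
  · obtain ⟨C, hC, h⟩ := exists_sum_lintegral_moll_sq_le (χ j) (hlow 0 (by simpa using hr.le))
    refine ⟨C, hC, fun f g _ _ hg τ K u hτ => ?_⟩
    simp only [Finset.pair_eq_singleton, Finset.prod_singleton, hg]
    refine le_trans (le_of_eq ?_) ((h g τ K hτ).trans (mul_le_mul_left
      (ENNReal.ofReal_le_ofReal (le_mul_of_one_le_right hC
        (one_le_pow₀ (by linarith [norm_nonneg u])))) _))
    refine Finset.sum_congr rfl fun k _ => ?_
    exact lintegral_sub_right_eq_self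
      (fun x => ‖moll (χ j) g (2 ^ k * τ) x‖ₑ ^ 2) ((c j * (2 ^ k * τ)) • u)
  · obtain ⟨C, hC, h⟩ := exists_carleson_embedding (χ j) (χ p) hr hlow hhigh
    refine ⟨C * M ^ 2 * (1 + |c p - c j|) ^ 2, by positivity, fun f g hf hM hg τ K u hτ => ?_⟩
    refine le_trans (le_of_eq ?_) ((h (f j) M hf (hM hjp) g ((c p - c j) • u) τ K hτ).trans
      (mul_le_mul_left (ENNReal.ofReal_le_ofReal ?_) _))
    · refine Finset.sum_congr rfl fun k _ => ?_
      rw [← lintegral_sub_right_eq_self (fun x => ‖moll (χ j) (f j) (2 ^ k * τ) x‖ₑ ^ 2 *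
        ‖moll (χ p) g (2 ^ k * τ) (x - (2 ^ k * τ) • (c p - c j) • u)‖ₑ ^ 2)
        ((c j * (2 ^ k * τ)) • u)]
      congr 1; ext x
      rw [Finset.prod_pair hjp.symm, mul_comm, hg]
      rw [show x - (c p * (2 ^ k * τ)) • u =
        x - (c j * (2 ^ k * τ)) • u - (2 ^ k * τ) • (c p - c j) • u by module]
    · have h1 : 1 + ‖(c p - c j) • u‖ ≤ (1 + |c p - c j|) * (1 + ‖u‖) := by
        rw [norm_smul, Real.norm_eq_abs]
        nlinarith [norm_nonneg u, abs_nonneg (c p - c j)]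
      have h2 := pow_le_pow_left₀ (by positivity) h1 2
      have := mul_le_mul_of_nonneg_left h2 (by positivity : 0 ≤ C * M ^ 2)
      linarith

variable [Fintype ι] [DecidableEq ι]

/-- Two high frequency factors give a convergent sum of forms. -/
theorem exists_sum_form_le_of_high {Ψ : 𝓢(Space d, ℂ)} {χ : ι → 𝓢(Space d, ℂ)} {p q j k : ι}
    {r R : ℝ} (hpq : p ≠ q) (hjk : j ≠ k) (hr : 0 < r)
    (hj : ∀ ξ, ‖ξ‖ ≤ r → 𝓕 (χ j) ξ = 0) (hk : ∀ ξ, ‖ξ‖ ≤ r → 𝓕 (χ k) ξ = 0)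
    (hR : ∀ i ξ, R < ‖ξ‖ → 𝓕 (χ i) ξ = 0) (c M : ι → ℝ) :
    ∃ C, 0 ≤ C ∧ ∀ (f : ι → Space d → ℂ) (g h : 𝓢(Space d, ℂ)), (∀ i, Measurable (f i)) →
      (∀ i, i ≠ p → i ≠ q → ∀ x, ‖f i x‖ ≤ M i) → f p = g → f q = h → ∀ (τ : ℝ) (K : ℕ), 0 < τ →
      ∑ k ∈ Finset.range K, ‖∫ x, ∫ u, Ψ u *
        ∏ i, moll (χ i) (f i) (2 ^ k * τ) (x - (c i * (2 ^ k * τ)) • u)‖ₑ ≤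
        ENNReal.ofReal C * ((∫⁻ x, ‖g x‖ₑ ^ 2) + ∫⁻ x, ‖h x‖ₑ ^ 2) := by
  -- Exchanging j and k if necessary makes {p, j} and {q, k} disjoint, so that each half contains
  -- one L² entry and one high frequency factor, possibly the same.
  wlog hjq : j ≠ q ∧ k ≠ p generalizing j k
  · refine this hjk.symm hk hj ?_
    by_cases h : j = q
    · subst h; exact ⟨hjk.symm, hpq.symm⟩
    · have h2 : k = p := by by_contra h2; exact hjq ⟨h, h2⟩
      subst h2; exact ⟨hpq, hjk⟩
  obtain ⟨hjq, hkp⟩ := hjq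
  obtain ⟨C1, hC1, h1⟩ := exists_sum_lintegral_pair_le (p := p) hr hj (hR j) c (M j)
  obtain ⟨C2, hC2, h2⟩ := exists_sum_lintegral_pair_le (p := q) hr hk (hR k) c (M k)
  set P : Finset ι := {p, j} with hP
  set Q : Finset ι := {q, k} with hQ
  have hd : Disjoint P Q := by
    rw [Finset.disjoint_left]
    intro i hi hi'
    simp only [hP, hQ, Finset.mem_insert, Finset.mem_singleton] at hi hi'
    rcases hi with rfl | rfl <;> rcases hi' with h | h
    · exact hpq h
    · exact hkp h.symm
    · exact hjq h
    · exact hjk h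
  set T : Finset ι := Finset.univ \ (P ∪ Q) with hT
  set D : ℝ≥0∞ := ∏ i ∈ T, ENNReal.ofReal ((∫ w, ‖χ i w‖) * M i) with hD
  have hDtop : D ≠ (⊤ : ℝ≥0∞) := ENNReal.prod_ne_top fun i _ => ENNReal.ofReal_ne_top
  have hDD : D = ENNReal.ofReal D.toReal := (ENNReal.ofReal_toReal hDtop).symm
  set E := ∫⁻ w, ‖Ψ w‖ₑ * ENNReal.ofReal ((1 + ‖w‖) ^ 2) with hE
  have hEtop : E ≠ (⊤ : ℝ≥0∞) := (lintegral_enorm_mul_one_add_sq_lt_top Ψ).ne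
  have hEE : E = ENNReal.ofReal E.toReal := (ENNReal.ofReal_toReal hEtop).symm
  refine ⟨D.toReal * E.toReal * (C1 + C2), by positivity,
    fun f g h hf hM hg hh τ K hτ => ?_⟩
  set F : ℕ → ι → Space d → ℂ := fun l i => moll (χ i) (f i) (2 ^ l * τ) with hF
  have hFm : ∀ l i, Measurable (F l i) := fun l i =>
    measurable_moll_right (χ i).continuous.measurable (hf i) _
  have hΨm := Ψ.continuous.measurable
  have hterm : ∀ l ∈ Finset.range K, ‖∫ x, ∫ u, Ψ u *
      ∏ i, moll (χ i) (f i) (2 ^ l * τ) (x - (c i * (2 ^ l * τ)) • u)‖ₑ ≤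
      ∫⁻ u, ‖Ψ u‖ₑ * D * ((∫⁻ x, ∏ i ∈ P, ‖F l i (x - (c i * (2 ^ l * τ)) • u)‖ₑ ^ 2) +
        ∫⁻ x, ∏ i ∈ Q, ‖F l i (x - (c i * (2 ^ l * τ)) • u)‖ₑ ^ 2) := by
    intro l _
    set t := 2 ^ l * τ
    have mP : ∀ S : Finset ι, Measurable fun q : Space d × Space d =>
        ∏ i ∈ S, ‖F l i (q.1 - (c i * t) • q.2)‖ₑ ^ 2 := fun S =>
      Finset.measurable_fun_prod _ fun i _ => (((hFm l i).comp (by fun_prop)).enorm).pow_const 2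
    have pt : ∀ x u, ‖Ψ u * ∏ i, F l i (x - (c i * t) • u)‖ₑ ≤
        ‖Ψ u‖ₑ * D * ((∏ i ∈ P, ‖F l i (x - (c i * t) • u)‖ₑ ^ 2) +
          ∏ i ∈ Q, ‖F l i (x - (c i * t) • u)‖ₑ ^ 2) := by
      intro x u
      rw [enorm_mul, mul_assoc]
      refine mul_le_mul_right ?_ _
      have e1 : ‖∏ i, F l i (x - (c i * t) • u)‖ₑ = ∏ i, ‖F l i (x - (c i * t) • u)‖ₑ := by
        simp only [enorm_eq_nnnorm, nnnorm_prod, ENNReal.ofNNReal_finsetProd]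
      rw [e1, ← Finset.prod_sdiff (Finset.subset_univ (P ∪ Q)), Finset.prod_union hd,
        Finset.prod_pow, Finset.prod_pow]
      refine mul_le_mul' (Finset.prod_le_prod' fun i hi => ?_) ?_
      · simp only [hP, hQ, Finset.mem_sdiff, Finset.mem_univ, true_and, Finset.mem_union,
          Finset.mem_insert, Finset.mem_singleton, not_or] at hi
        rw [← ofReal_norm]
        exact ENNReal.ofReal_le_ofReal
          (norm_moll_le (χ i).integrable (hM i hi.1.1 hi.2.1) t _)
      · set A := ∏ i ∈ P, ‖F l i (x - (c i * t) • u)‖ₑ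
        set B := ∏ i ∈ Q, ‖F l i (x - (c i * t) • u)‖ₑ
        rw [sq, sq]
        -- The elementary bound AB ≤ A² + B² takes the place of Cauchy–Schwarz; homogeneity is
        -- restored later by rescaling the test function.
        rcases le_total A B with hAB | hAB
        · exact (mul_le_mul_left hAB _).trans le_add_self
        · exact (mul_le_mul_right hAB _).trans le_self_add
    calc _ ≤ ∫⁻ x, ∫⁻ u, ‖Ψ u * ∏ i, F l i (x - (c i * t) • u)‖ₑ :=
          (enorm_integral_le_lintegral_enorm _).trans
            (lintegral_mono fun x => enorm_integral_le_lintegral_enorm _)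
      _ ≤ ∫⁻ x, ∫⁻ u, ‖Ψ u‖ₑ * D * ((∏ i ∈ P, ‖F l i (x - (c i * t) • u)‖ₑ ^ 2) +
          ∏ i ∈ Q, ‖F l i (x - (c i * t) • u)‖ₑ ^ 2) :=
          lintegral_mono fun x => lintegral_mono fun u => pt x u
      _ = ∫⁻ u, ∫⁻ x, ‖Ψ u‖ₑ * D * ((∏ i ∈ P, ‖F l i (x - (c i * t) • u)‖ₑ ^ 2) +
          ∏ i ∈ Q, ‖F l i (x - (c i * t) • u)‖ₑ ^ 2) := by
          refine lintegral_lintegral_swap (Measurable.aemeasurable ?_)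
          exact ((hΨm.comp measurable_snd).enorm.mul_const D).mul ((mP P).add (mP Q))
      _ = _ := by
          congr 1; ext u
          have mu : ∀ S : Finset ι, Measurable fun x : Space d =>
              ∏ i ∈ S, ‖F l i (x - (c i * t) • u)‖ₑ ^ 2 := fun S =>
            Finset.measurable_fun_prod _ fun i _ =>
              (((hFm l i).comp (by fun_prop)).enorm).pow_const 2
          rw [← lintegral_add_left (mu P)]
          exact lintegral_const_mul _ ((mu P).add (mu Q))
  refine (Finset.sum_le_sum hterm).trans ?_
  have mP : ∀ (S : Finset ι) (l : ℕ), Measurable fun u : Space d =>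
      ∫⁻ x, ∏ i ∈ S, ‖F l i (x - (c i * (2 ^ l * τ)) • u)‖ₑ ^ 2 := fun S l =>
    Measurable.lintegral_prod_right' (f := fun q : Space d × Space d =>
        ∏ i ∈ S, ‖F l i (q.2 - (c i * (2 ^ l * τ)) • q.1)‖ₑ ^ 2)
      (Finset.measurable_fun_prod _ fun i _ => (((hFm l i).comp (by fun_prop)).enorm).pow_const 2)
  rw [← lintegral_finsetSum']
  swap
  · intro l _
    exact ((hΨm.enorm.mul_const D).mul ((mP P l).add (mP Q l))).aemeasurable
  set G := ∫⁻ x, ‖g x‖ₑ ^ 2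
  set H := ∫⁻ x, ‖h x‖ₑ ^ 2
  have hu : ∀ u, ∑ l ∈ Finset.range K, ‖Ψ u‖ₑ * D *
      ((∫⁻ x, ∏ i ∈ P, ‖F l i (x - (c i * (2 ^ l * τ)) • u)‖ₑ ^ 2) +
        ∫⁻ x, ∏ i ∈ Q, ‖F l i (x - (c i * (2 ^ l * τ)) • u)‖ₑ ^ 2) ≤
      ‖Ψ u‖ₑ * ENNReal.ofReal ((1 + ‖u‖) ^ 2) * (D * (ENNReal.ofReal (C1 + C2) * (G + H))) := by
    intro u
    rw [← Finset.mul_sum, Finset.sum_add_distrib]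
    have b1 := h1 f g (hf j) (fun hjp => hM j hjp hjq) hg τ K u hτ
    have b2 := h2 f h (hf k) (fun hkq => hM k hkp hkq) hh τ K u hτ
    calc _ ≤ ‖Ψ u‖ₑ * D * (ENNReal.ofReal (C1 * (1 + ‖u‖) ^ 2) * G +
          ENNReal.ofReal (C2 * (1 + ‖u‖) ^ 2) * H) :=
          mul_le_mul_right (add_le_add b1 b2) _
      _ ≤ ‖Ψ u‖ₑ * D * (ENNReal.ofReal ((C1 + C2) * (1 + ‖u‖) ^ 2) * G +
          ENNReal.ofReal ((C1 + C2) * (1 + ‖u‖) ^ 2) * H) := by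
          gcongr <;> linarith
      _ = _ := by
          rw [ENNReal.ofReal_mul (by positivity)]; ring
  refine (lintegral_mono hu).trans (le_of_eq ?_)
  rw [lintegral_mul_const, ENNReal.ofReal_mul (by positivity), ENNReal.ofReal_mul (by positivity),
    ← hEE, ← hDD]
  · ring
  · fun_prop

/-- The dyadic sums of the multilinear form are bounded by the `L²` norms of two of the entries. -/
theorem exists_sum_form_le {Ψ : 𝓢(Space d, ℂ)} {φ : ι → 𝓢(Space d, ℂ)} {p q : ι}
    {a R : ℝ} (hpq : p ≠ q) (ha : 0 < a) (hΨ : ∀ ξ, ‖ξ‖ ≤ a → 𝓕 Ψ ξ = 0)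
    (hR : ∀ i ξ, R < ‖ξ‖ → 𝓕 (φ i) ξ = 0) (c M : ι → ℝ) :
    ∃ C, 0 ≤ C ∧ ∀ (f : ι → Space d → ℂ) (g h : 𝓢(Space d, ℂ)), (∀ i, Measurable (f i)) →
      (∀ i, i ≠ p → i ≠ q → ∀ x, ‖f i x‖ ≤ M i) → f p = g → f q = h → ∀ (τ : ℝ) (K : ℕ), 0 < τ →
      ∑ k ∈ Finset.range K, ‖∫ x, ∫ u, Ψ u *
        ∏ i, moll (φ i) (f i) (2 ^ k * τ) (x - (c i * (2 ^ k * τ)) • u)‖ₑ ≤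
        ENNReal.ofReal C * ((∫⁻ x, ‖g x‖ₑ ^ 2) + ∫⁻ x, ‖h x‖ₑ ^ 2) := by
  have hcard : (0 : ℝ) < Fintype.card ι := by exact_mod_cast Fintype.card_pos_iff.2 ⟨p⟩
  have hc0 : 0 ≤ ∑ i, |c i| := Finset.sum_nonneg fun i _ => abs_nonneg _
  -- Small enough for the vanishing lemma; the summand 1 avoids division by zero when all shifts are
  -- zero.
  set ε := a / ((1 + ∑ i, |c i|) * (2 * Fintype.card ι)) with hε
  have hε0 : 0 < ε := by positivity
  have hεa : (∑ i, |c i|) * (2 * (Fintype.card ι * ε)) ≤ a := by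
    rw [hε, show (∑ i, |c i|) * (2 * (Fintype.card ι * (a / ((1 + ∑ i, |c i|) *
      (2 * Fintype.card ι))))) = a * ((∑ i, |c i|) / (1 + ∑ i, |c i|)) by field_simp]
    refine mul_le_of_le_one_right ha.le ?_
    rw [div_le_one (by positivity)]; linarith
  choose lo hi hadd hlo hhi hhi0 hlo0 using fun i => exists_low_high (φ i) (half_pos hε0)
  let ψ : ι → Bool → 𝓢(Space d, ℂ) := fun i b => if b then hi i else lo i
  have hψR : ∀ i b ξ, R < ‖ξ‖ → 𝓕 (ψ i b) ξ = 0 := by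
    intro i b ξ hξ
    cases b
    · exact hlo0 i ξ (hR i ξ hξ)
    · exact hhi0 i ξ (hR i ξ hξ)
  have key : ∀ s : ι → Bool, ∃ C, 0 ≤ C ∧ ∀ (f : ι → Space d → ℂ) (g h : 𝓢(Space d, ℂ)),
      (∀ i, Measurable (f i)) → (∀ i, i ≠ p → i ≠ q → ∀ x, ‖f i x‖ ≤ M i) → f p = g → f q = h →
      ∀ (τ : ℝ) (K : ℕ), 0 < τ → ∑ k ∈ Finset.range K, ‖∫ x, ∫ u, Ψ u *
        ∏ i, moll (ψ i (s i)) (f i) (2 ^ k * τ) (x - (c i * (2 ^ k * τ)) • u)‖ₑ ≤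
        ENNReal.ofReal C * ((∫⁻ x, ‖g x‖ₑ ^ 2) + ∫⁻ x, ‖h x‖ₑ ^ 2) := by
    intro s
    by_cases hs : ∃ j k, j ≠ k ∧ s j = true ∧ s k = true
    · obtain ⟨j, k, hjk, hj, hk⟩ := hs
      refine exists_sum_form_le_of_high (χ := fun i => ψ i (s i)) hpq hjk (half_pos hε0) ?_ ?_
        (fun i => hψR i (s i)) c M
      · simp only [hj]; exact hhi j
      · simp only [hk]; exact hhi k
    · push Not at hs
      obtain ⟨j, hj⟩ : ∃ j, ∀ i, i ≠ j → s i = false := by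
        by_cases h : ∃ j, s j = true
        · obtain ⟨j, hj⟩ := h
          refine ⟨j, fun i hij => ?_⟩
          simpa using fun hi => hs i j hij hi hj
        · push Not at h
          exact ⟨p, fun i _ => by simpa using h i⟩
      -- With two L² entries, at least one is not the exceptional factor, and it supplies the
      -- integrability required for vanishing.
      obtain ⟨l, hl, hlj⟩ : ∃ l, (l = p ∨ l = q) ∧ l ≠ j := by
        by_cases h : p = j
        · exact ⟨q, Or.inr rfl, fun h' => hpq (h.trans h'.symm)⟩
        · exact ⟨p, Or.inl rfl, h⟩
      refine ⟨0, le_rfl, fun f g h hf hM hg hh τ K hτ => ?_⟩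
      have hB : ∀ i, ∃ B, ∀ x, ‖f i x‖ ≤ B := by
        intro i
        by_cases hip : i = p
        · obtain ⟨B, -, hB⟩ := g.decay 0 0
          exact ⟨B, fun x => by rw [hip, hg]; simpa using hB x⟩
        by_cases hiq : i = q
        · obtain ⟨B, -, hB⟩ := h.decay 0 0
          exact ⟨B, fun x => by rw [hiq, hh]; simpa using hB x⟩
        exact ⟨M i, hM i hip hiq⟩
      choose B hB using hB
      have hli : Integrable (f l) := by
        rcases hl with rfl | rfl
        · rw [hg]; exact g.integrable
        · rw [hh]; exact h.integrable
      refine (Finset.sum_eq_zero fun k _ => ?_).trans_le zero_le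
      rw [form_eq_zero (φ := fun i => ψ i (s i)) hlj hε0 hf hB hli hΨ ?_ c hεa (by positivity),
        enorm_zero]
      intro i hij ξ hξ
      simp only [hj i hij]
      exact hlo i ξ (by linarith)
  choose C hC0 hC using key
  refine ⟨∑ s, C s, Finset.sum_nonneg fun s _ => hC0 s, fun f g h hf hM hg hh τ K hτ => ?_⟩
  have hsum : ∀ k, ‖∫ x, ∫ u, Ψ u *
        ∏ i, moll (φ i) (f i) (2 ^ k * τ) (x - (c i * (2 ^ k * τ)) • u)‖ₑ ≤
      ∑ s : ι → Bool, ‖∫ x, ∫ u, Ψ u *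
        ∏ i, moll (ψ i (s i)) (f i) (2 ^ k * τ) (x - (c i * (2 ^ k * τ)) • u)‖ₑ := by
    intro k
    set t := 2 ^ k * τ
    have hB : ∀ i, ∃ B, ∀ x, ‖f i x‖ ≤ B := by
      intro i
      by_cases hip : i = p
      · obtain ⟨B, -, hB⟩ := g.decay 0 0
        exact ⟨B, fun x => by rw [hip, hg]; simpa using hB x⟩
      by_cases hiq : i = q
      · obtain ⟨B, -, hB⟩ := h.decay 0 0
        exact ⟨B, fun x => by rw [hiq, hh]; simpa using hB x⟩
      exact ⟨M i, hM i hip hiq⟩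
    choose B hB using hB
    have hpi : Integrable (f p) := by rw [hg]; exact g.integrable
    have hint : ∀ s : ι → Bool, Integrable (fun z : Space d × Space d =>
        Ψ z.2 * ∏ i, moll (ψ i (s i)) (f i) t (z.1 - (c i * t) • z.2))
        (volume.prod volume) := fun s =>
      integrable_form (l := p) (M := fun i => (∫ w, ‖ψ i (s i) w‖) * B i) Ψ.integrable
        (fun i => measurable_moll_right (ψ i (s i)).continuous.measurable (hf i) t)
        (fun i x => norm_moll_le (ψ i (s i)).integrable (hB i) t _)
        (integrable_moll (ψ p (s p)).integrable hpi t) _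
    have e1 : ∀ x u, Ψ u * ∏ i, moll (φ i) (f i) t (x - (c i * t) • u) =
        ∑ s : ι → Bool, Ψ u * ∏ i, moll (ψ i (s i)) (f i) t (x - (c i * t) • u) := by
      intro x u
      rw [← Finset.mul_sum]
      congr 1
      have e2 : ∀ i, moll (φ i) (f i) t (x - (c i * t) • u) =
          ∑ b : Bool, moll (ψ i b) (f i) t (x - (c i * t) • u) := by
        intro i
        have e3 : (φ i : Space d → ℂ) = fun w => hi i w + lo i w := by
          ext w; rw [hadd, add_comm]
        rw [Fintype.sum_bool, e3, moll_add (hi i).integrable (lo i).integrable (hf i) (hB i)]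
        rfl
      simp only [e2]
      exact Finset.prod_univ_sum _ _ |>.trans (by rw [Fintype.piFinset_univ])
    have e4 : ∫ x, ∫ u, Ψ u * ∏ i, moll (φ i) (f i) t (x - (c i * t) • u) =
        ∑ s : ι → Bool, ∫ x, ∫ u, Ψ u *
          ∏ i, moll (ψ i (s i)) (f i) t (x - (c i * t) • u) := by
      simp only [e1]
      rw [← integral_prod (f := fun z : Space d × Space d => ∑ s : ι → Bool,
        Ψ z.2 * ∏ i, moll (ψ i (s i)) (f i) t (z.1 - (c i * t) • z.2))
        (integrable_finsetSum _ fun s _ => hint s), integral_finsetSum _ fun s _ => hint s]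
      exact Finset.sum_congr rfl fun s _ => integral_prod _ (hint s)
    rw [e4]
    exact enorm_sum_le _ _
  refine (Finset.sum_le_sum fun k _ => hsum k).trans ?_
  rw [Finset.sum_comm, ENNReal.ofReal_sum_of_nonneg fun s _ => hC0 s, Finset.sum_mul]
  exact Finset.sum_le_sum fun s _ => hC s f g h hf hM hg hh τ K hτ

end

/-! ### Pairing with a test function as one more factor -/

section

variable {d : ℕ} {ι : Type*} [Fintype ι]

theorem exists_schwartz_fourier_eq_one {r : ℝ} (hr : 0 < r) :
    ∃ θ : 𝓢(Space d, ℂ), (∀ ξ, ‖ξ‖ ≤ r → 𝓕 θ ξ = 1) ∧ ∀ ξ, 2 * r < ‖ξ‖ → 𝓕 θ ξ = 0 := by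
  let χ : ContDiffBump (0 : Space d) := ⟨r, 2 * r, hr, by linarith⟩
  have hs : HasCompactSupport fun x => (χ x : ℂ) :=
    χ.hasCompactSupport.comp_left (g := Complex.ofReal) Complex.ofReal_zero
  have hd : ContDiff ℝ ∞ fun x => (χ x : ℂ) := Complex.ofRealCLM.contDiff.comp χ.contDiff
  refine ⟨𝓕⁻ (hs.toSchwartzMap hd), fun ξ hξ => ?_, fun ξ hξ => ?_⟩
  · rw [FourierTransform.fourier_fourierInv_eq]
    change (χ ξ : ℂ) = 1
    rw [χ.one_of_mem_closedBall (by simpa [χ] using hξ), Complex.ofReal_one]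
  · rw [FourierTransform.fourier_fourierInv_eq]
    change (χ ξ : ℂ) = 0
    rw [χ.zero_of_le_dist (by simpa [χ] using hξ.le), Complex.ofReal_zero]

/-- The product has spectral radius at most card ι · R/t, and h minus its average with θ has no
frequency there because 𝓕θ = 1 on the rescaled ball. -/
theorem integral_mul_prod_moll_eq {φ : ι → 𝓢(Space d, ℂ)} {f : ι → Space d → ℂ} {B : ι → ℝ}
    {R : ℝ} (hf : ∀ i, Measurable (f i)) (hB : ∀ i x, ‖f i x‖ ≤ B i)
    (hR : ∀ i ξ, R < ‖ξ‖ → 𝓕 (φ i) ξ = 0) {θ : 𝓢(Space d, ℂ)}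
    (hθ : ∀ ξ, ‖ξ‖ ≤ Fintype.card ι * R → 𝓕 θ ξ = 1) (h : 𝓢(Space d, ℂ)) {t : ℝ} (ht : 0 < t)
    (b : ι → Space d) :
    ∫ x, h x * ∏ i, moll (φ i) (f i) t (x - b i) =
      ∫ x, moll θ h t x * ∏ i, moll (φ i) (f i) t (x - b i) := by
  have hm : ∀ i, Measurable fun x => moll (φ i) (f i) t (x - b i) := fun i =>
    (measurable_moll_right (φ i).continuous.measurable (hf i) t).comp (by fun_prop)
  have hb : ∀ i x, ‖moll (φ i) (f i) t (x - b i)‖ ≤ (∫ w, ‖φ i w‖) * B i := fun i x =>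
    norm_moll_le (φ i).integrable (hB i) t _
  have hspec : HasSpec (∑ i : ι, R / t) (fun x => ∏ i, moll (φ i) (f i) t (x - b i)) := by
    refine hasSpec_prod _ (fun i _ => ?_) (fun i _ => hm i) (fun i _ => hb i)
    have := hasSpec_moll ((hf i).comp (measurable_id.sub_const (b i))) (fun x => hB i _) ht (hR i)
    convert this using 1
    ext x
    rw [moll_translate]; rfl
  have hθi := integrable_moll θ.integrable h.integrable t
  have key := hspec (fun x => h x - moll θ h t x) (h.integrable.sub hθi) ?_
  · have hpm : Measurable fun x => ∏ i, moll (φ i) (f i) t (x - b i) :=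
      Finset.measurable_fun_prod _ fun i _ => hm i
    have hpb : ∀ x, ‖∏ i, moll (φ i) (f i) t (x - b i)‖ ≤ ∏ i, ((∫ w, ‖φ i w‖) * B i) :=
      fun x => by
        rw [norm_prod]
        exact Finset.prod_le_prod (fun _ _ => norm_nonneg _) fun i _ => hb i x
    rw [← sub_eq_zero, ← integral_sub
      (h.integrable.mul_bdd hpm.aestronglyMeasurable (Filter.Eventually.of_forall hpb))
      (hθi.mul_bdd hpm.aestronglyMeasurable (Filter.Eventually.of_forall hpb)), ← key]
    congr 1; ext x; ring
  · intro ξ hξ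
    have e : 𝓕 (fun x => h x - moll θ h t x) ξ = 𝓕 h ξ - 𝓕 (moll θ h t) ξ := by
      have i1 := (Real.fourierIntegral_convergent_iff (V := Space d) ξ).2
        (h.integrable (μ := volume))
      have i2 := (Real.fourierIntegral_convergent_iff (V := Space d) ξ).2 hθi
      rw [SchwartzMap.fourier_coe]
      simp only [Real.fourier_eq, smul_sub]
      exact integral_sub i1 i2
    rw [e, fourier_moll θ.integrable h.integrable, ← SchwartzMap.fourier_coe,
      ← SchwartzMap.fourier_coe, hθ, one_mul, sub_self]
    rw [norm_smul, Real.norm_of_nonneg ht.le]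
    simp only [Finset.sum_const, nsmul_eq_mul, Finset.card_univ] at hξ
    calc t * ‖ξ‖ ≤ t * (Fintype.card ι * (R / t)) := mul_le_mul_of_nonneg_left hξ ht.le
      _ = _ := by field_simp

variable [DecidableEq ι]

/-- The dyadic sums of the pairing of the multilinear form with a function are bounded by the `L²`
norms of that function and of one of the entries. -/
theorem exists_sum_pairing_le {Ψ : 𝓢(Space d, ℂ)} {φ : ι → 𝓢(Space d, ℂ)} (p : ι)
    {a R : ℝ} (ha : 0 < a) (hΨ : ∀ ξ, ‖ξ‖ ≤ a → 𝓕 Ψ ξ = 0)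
    (hR : ∀ i ξ, R < ‖ξ‖ → 𝓕 (φ i) ξ = 0) (c M : ι → ℝ) :
    ∃ C, 0 ≤ C ∧ ∀ (f : ι → Space d → ℂ) (g h : 𝓢(Space d, ℂ)), (∀ i, Measurable (f i)) →
      (∀ i, i ≠ p → ∀ x, ‖f i x‖ ≤ M i) → f p = g → ∀ (τ : ℝ) (K : ℕ), 0 < τ →
      ∑ k ∈ Finset.range K, ‖∫ x, h x * ∫ u, Ψ u *
        ∏ i, moll (φ i) (f i) (2 ^ k * τ) (x - (c i * (2 ^ k * τ)) • u)‖ₑ ≤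
        ENNReal.ofReal C * ((∫⁻ x, ‖g x‖ₑ ^ 2) + ∫⁻ x, ‖h x‖ₑ ^ 2) := by
  set r := Fintype.card ι * |R| + 1 with hr
  have hr0 : 0 < r := by positivity
  obtain ⟨θ, hθ1, hθ0⟩ := exists_schwartz_fourier_eq_one (d := d) hr0
  -- The index `none` carries the average of h. It has shift 0, and its bound 0 is never used, since
  -- `none` is one of the two L² entries.
  obtain ⟨C, hC, hform⟩ := exists_sum_form_le (ι := Option ι) (Ψ := Ψ)
    (φ := fun o => o.elim θ φ) (p := some p) (q := none) (R := |R| + 2 * r) (by simp) ha hΨ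
    (by
      intro o ξ hξ
      cases o with
      | none => exact hθ0 ξ (by linarith [abs_nonneg R])
      | some i => exact hR i ξ (by linarith [le_abs_self R]))
    (fun o => o.elim 0 c) (fun o => o.elim 0 M)
  refine ⟨C, hC, fun f g h hf hM hg τ K hτ => ?_⟩
  refine le_trans (le_of_eq ?_) (hform (fun o => o.elim h f) g h ?_ ?_ hg rfl τ K hτ)
  · refine Finset.sum_congr rfl fun k _ => congrArg _ ?_
    set t := 2 ^ k * τ with ht
    have ht0 : 0 < t := by positivity
    have hB : ∀ i, ∃ B, ∀ x, ‖f i x‖ ≤ B := by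
      intro i
      by_cases hip : i = p
      · obtain ⟨B, -, hB⟩ := g.decay 0 0
        exact ⟨B, fun x => by rw [hip, hg]; simpa using hB x⟩
      exact ⟨M i, hM i hip⟩
    choose B hB using hB
    set W : Space d → Space d → ℂ := fun x u => ∏ i, moll (φ i) (f i) t (x - (c i * t) • u)
    have hWm : Measurable fun z : Space d × Space d => W z.1 z.2 :=
      Finset.measurable_fun_prod _ fun i _ =>
        (measurable_moll_right (φ i).continuous.measurable (hf i) t).comp (by fun_prop)
    have hWb : ∀ z : Space d × Space d, ‖W z.1 z.2‖ ≤ ∏ i, ((∫ w, ‖φ i w‖) * B i) := fun z => by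
      rw [norm_prod]
      exact Finset.prod_le_prod (fun _ _ => norm_nonneg _) fun i _ =>
        norm_moll_le (φ i).integrable (hB i) t _
    have hint : ∀ G : Space d → ℂ, Integrable G → Integrable (fun z : Space d × Space d =>
        G z.1 * Ψ z.2 * W z.1 z.2) (volume.prod volume) := fun G hG =>
      (hG.mul_prod Ψ.integrable).mul_bdd hWm.aestronglyMeasurable
        (Filter.Eventually.of_forall hWb)
    calc ∫ x, h x * ∫ u, Ψ u * W x u
        = ∫ x, ∫ u, h x * Ψ u * W x u := by
          simp only [← integral_const_mul, mul_assoc]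
      _ = ∫ u, ∫ x, h x * Ψ u * W x u := integral_integral_swap (hint _ h.integrable)
      _ = ∫ u, ∫ x, moll θ h t x * Ψ u * W x u := by
          congr 1; ext u
          have e := integral_mul_prod_moll_eq hf hB (R := |R|)
            (fun i ξ hξ => hR i ξ ((le_abs_self R).trans_lt hξ))
            (fun ξ hξ => hθ1 ξ (by rw [hr]; linarith)) h ht0 (fun i => (c i * t) • u)
          have e2 : ∀ G : Space d → ℂ, ∫ x, G x * Ψ u * W x u = Ψ u * ∫ x, G x * W x u := by
            intro G
            rw [← integral_const_mul]; congr 1; ext x; ring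
          rw [e2, e2, e]
      _ = ∫ x, ∫ u, moll θ h t x * Ψ u * W x u :=
          (integral_integral_swap (hint _ (integrable_moll θ.integrable h.integrable t))).symm
      _ = _ := by
          congr 1; ext x; congr 1; ext u
          rw [Fintype.prod_option]
          simp only [Option.elim, zero_mul, zero_smul, sub_zero, W]
          ring
  · intro o
    cases o with
    | none => exact h.continuous.measurable
    | some i => exact hf i
  · intro o h1 h2
    cases o with
    | none => exact absurd rfl h2
    | some i => exact hM i (fun e => h1 (by rw [e]))

end

/-! ### Absolute convergence of the integral over scales -/

section

variable {d : ℕ} {ι : Type*} [Fintype ι]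

/-- The multilinear average `∫ Ψ u * ∏ i, [φ_i ∗ f_i]_t (x - c_i t u) du` at scale `t`. -/
def slice (Ψ : Space d → ℂ) (φ : ι → Space d → ℂ) (c : ι → ℝ) (f : ι → Space d → ℂ) (t : ℝ)
    (x : Space d) : ℂ :=
  ∫ u, Ψ u * ∏ i, moll (φ i) (f i) t (x - (c i * t) • u)

theorem measurable_slice {Ψ : Space d → ℂ} {φ : ι → Space d → ℂ} {f : ι → Space d → ℂ}
    (hΨ : Measurable Ψ) (hφ : ∀ i, Measurable (φ i)) (hf : ∀ i, Measurable (f i)) (c : ι → ℝ) :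
    Measurable fun p : ℝ × Space d => slice Ψ φ c f p.1 p.2 := by
  have : StronglyMeasurable fun q : (ℝ × Space d) × Space d =>
      Ψ q.2 * ∏ i, moll (φ i) (f i) q.1.1 (q.1.2 - (c i * q.1.1) • q.2) := by
    refine Measurable.stronglyMeasurable ?_
    exact (hΨ.comp measurable_snd).mul (Finset.measurable_fun_prod _ fun i _ =>
      (measurable_moll (hφ i) (hf i)).comp (g := fun p : ℝ × Space d => moll (φ i) (f i) p.1 p.2)
        (f := fun q : (ℝ × Space d) × Space d => (q.1.1, q.1.2 - (c i * q.1.1) • q.2))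
        (by fun_prop))
  exact this.integral_prod_right.measurable

section Pointwise

variable {Ψ : Space d → ℂ} {φ f : ι → Space d → ℂ} {B : ι → ℝ}

theorem integrable_slice (hΨ : Integrable Ψ) (hφ : ∀ i, Integrable (φ i))
    (hφm : ∀ i, Measurable (φ i)) (hf : ∀ i, Measurable (f i)) (hB : ∀ i x, ‖f i x‖ ≤ B i)
    (c : ι → ℝ) (t : ℝ) (x : Space d) :
    Integrable fun u => Ψ u * ∏ i, moll (φ i) (f i) t (x - (c i * t) • u) := by
  refine hΨ.mul_bdd (c := ∏ i, ((∫ w, ‖φ i w‖) * B i)) ?_ (Filter.Eventually.of_forall fun u => ?_)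
  · exact (Finset.measurable_fun_prod _ fun i _ =>
      (measurable_moll_right (hφm i) (hf i) t).comp (by fun_prop)).aestronglyMeasurable
  · rw [norm_prod]
    exact Finset.prod_le_prod (fun _ _ => norm_nonneg _) fun i _ => norm_moll_le (hφ i) (hB i) _ _

theorem norm_slice_le (hΨ : Integrable Ψ) (hφ : ∀ i, Integrable (φ i))
    (hB : ∀ i x, ‖f i x‖ ≤ B i) (c : ι → ℝ) (t : ℝ) (x : Space d) :
    ‖slice Ψ φ c f t x‖ ≤ (∫ u, ‖Ψ u‖) * ∏ i, ((∫ w, ‖φ i w‖) * B i) := by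
  rw [slice, ← integral_mul_const]
  refine norm_integral_le_of_norm_le (hΨ.norm.mul_const _) (Filter.Eventually.of_forall fun u => ?_)
  rw [norm_mul, norm_prod]
  exact mul_le_mul_of_nonneg_left (Finset.prod_le_prod (fun _ _ => norm_nonneg _) fun i _ =>
    norm_moll_le (hφ i) (hB i) _ _) (norm_nonneg _)

/-- The sup norm is taken on the kernel and the L¹ norm on the function; the change of variables
produces the decay at large scales. -/
theorem norm_moll_le_inv_pow {κ g : Space d → ℂ} {A : ℝ} (hA : ∀ w, ‖κ w‖ ≤ A)
    (hg : Integrable g) {t : ℝ} (ht : 0 < t) (x : Space d) :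
    ‖moll κ g t x‖ ≤ A * (∫ y, ‖g y‖) * (1 / t ^ d) := by
  have h1 : Integrable fun w => ‖g (x - t • w)‖ :=
    ((hg.comp_sub_left x).comp_smul (f := fun w => g (x - w)) ht.ne').norm
  have h2 : ∫ w, ‖g (x - t • w)‖ = (1 / t ^ d) * ∫ y, ‖g y‖ := by
    rw [Measure.integral_comp_smul volume (fun w => ‖g (x - w)‖) t,
      integral_sub_left_eq_self (fun w => ‖g w‖) volume x]
    simp [abs_of_pos ht]
  calc ‖moll κ g t x‖ ≤ ∫ w, A * ‖g (x - t • w)‖ :=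
        norm_integral_le_of_norm_le (h1.const_mul A) (Filter.Eventually.of_forall fun w => by
          rw [norm_mul]; exact mul_le_mul_of_nonneg_right (hA w) (norm_nonneg _))
    _ = _ := by rw [integral_const_mul, h2]; ring

theorem norm_slice_le_inv_pow [DecidableEq ι] (hΨ : Integrable Ψ) (hφ : ∀ i, Integrable (φ i))
    (hB : ∀ i x, ‖f i x‖ ≤ B i) (c : ι → ℝ) {p : ι} {A : ℝ} (hA : ∀ w, ‖φ p w‖ ≤ A)
    (hp : Integrable (f p)) {t : ℝ} (ht : 0 < t) (x : Space d) :
    ‖slice Ψ φ c f t x‖ ≤ (∫ u, ‖Ψ u‖) * (A * (∫ y, ‖f p y‖) *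
      ∏ i ∈ Finset.univ.erase p, ((∫ w, ‖φ i w‖) * B i)) * (1 / t ^ d) := by
  rw [mul_assoc, slice, ← integral_mul_const]
  refine norm_integral_le_of_norm_le (hΨ.norm.mul_const _) (Filter.Eventually.of_forall fun u => ?_)
  rw [norm_mul, norm_prod]
  refine mul_le_mul_of_nonneg_left ?_ (norm_nonneg _)
  rw [← Finset.mul_prod_erase _ _ (Finset.mem_univ p)]
  have h1 := norm_moll_le_inv_pow hA hp ht (x - (c p * t) • u)
  have h2 : ∏ i ∈ Finset.univ.erase p, ‖moll (φ i) (f i) t (x - (c i * t) • u)‖ ≤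
      ∏ i ∈ Finset.univ.erase p, ((∫ w, ‖φ i w‖) * B i) :=
    Finset.prod_le_prod (fun _ _ => norm_nonneg _) fun i _ => norm_moll_le (hφ i) (hB i) _ _
  refine (mul_le_mul h1 h2 (Finset.prod_nonneg fun _ _ => norm_nonneg _)
    ((norm_nonneg _).trans h1)).trans (le_of_eq ?_)
  ring

theorem exists_norm_prod_sub_prod_le {κ : Type*} (s : Finset κ) (B : κ → ℝ) :
    ∃ D, 0 ≤ D ∧ ∀ (a b : κ → ℂ) (δ : κ → ℝ), (∀ i ∈ s, ‖a i‖ ≤ B i) → (∀ i ∈ s, ‖b i‖ ≤ B i) →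
      (∀ i ∈ s, ‖a i - b i‖ ≤ δ i) → ‖∏ i ∈ s, a i - ∏ i ∈ s, b i‖ ≤ D * ∑ i ∈ s, δ i := by
  classical
  induction s using Finset.induction_on with
  | empty => exact ⟨0, le_rfl, by simp⟩
  | insert j s hj ih =>
    obtain ⟨D, hD, h⟩ := ih
    refine ⟨∏ i ∈ s, |B i| + |B j| * D, by positivity, fun a b δ ha hb hδ => ?_⟩
    rw [Finset.prod_insert hj, Finset.prod_insert hj, Finset.sum_insert hj]
    have hs : ∀ i ∈ s, i ∈ insert j s := fun i hi => Finset.mem_insert_of_mem hi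
    have h1 := h a b δ (fun i hi => ha i (hs i hi)) (fun i hi => hb i (hs i hi))
      (fun i hi => hδ i (hs i hi))
    have h2 := hδ j (Finset.mem_insert_self j s)
    have h3 : ‖b j‖ ≤ |B j| := (hb j (Finset.mem_insert_self j s)).trans (le_abs_self _)
    have h4 : ‖∏ i ∈ s, a i‖ ≤ ∏ i ∈ s, |B i| := by
      rw [norm_prod]
      exact Finset.prod_le_prod (fun _ _ => norm_nonneg _) fun i hi =>
        (ha i (hs i hi)).trans (le_abs_self _)
    have h5 : 0 ≤ ∑ i ∈ s, δ i := Finset.sum_nonneg fun i hi =>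
      (norm_nonneg _).trans (hδ i (hs i hi))
    have h6 : 0 ≤ δ j := (norm_nonneg _).trans h2
    have h7 : 0 ≤ ∏ i ∈ s, |B i| := Finset.prod_nonneg fun i _ => abs_nonneg _
    calc ‖a j * ∏ i ∈ s, a i - b j * ∏ i ∈ s, b i‖
        = ‖(a j - b j) * ∏ i ∈ s, a i + b j * (∏ i ∈ s, a i - ∏ i ∈ s, b i)‖ := by
          congr 1; ring
      _ ≤ δ j * ∏ i ∈ s, |B i| + |B j| * (D * ∑ i ∈ s, δ i) := by
          refine (norm_add_le _ _).trans (add_le_add ?_ ?_)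
          · rw [norm_mul]; exact mul_le_mul h2 h4 (norm_nonneg _) h6
          · rw [norm_mul]; exact mul_le_mul h3 h1 (norm_nonneg _) (abs_nonneg _)
      _ ≤ _ := by
          have := mul_nonneg h7 h5
          have := mul_nonneg (mul_nonneg (abs_nonneg (B j)) hD) h6
          nlinarith

/-- Differentiability gives the estimate near x; at distance at least δ boundedness does, as 2B ≤
(2B/δ)‖y‖. No bound on the derivatives of f is needed. -/
theorem exists_norm_sub_le {f : Space d → ℂ} {B : ℝ} (hB : ∀ x, ‖f x‖ ≤ B) {x : Space d}
    (hf : DifferentiableAt ℝ f x) : ∃ C, 0 ≤ C ∧ ∀ y, ‖f (x - y) - f x‖ ≤ C * ‖y‖ := by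
  obtain ⟨C, hC⟩ := hf.isBigO_sub.bound
  obtain ⟨δ, hδ, h⟩ := Metric.eventually_nhds_iff.1 hC
  have hB0 : 0 ≤ B := (norm_nonneg _).trans (hB x)
  refine ⟨|C| + 2 * B / δ, by positivity, fun y => ?_⟩
  rw [add_mul]
  rcases lt_or_ge ‖y‖ δ with hy | hy
  · have := h (y := x - y) (by simpa using hy)
    have h2 : ‖x - y - x‖ = ‖y‖ := by rw [sub_sub_cancel_left, norm_neg]
    rw [h2] at this
    have h3 := mul_le_mul_of_nonneg_right (le_abs_self C) (norm_nonneg y)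
    have : 0 ≤ 2 * B / δ * ‖y‖ := by positivity
    linarith
  · have h1 : ‖f (x - y) - f x‖ ≤ 2 * B := (norm_sub_le _ _).trans (by linarith [hB (x - y), hB x])
    have h2 : 2 * B ≤ 2 * B / δ * ‖y‖ := by
      rw [div_mul_eq_mul_div, le_div_iff₀ hδ]
      exact mul_le_mul_of_nonneg_left hy (by positivity)
    have : 0 ≤ |C| * ‖y‖ := by positivity
    linarith

theorem exists_norm_moll_sub_le (κ : 𝓢(Space d, ℂ)) {f : Space d → ℂ} {B : ℝ} (hfm : Measurable f)
    (hB : ∀ x, ‖f x‖ ≤ B) (c : ℝ) {x : Space d} (hf : DifferentiableAt ℝ f x) :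
    ∃ C, 0 ≤ C ∧ ∀ t u, 0 ≤ t →
      ‖moll κ f t (x - (c * t) • u) - moll κ f 0 x‖ ≤ C * (t * (1 + ‖u‖)) := by
  obtain ⟨C, hC, h⟩ := exists_norm_sub_le hB hf
  have i1 : Integrable fun w => ‖w‖ * ‖κ w‖ := by simpa using κ.integrable_pow_mul volume 1
  have i0 : Integrable fun w => ‖κ w‖ := κ.integrable.norm
  refine ⟨C * (|c| * (∫ w, ‖κ w‖) + ∫ w, ‖w‖ * ‖κ w‖), mul_nonneg hC (add_nonneg (mul_nonneg
    (abs_nonneg _) (integral_nonneg fun _ => norm_nonneg _))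
    (integral_nonneg fun _ => by positivity)), fun t u ht => ?_⟩
  have e : moll κ f t (x - (c * t) • u) - moll κ f 0 x =
      ∫ w, κ w * (f (x - ((c * t) • u + t • w)) - f x) := by
    simp only [moll, mul_sub]
    rw [integral_sub]
    · simp only [zero_smul, sub_zero, sub_sub]
    · have := integrable_mul_bounded κ.integrable hfm hB t (x - (c * t) • u)
      simpa only [sub_sub] using this
    · exact κ.integrable.mul_const _
  rw [e]
  calc _ ≤ ∫ w, C * t * (|c| * ‖u‖ * ‖κ w‖ + ‖w‖ * ‖κ w‖) := by
        refine norm_integral_le_of_norm_le (((i0.const_mul _).add i1).const_mul _)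
          (Filter.Eventually.of_forall fun w => ?_)
        rw [norm_mul]
        have h1 : ‖(c * t) • u + t • w‖ ≤ |c| * t * ‖u‖ + t * ‖w‖ := by
          refine (norm_add_le _ _).trans (le_of_eq ?_)
          rw [norm_smul, norm_smul, Real.norm_eq_abs, Real.norm_eq_abs, abs_mul, abs_of_nonneg ht]
        calc ‖κ w‖ * _ ≤ ‖κ w‖ * (C * (|c| * t * ‖u‖ + t * ‖w‖)) :=
              mul_le_mul_of_nonneg_left ((h _).trans (mul_le_mul_of_nonneg_left h1 hC))
                (norm_nonneg _)
          _ = _ := by ring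
    _ = C * t * (|c| * ‖u‖ * (∫ w, ‖κ w‖) + ∫ w, ‖w‖ * ‖κ w‖) := by
        rw [integral_const_mul, integral_add (i0.const_mul _) i1, integral_const_mul]
    _ ≤ C * t * ((|c| * (∫ w, ‖κ w‖) + ∫ w, ‖w‖ * ‖κ w‖) * (1 + ‖u‖)) := by
        refine mul_le_mul_of_nonneg_left ?_ (by positivity)
        have a0 : 0 ≤ |c| * (∫ w, ‖κ w‖) :=
          mul_nonneg (abs_nonneg _) (integral_nonneg fun _ => norm_nonneg _)
        have a1 : 0 ≤ ∫ w, ‖w‖ * ‖κ w‖ := integral_nonneg fun _ => by positivity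
        nlinarith [norm_nonneg u, mul_nonneg a1 (norm_nonneg u)]
    _ = _ := by ring

/-- Since ∫ Ψ = 0, the product of the averages may be diminished by its value at scale 0, from which
it differs by O(t(1 + |u|)). -/
theorem exists_norm_slice_le_mul (Ψ : 𝓢(Space d, ℂ)) (hΨ : 𝓕 Ψ 0 = 0) (φ : ι → 𝓢(Space d, ℂ))
    (hf : ∀ i, Measurable (f i)) (hB : ∀ i x, ‖f i x‖ ≤ B i) (c : ι → ℝ) {x : Space d}
    (hfx : ∀ i, DifferentiableAt ℝ (f i) x) :
    ∃ C, 0 ≤ C ∧ ∀ t, 0 ≤ t → ‖slice Ψ (fun i => φ i) c f t x‖ ≤ C * t := by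
  choose C hC h using fun i => exists_norm_moll_sub_le (φ i) (hf i) (hB i) (c i) (hfx i)
  obtain ⟨D, hD, hprod⟩ := exists_norm_prod_sub_prod_le Finset.univ
    (fun i => (∫ w, ‖φ i w‖) * B i)
  have i1 : Integrable fun u => ‖u‖ * ‖Ψ u‖ := by simpa using Ψ.integrable_pow_mul volume 1
  have i0 : Integrable fun u => ‖Ψ u‖ := Ψ.integrable.norm
  refine ⟨D * (∑ i, C i) * ∫ u, (‖Ψ u‖ + ‖u‖ * ‖Ψ u‖), mul_nonneg (mul_nonneg hD
    (Finset.sum_nonneg fun i _ => hC i)) (integral_nonneg fun _ => by positivity), fun t ht => ?_⟩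
  have hΨ0 : ∫ u, Ψ u = 0 := by rw [integral_eq_fourier_zero, ← SchwartzMap.fourier_coe, hΨ]
  have e : slice Ψ (fun i => φ i) c f t x = ∫ u, Ψ u *
      (∏ i, moll (φ i) (f i) t (x - (c i * t) • u) - ∏ i, moll (φ i) (f i) 0 x) := by
    simp only [mul_sub]
    rw [integral_sub (integrable_slice Ψ.integrable (fun i => (φ i).integrable)
      (fun i => (φ i).continuous.measurable) hf hB c t x) (Ψ.integrable.mul_const _),
      integral_mul_const, hΨ0, zero_mul, sub_zero, slice]
  rw [e]
  calc _ ≤ ∫ u, D * (∑ i, C i) * t * (‖Ψ u‖ + ‖u‖ * ‖Ψ u‖) := by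
        refine norm_integral_le_of_norm_le ((i0.add i1).const_mul _)
          (Filter.Eventually.of_forall fun u => ?_)
        rw [norm_mul]
        have := hprod (fun i => moll (φ i) (f i) t (x - (c i * t) • u))
          (fun i => moll (φ i) (f i) 0 x) (fun i => C i * (t * (1 + ‖u‖)))
          (fun i _ => norm_moll_le (φ i).integrable (hB i) _ _)
          (fun i _ => norm_moll_le (φ i).integrable (hB i) _ _) (fun i _ => h i t u ht)
        rw [← Finset.sum_mul] at this
        calc _ ≤ ‖Ψ u‖ * _ := mul_le_mul_of_nonneg_left this (norm_nonneg _)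
          _ = _ := by ring
    _ = _ := by rw [integral_const_mul]; ring

end Pointwise

/-- The average over all scales converges absolutely. -/
theorem integrableOn_slice (hd : 1 ≤ d) [DecidableEq ι] (Ψ : 𝓢(Space d, ℂ)) (hΨ : 𝓕 Ψ 0 = 0)
    (φ : ι → 𝓢(Space d, ℂ)) {f : ι → Space d → ℂ} {B : ι → ℝ}
    (hf : ∀ i, ContDiff ℝ ∞ (f i)) (hB : ∀ i x, ‖f i x‖ ≤ B i) (c : ι → ℝ) {p : ι}
    (hp : Integrable (f p)) {L : ℝ → ℂ} {A : ℝ} (hL : Measurable L) (hA : ∀ t > 0, ‖L t‖ ≤ A)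
    (x : Space d) :
    IntegrableOn (fun t => L t * slice Ψ (fun i => φ i) c f t x / (t : ℂ)) (Ioi 0) := by
  have hfm : ∀ i, Measurable (f i) := fun i => (hf i).continuous.measurable
  have hA0 : 0 ≤ A := (norm_nonneg _).trans (hA 1 one_pos)
  have hm : Measurable fun t => L t * slice Ψ (fun i => φ i) c f t x / (t : ℂ) :=
    (hL.mul ((measurable_slice Ψ.continuous.measurable (fun i => (φ i).continuous.measurable)
      hfm c).comp (g := fun q : ℝ × Space d => slice Ψ (fun i => φ i) c f q.1 q.2)
      (f := fun t => (t, x)) (by fun_prop))).div Complex.measurable_ofReal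
  rw [← Ioc_union_Ioi_eq_Ioi (zero_le_one (α := ℝ))]
  refine IntegrableOn.union ?_ ?_
  · obtain ⟨C, hC, h⟩ := exists_norm_slice_le_mul Ψ hΨ φ hfm hB c
      (x := x) (fun i => (hf i).differentiable (by simp) x)
    refine Measure.integrableOn_of_bounded (M := A * C) (by simp) hm.aestronglyMeasurable
      ((ae_restrict_iff' measurableSet_Ioc).2 (Filter.Eventually.of_forall fun t ht => ?_))
    rw [norm_div, norm_mul, Complex.norm_real, Real.norm_of_nonneg ht.1.le, div_le_iff₀ ht.1,
      mul_assoc]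
    exact mul_le_mul (hA t ht.1) (h t ht.1.le) (norm_nonneg _) hA0
  · obtain ⟨A', -, hA'⟩ := (φ p).decay 0 0
    have hA'' : ∀ w, ‖φ p w‖ ≤ A' := fun w => by simpa using hA' w
    set C := (∫ u, ‖Ψ u‖) * (A' * (∫ y, ‖f p y‖) *
      ∏ i ∈ Finset.univ.erase p, ((∫ w, ‖φ i w‖) * B i)) with hC
    have hdom : IntegrableOn (fun t : ℝ => A * C * t ^ (-2 : ℝ)) (Ioi 1) :=
      (integrableOn_Ioi_rpow_of_lt (by norm_num) one_pos).const_mul _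
    refine hdom.mono' hm.aestronglyMeasurable
      ((ae_restrict_iff' measurableSet_Ioi).2 (Filter.Eventually.of_forall fun t ht => ?_))
    have ht1 : 1 < t := ht
    have ht0 : 0 < t := by linarith
    have h1 := norm_slice_le_inv_pow (φ := fun i => φ i) Ψ.integrable
      (fun i => (φ i).integrable) hB c hA'' hp ht0 x
    have hC0 : 0 ≤ C := by
      have := (norm_nonneg _).trans h1
      exact nonneg_of_mul_nonneg_left this (by positivity)
    rw [norm_div, norm_mul, Complex.norm_real, Real.norm_of_nonneg ht0.le, div_le_iff₀ ht0]
    -- The positivity of the dimension gives one power of decay, and dt/t a second one.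
    have h2 : 1 / t ^ d ≤ 1 / t := by
      refine one_div_le_one_div_of_le ht0 ?_
      calc t = t ^ 1 := (pow_one t).symm
        _ ≤ t ^ d := pow_le_pow_right₀ ht1.le hd
    calc _ ≤ A * (C * (1 / t)) := mul_le_mul (hA t ht0)
          (h1.trans (mul_le_mul_of_nonneg_left h2 hC0)) (norm_nonneg _) hA0
      _ = A * C * t ^ (-2 : ℝ) * t := by
          rw [Real.rpow_neg ht0.le, show (2 : ℝ) = ((2 : ℕ) : ℝ) by norm_num, Real.rpow_natCast]
          field_simp

section Model

variable {n : ℕ} {Ψ : 𝓢(Space d, ℂ)} {Φ : Fin n → 𝓢(Space d, ℂ)} {ρ lam : Fin n → ℝ}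
  {f : Fin n → Space d → ℂ} {B : Fin n → ℝ}

theorem conv_dil_mul {κ f : Space d → ℂ} {l t : ℝ} (hl : l ≠ 0) (ht : t ≠ 0) (x : Space d) :
    conv (dil (l * t) κ) f x = moll (dil l κ) f t x := by
  rw [conv_dil (mul_ne_zero hl ht), moll_dil hl, mul_comm]

theorem innerIntegrand_eq (hlam : ∀ i, lam i ≠ 0) {t : ℝ} (ht : 0 < t) (x y : Space d) :
    innerIntegrand Ψ Φ ρ lam f x t y = ((1 / |t| ^ d : ℝ) : ℂ) * (fun u => Ψ u *
      ∏ i, moll (dil (lam i) (Φ i)) (f i) t (x - (ρ i * lam i * t) • u)) (t⁻¹ • y) := by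
  simp only [innerIntegrand, conv_dil_mul (hlam _) ht.ne', dil, smul_smul]
  rw [mul_assoc]
  simp only [mul_assoc, mul_inv_cancel₀ ht.ne', mul_one]

theorem integral_innerIntegrand (hlam : ∀ i, lam i ≠ 0) {t : ℝ} (ht : 0 < t) (x : Space d) :
    ∫ y, innerIntegrand Ψ Φ ρ lam f x t y =
      slice Ψ (fun i => dil (lam i) (Φ i)) (fun i => ρ i * lam i) f t x := by
  simp only [innerIntegrand_eq hlam ht]
  rw [integral_const_mul, Measure.integral_comp_inv_smul volume (fun u => Ψ u *
      ∏ i, moll (dil (lam i) (Φ i)) (f i) t (x - (ρ i * lam i * t) • u)) t]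
  simp only [finrank_euclideanSpace, Fintype.card_fin, Complex.real_smul]
  rw [← mul_assoc, ← Complex.ofReal_mul, abs_pow, one_div, inv_mul_cancel₀ (by positivity)]
  simp [slice]

theorem outerIntegrand_eq (hlam : ∀ i, lam i ≠ 0) (L : ℝ → ℂ) {t : ℝ} (ht : 0 < t) (x : Space d) :
    outerIntegrand Ψ Φ ρ lam L f x t =
      L t * slice Ψ (fun i => dil (lam i) (Φ i)) (fun i => ρ i * lam i) f t x / (t : ℂ) := by
  rw [outerIntegrand, integral_innerIntegrand hlam ht]

theorem modelU_eq (hlam : ∀ i, lam i ≠ 0) (L : ℝ → ℂ) (x : Space d) :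
    modelU Ψ Φ ρ lam L f x = ∫ t in Ioi (0 : ℝ),
      L t * slice Ψ (fun i => dil (lam i) (Φ i)) (fun i => ρ i * lam i) f t x / (t : ℂ) :=
  setIntegral_congr_fun measurableSet_Ioi fun _ ht => outerIntegrand_eq hlam L ht x

theorem modelConverges (hd : 1 ≤ d) (hΨ : 𝓕 Ψ 0 = 0) (hlam : ∀ i, lam i ≠ 0)
    (hf : ∀ i, ContDiff ℝ ∞ (f i)) (hB : ∀ i x, ‖f i x‖ ≤ B i) {p : Fin n}
    (hp : Integrable (f p)) {L : ℝ → ℂ} {A : ℝ} (hL : Measurable L) (hA : ∀ t > 0, ‖L t‖ ≤ A)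
    (x : Space d) : ModelConverges Ψ Φ ρ lam L f x := by
  have hfm : ∀ i, Measurable (f i) := fun i => (hf i).continuous.measurable
  choose φ hφ using fun i => exists_schwartz_dil (Φ i) (hlam i)
  refine ⟨fun t ht i y => ?_, fun t ht => ?_, ?_⟩
  · obtain ⟨κ, hκ⟩ := exists_schwartz_dil (Φ i) (mul_ne_zero (hlam i) ht.ne')
    rw [← hκ]
    have := integrable_mul_bounded κ.integrable (hfm i) (hB i) 1 y
    simpa only [one_smul, ConvolutionExistsAt, ContinuousLinearMap.mul_apply'] using this
  · have h1 := integrable_slice (φ := fun i => φ i) Ψ.integrable (fun i => (φ i).integrable)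
      (fun i => (φ i).continuous.measurable) hfm hB (fun i => ρ i * lam i) t x
    have h2 := (h1.comp_smul (inv_ne_zero ht.ne')).const_mul ((1 / |t| ^ d : ℝ) : ℂ)
    refine h2.congr (Filter.Eventually.of_forall fun y => ?_)
    simp only [innerIntegrand_eq hlam ht, hφ]
  · have := integrableOn_slice hd Ψ hΨ φ hf hB (fun i => ρ i * lam i) hp hL hA x
    refine this.congr_fun (fun t ht => ?_) measurableSet_Ioi
    simp only [outerIntegrand_eq hlam L ht, hφ]

end Model

end

/-! ### L² bounds for the truncated integrals -/

section

variable {d : ℕ}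

theorem lintegral_Ioc_mul {G : ℝ → ℝ≥0∞} (hG : Measurable G) {c : ℝ} (hc : 0 < c) (a b : ℝ) :
    ∫⁻ t in Ioc (c * a) (c * b), G t = ENNReal.ofReal c * ∫⁻ t in Ioc a b, G (c * t) := by
  rw [← lintegral_indicator measurableSet_Ioc, ← lintegral_indicator measurableSet_Ioc]
  conv_lhs => rw [← Real.smul_map_volume_mul_left hc.ne', lintegral_smul_measure,
    lintegral_map (hG.indicator measurableSet_Ioc) (measurable_const_mul c), abs_of_pos hc]
  rw [smul_eq_mul]
  congr 2; ext t
  simp only [indicator, mem_Ioc, mul_lt_mul_iff_right₀ hc, mul_le_mul_iff_right₀ hc]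

/-- The measure dt/t is invariant under dilation, so every octave is carried back to the first. -/
theorem lintegral_Ioc_dyadic {F : ℝ → ℝ≥0∞} (hF : Measurable F) {a : ℝ} (ha : 0 < a) (n : ℕ) :
    ∫⁻ t in Ioc a (2 ^ n * a), F t * ENNReal.ofReal (1 / t) =
      ∑ k ∈ Finset.range n, ∫⁻ t in Ioc a (2 * a), F (2 ^ k * t) * ENNReal.ofReal (1 / t) := by
  induction n with
  | zero => simp
  | succ n ih =>
    have h1 : a ≤ 2 ^ n * a := le_mul_of_one_le_left ha.le (one_le_pow₀ (by norm_num))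
    have h2 : 2 ^ n * a ≤ 2 ^ (n + 1) * a := by
      rw [pow_succ]; nlinarith [pow_pos (two_pos : (0 : ℝ) < 2) n]
    rw [← Ioc_union_Ioc_eq_Ioc h1 h2, lintegral_union measurableSet_Ioc
      (Set.disjoint_left.2 fun t ht ht' => not_lt.2 ht.2 ht'.1), ih, Finset.sum_range_succ]
    congr 1
    rw [pow_succ, mul_assoc, lintegral_Ioc_mul (by fun_prop) (by positivity),
      ← lintegral_const_mul _ (by fun_prop)]
    refine setLIntegral_congr_fun measurableSet_Ioc fun t ht => ?_
    have ht0 : 0 < t := ha.trans ht.1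
    rw [← mul_assoc, mul_comm (ENNReal.ofReal _), mul_assoc,
      ← ENNReal.ofReal_mul (by positivity)]
    congr 2; field_simp

theorem eLpNorm_two_sq (f : Space d → ℂ) : eLpNorm f 2 volume ^ 2 = ∫⁻ x, ‖f x‖ₑ ^ 2 := by
  have := eLpNorm_nnreal_pow_eq_lintegral (μ := (volume : Measure (Space d))) (f := f)
    (p := 2) two_ne_zero
  simpa using this

theorem lintegral_enorm_sq_eq (h : 𝓢(Space d, ℂ)) :
    ∫⁻ x, ‖h x‖ₑ ^ 2 = ENNReal.ofReal (‖h.toLp 2‖ ^ 2) := by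
  rw [← eLpNorm_two_sq, SchwartzMap.norm_toLp, ENNReal.ofReal_pow ENNReal.toReal_nonneg,
    ENNReal.ofReal_toReal (h.memLp 2 volume).2.ne]

/-- A bounded function whose pairing with test functions is `L²`-bounded belongs to `L²`. -/
theorem eLpNorm_le_of_pairing {u : Space d → ℂ} (hu : Measurable u) {B : ℝ}
    (hB : ∀ x, ‖u x‖ ≤ B) {C : ℝ} (hC : 0 ≤ C)
    (h : ∀ h : 𝓢(Space d, ℂ), ‖∫ x, h x * u x‖ ≤ C * ‖h.toLp 2‖) :
    eLpNorm u 2 volume ≤ ENNReal.ofReal C := by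
  have hint : ∀ h : 𝓢(Space d, ℂ), Integrable fun x => h x * u x := fun h =>
    h.integrable.mul_bdd hu.aestronglyMeasurable (Filter.Eventually.of_forall hB)
  let ℓ : 𝓢(Space d, ℂ) →ₗ[ℂ] ℂ :=
    { toFun := fun h => ∫ x, h x * u x
      map_add' := fun h k => by
        simp only [add_apply, add_mul]; exact integral_add (hint h) (hint k)
      map_smul' := fun a h => by
        simp only [smul_apply, smul_eq_mul, mul_assoc, RingHom.id_apply]
        exact integral_const_mul _ _ }
  let e : 𝓢(Space d, ℂ) →ₗ[ℂ] Lp ℂ 2 (volume : Measure (Space d)) :=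
    (SchwartzMap.toLpCLM ℂ ℂ 2 volume).toLinearMap
  have hdense : DenseRange e :=
    SchwartzMap.denseRange_toLpCLM (F := ℂ) (μ := (volume : Measure (Space d)))
      (p := 2) (by simp)
  -- The pairing extends from the dense Schwartz functions to L² and is represented by some v;
  -- testing with smooth compactly supported functions identifies u with the conjugate of v.
  let L := ℓ.extendOfNorm e
  have hL : ∀ h, L (e h) = ℓ h := fun k => LinearMap.extendOfNorm_eq hdense ⟨C, h⟩ k
  have hLC : ‖L‖ ≤ C := LinearMap.opNorm_extendOfNorm_le hdense hC h
  let v := (InnerProductSpace.toDual ℂ (Lp ℂ 2 (volume : Measure (Space d)))).symm L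
  have hv : ∀ k, inner ℂ v k = L k := fun k => InnerProductSpace.toDual_symm_apply
  have hvC : ‖v‖ ≤ C := by rw [LinearIsometryEquiv.norm_map]; exact hLC
  have hae : ∀ᵐ x, u x = (starRingEnd ℂ) (v x) := by
    have hvl : LocallyIntegrable (fun x => (starRingEnd ℂ) (v x)) volume := by
      have h1 := (Lp.memLp v).locallyIntegrable one_le_two
      have h2 : MemLp (fun x => (starRingEnd ℂ) (v x)) 2 volume := (Lp.memLp v).star
      exact h2.locallyIntegrable one_le_two
    have hul : LocallyIntegrable u volume := by
      refine LocallyIntegrable.mono (f := fun _ => B) (locallyIntegrable_const B)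
        hu.aestronglyMeasurable (Filter.Eventually.of_forall fun x => ?_)
      exact (hB x).trans (le_abs_self B)
    refine ae_eq_of_integral_contDiff_smul_eq hul hvl fun g hg hgs => ?_
    have hs : HasCompactSupport fun x => (g x : ℂ) :=
      hgs.comp_left (g := Complex.ofReal) Complex.ofReal_zero
    have hd : ContDiff ℝ ∞ fun x => (g x : ℂ) := Complex.ofRealCLM.contDiff.comp hg
    have h1 := (hL (hs.toSchwartzMap hd)).symm.trans (hv _).symm
    have h2 : ℓ (hs.toSchwartzMap hd) = ∫ x, g x • u x := rfl
    rw [← h2, h1, L2.inner_def]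
    refine integral_congr_ae ?_
    filter_upwards [(hs.toSchwartzMap hd).coeFn_toLp 2 volume] with x hx
    have hx' : e (hs.toSchwartzMap hd) x = (g x : ℂ) := hx
    rw [hx', RCLike.inner_apply, Complex.real_smul]
  rw [eLpNorm_congr_ae hae]
  have h3 : eLpNorm (fun x => (starRingEnd ℂ) (v x)) 2 volume = eLpNorm v 2 volume :=
    eLpNorm_congr_norm_ae (Filter.Eventually.of_forall fun x => by simp)
  rw [h3]
  rw [Lp.norm_def] at hvC
  rw [← ENNReal.ofReal_toReal (Lp.eLpNorm_ne_top v)]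
  exact ENNReal.ofReal_le_ofReal hvC

/-- Turns a bound by a sum of squares into a bound by a product. The optimal s is γ/η; it is
replaced by (γ + ε)/(η + ε) so that γ or η may vanish. -/
theorem le_two_mul_of_forall_scale {X C γ η : ℝ} (hC : 0 ≤ C) (hγ : 0 ≤ γ) (hη : 0 ≤ η)
    (h : ∀ s > 0, s * X ≤ C * (γ ^ 2 + s ^ 2 * η ^ 2)) : X ≤ 2 * C * γ * η := by
  refine le_of_forall_pos_le_add fun δ hδ => ?_
  set ε := δ / (C * (γ + η) + 1) with hε
  have hD : 0 < C * (γ + η) + 1 := by positivity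
  have hε0 : 0 < ε := by positivity
  have hεδ : ε * (C * (γ + η)) ≤ δ := by
    rw [hε, div_mul_eq_mul_div, div_le_iff₀ hD]; nlinarith
  have h1 := h ((γ + ε) / (η + ε)) (by positivity)
  have hη' : 0 < η + ε := by positivity
  have hγ' : 0 < γ + ε := by positivity
  have h2 : (γ + ε) * X ≤ (γ + ε) * (C * (γ * (η + ε) + (γ + ε) * η)) := by
    have h3 := mul_le_mul_of_nonneg_left h1 hη'.le
    have e1 : (η + ε) * ((γ + ε) / (η + ε) * X) = (γ + ε) * X := by field_simp
    have e2 : (η + ε) * (C * (γ ^ 2 + ((γ + ε) / (η + ε)) ^ 2 * η ^ 2)) =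
        C * (γ ^ 2 * (η + ε) + (γ + ε) ^ 2 * (η ^ 2 / (η + ε))) := by field_simp
    rw [e1, e2] at h3
    refine h3.trans ?_
    have h4 : γ ^ 2 * (η + ε) ≤ (γ + ε) * (γ * (η + ε)) := by
      have : 0 ≤ ε * γ * (η + ε) := by positivity
      nlinarith
    have h5 : η ^ 2 / (η + ε) ≤ η := by
      rw [div_le_iff₀ hη']; nlinarith
    have h6 := mul_le_mul_of_nonneg_left h5 (sq_nonneg (γ + ε))
    have := mul_le_mul_of_nonneg_left (add_le_add h4 h6) hC
    refine this.trans (le_of_eq (by ring))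
  have h7 := le_of_mul_le_mul_left h2 hγ'
  nlinarith

variable {ι : Type*} [Fintype ι] [DecidableEq ι]

theorem norm_div_le_of_lt {L : ℝ → ℂ} {A a : ℝ} (hA : ∀ t > 0, ‖L t‖ ≤ A) (ha : 0 < a) {t : ℝ}
    (ht : a < t) : ‖L t / (t : ℂ)‖ ≤ A / a := by
  have ht0 := ha.trans ht
  rw [norm_div, Complex.norm_real, Real.norm_of_nonneg ht0.le]
  have hA0 : 0 ≤ A := (norm_nonneg _).trans (hA t ht0)
  exact div_le_div₀ hA0 (hA t ht0) ha ht.le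

/-- The dyadic bound is uniform in the base scale, hence can be integrated over one octave. The
constant depends neither on the truncation nor on the number of octaves. -/
theorem exists_integral_truncation_le {Ψ : 𝓢(Space d, ℂ)} {φ : ι → 𝓢(Space d, ℂ)} (p : ι)
    {a R : ℝ} (ha : 0 < a) (hΨ : ∀ ξ, ‖ξ‖ ≤ a → 𝓕 Ψ ξ = 0)
    (hR : ∀ i ξ, R < ‖ξ‖ → 𝓕 (φ i) ξ = 0) (c M : ι → ℝ) {L : ℝ → ℂ} {A : ℝ} (hL : Measurable L)
    (hA : ∀ t > 0, ‖L t‖ ≤ A) :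
    ∃ C, 0 ≤ C ∧ ∀ (f : ι → Space d → ℂ) (g : 𝓢(Space d, ℂ)), (∀ i, Measurable (f i)) →
      (∀ i, i ≠ p → ∀ x, ‖f i x‖ ≤ M i) → f p = g → ∀ (b : ℝ) (n : ℕ), 0 < b →
      eLpNorm (fun x => ∫ t in Ioc b (2 ^ n * b), L t * slice Ψ (fun i => φ i) c f t x / (t : ℂ))
        2 volume ≤ ENNReal.ofReal (C * ‖g.toLp 2‖) := by
  obtain ⟨C, hC, hpair⟩ := exists_sum_pairing_le p ha hΨ hR c M
  have hA0 : 0 ≤ A := (norm_nonneg _).trans (hA 1 one_pos)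
  refine ⟨2 * (A * C), by positivity, fun f g hf hM hg b n hb => ?_⟩
  have hB : ∀ i, ∃ B, ∀ x, ‖f i x‖ ≤ B := by
    intro i
    by_cases hip : i = p
    · obtain ⟨B, -, hB⟩ := g.decay 0 0
      exact ⟨B, fun x => by rw [hip, hg]; simpa using hB x⟩
    exact ⟨M i, hM i hip⟩
  choose B hB using hB
  set W : ℝ → Space d → ℂ := slice Ψ (fun i => φ i) c f with hW
  have hWm : Measurable fun q : ℝ × Space d => W q.1 q.2 :=
    measurable_slice Ψ.continuous.measurable (fun i => (φ i).continuous.measurable) hf c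
  obtain ⟨D, hWD⟩ : ∃ D, ∀ t x, ‖W t x‖ ≤ D := ⟨_, fun t x =>
    norm_slice_le Ψ.integrable (fun i => (φ i).integrable) hB c t x⟩
  have hpairW : ∀ (h : 𝓢(Space d, ℂ)) (τ : ℝ), 0 < τ →
      ∑ k ∈ Finset.range n, ‖∫ x, h x * W (2 ^ k * τ) x‖ₑ ≤
        ENNReal.ofReal C * ((∫⁻ x, ‖g x‖ₑ ^ 2) + ∫⁻ x, ‖h x‖ₑ ^ 2) := fun h τ hτ =>
    hpair f g h hf hM hg τ n hτ
  clear_value W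
  have hWm' : Measurable fun q : Space d × ℝ => W q.2 q.1 :=
    hWm.comp (measurable_snd.prodMk measurable_fst)
  set I := Ioc b (2 ^ n * b) with hI
  set k : ℝ → ℂ := I.indicator fun t => L t / (t : ℂ) with hk
  have hkm : Measurable k := (hL.div Complex.measurable_ofReal).indicator measurableSet_Ioc
  have hki : Integrable k := by
    rw [hk, integrable_indicator_iff measurableSet_Ioc]
    refine Measure.integrableOn_of_bounded (M := A / b) (by simp)
      (hL.div Complex.measurable_ofReal).aestronglyMeasurable
      ((ae_restrict_iff' measurableSet_Ioc).2 (Filter.Eventually.of_forall fun t ht => ?_))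
    exact norm_div_le_of_lt hA hb ht.1
  have e1 : ∀ x, ∫ t in I, L t * W t x / (t : ℂ) = ∫ t, k t * W t x := by
    intro x
    rw [← integral_indicator measurableSet_Ioc]
    congr 1; ext t
    simp only [hk, indicator]
    split_ifs
    · ring
    · simp
  simp only [e1]
  refine eLpNorm_le_of_pairing (B := (∫ t, ‖k t‖) * D) ?_ (fun x => ?_) (by positivity)
    fun h => ?_
  · have : StronglyMeasurable fun q : Space d × ℝ => k q.2 * W q.2 q.1 := by
      refine Measurable.stronglyMeasurable ?_
      exact (hkm.comp measurable_snd).mul hWm'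
    exact this.integral_prod_right.measurable
  · rw [← integral_mul_const]
    refine norm_integral_le_of_norm_le (hki.norm.mul_const _)
      (Filter.Eventually.of_forall fun t => ?_)
    rw [norm_mul]; exact mul_le_mul_of_nonneg_left (hWD _ _) (norm_nonneg _)
  · have main : ∀ h : 𝓢(Space d, ℂ), ‖∫ x, h x * ∫ t, k t * W t x‖ₑ ≤
        ENNReal.ofReal (A * C) * ((∫⁻ x, ‖g x‖ₑ ^ 2) + ∫⁻ x, ‖h x‖ₑ ^ 2) := by
      intro h
      set P : ℝ → ℂ := fun t => ∫ x, h x * W t x with hP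
      have hPm : Measurable P := by
        have : StronglyMeasurable fun q : ℝ × Space d => h q.2 * W q.1 q.2 := by
          refine Measurable.stronglyMeasurable ?_
          exact (h.continuous.measurable.comp measurable_snd).mul hWm
        exact this.integral_prod_right.measurable
      have hint : Integrable (fun q : Space d × ℝ => h q.1 * k q.2 * W q.2 q.1)
          (volume.prod volume) :=
        (h.integrable.mul_prod hki).mul_bdd hWm'.aestronglyMeasurable
          (Filter.Eventually.of_forall fun q => hWD _ _)
      have e2 : ∫ x, h x * ∫ t, k t * W t x = ∫ t, k t * P t := by
        calc _ = ∫ x, ∫ t, h x * k t * W t x := by simp only [← integral_const_mul, mul_assoc]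
          _ = ∫ t, ∫ x, h x * k t * W t x := integral_integral_swap hint
          _ = _ := by
            congr 1; ext t
            rw [hP, ← integral_const_mul]
            congr 1; ext x; ring
      rw [e2]
      set G := ∫⁻ x, ‖g x‖ₑ ^ 2
      set H := ∫⁻ x, ‖h x‖ₑ ^ 2
      have hFm : Measurable fun t => ‖P t‖ₑ := hPm.enorm
      calc ‖∫ t, k t * P t‖ₑ ≤ ∫⁻ t, ‖k t * P t‖ₑ := enorm_integral_le_lintegral_enorm _
        _ ≤ ∫⁻ t, I.indicator (fun t => ENNReal.ofReal A *
              (‖P t‖ₑ * ENNReal.ofReal (1 / t))) t := by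
            refine lintegral_mono fun t => ?_
            simp only [hk, indicator]
            split_ifs with ht
            · have ht0 : 0 < t := hb.trans ht.1
              rw [enorm_mul, mul_comm ‖P t‖ₑ, ← mul_assoc, ← ENNReal.ofReal_mul hA0]
              refine mul_le_mul_left ?_ _
              rw [← ofReal_norm]
              refine ENNReal.ofReal_le_ofReal ?_
              rw [norm_div, Complex.norm_real, Real.norm_of_nonneg ht0.le, mul_one_div]
              exact div_le_div_of_nonneg_right (hA t ht0) ht0.le
            · simp
        _ = ENNReal.ofReal A * ∫⁻ t in I, ‖P t‖ₑ * ENNReal.ofReal (1 / t) := by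
            rw [lintegral_indicator measurableSet_Ioc, lintegral_const_mul _ (by fun_prop)]
        _ = ENNReal.ofReal A * ∫⁻ t in Ioc b (2 * b), (∑ l ∈ Finset.range n, ‖P (2 ^ l * t)‖ₑ) *
              ENNReal.ofReal (1 / t) := by
            rw [lintegral_Ioc_dyadic hFm hb, ← lintegral_finsetSum _ fun l _ => by fun_prop]
            simp only [Finset.sum_mul]
        -- On this octave 1/t ≤ 1/b, and the octave has length b, so no logarithm of the truncation
        -- appears.
        _ ≤ ENNReal.ofReal A * ∫⁻ t in Ioc b (2 * b), ENNReal.ofReal C * (G + H) *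
              ENNReal.ofReal (1 / b) := by
            refine mul_le_mul_right (setLIntegral_mono' measurableSet_Ioc fun t ht => ?_) _
            have ht0 : 0 < t := hb.trans ht.1
            refine mul_le_mul' (hpairW h t ht0)
              (ENNReal.ofReal_le_ofReal (one_div_le_one_div_of_le hb ht.1.le))
        _ = _ := by
            rw [setLIntegral_const, Real.volume_Ioc, mul_assoc, mul_assoc,
              ← ENNReal.ofReal_mul (by positivity), ENNReal.ofReal_mul hA0,
              show 1 / b * (2 * b - b) = 1 by field_simp; ring, ENNReal.ofReal_one, mul_one]
            ring
    have main2 : ∀ h : 𝓢(Space d, ℂ), ‖∫ x, h x * ∫ t, k t * W t x‖ ≤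
        A * C * (‖g.toLp 2‖ ^ 2 + ‖h.toLp 2‖ ^ 2) := by
      intro h
      have := main h
      rw [lintegral_enorm_sq_eq, lintegral_enorm_sq_eq, ← ENNReal.ofReal_add (by positivity)
        (by positivity), ← ENNReal.ofReal_mul (by positivity), ← ofReal_norm] at this
      exact (ENNReal.ofReal_le_ofReal_iff (by positivity)).1 this
    refine (le_two_mul_of_forall_scale (C := A * C) (by positivity) (norm_nonneg (g.toLp 2))
      (norm_nonneg (h.toLp 2)) fun s hs => ?_).trans (le_of_eq (by ring))
    have e3 := main2 ((s : ℂ) • h)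
    have e4 : ((s : ℂ) • h).toLp 2 = (s : ℂ) • h.toLp 2 :=
      map_smul (SchwartzMap.toLpCLM ℂ ℂ 2 (volume : Measure (Space d))) (s : ℂ) h
    rw [e4, norm_smul, Complex.norm_real, Real.norm_of_nonneg hs.le, mul_pow] at e3
    refine le_trans (le_of_eq ?_) e3
    simp only [smul_apply, smul_eq_mul, mul_assoc]
    rw [integral_const_mul, norm_mul, Complex.norm_real, Real.norm_of_nonneg hs.le]

end

/-! ### Extension to a bounded operator of L² -/

section

variable {d : ℕ}

theorem isGivenBy_toTemperedDistribution {v : Lp ℂ 2 (volume : Measure (Space d))}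
    {u : Space d → ℂ} (hu : v =ᵐ[volume] u) : IsGivenBy (Lp.toTemperedDistribution v) u := by
  intro h
  have hae : (fun x => h x * v x) =ᵐ[volume] fun x => h x * u x := by
    filter_upwards [hu] with x hx
    rw [hx]
  refine ⟨?_, ?_⟩
  · refine Integrable.congr ?_ hae
    exact MemLp.integrable_mul (p := 2) (q := 2) (h.memLp 2 volume) (Lp.memLp v)
  · rw [← integral_congr_ae hae]
    exact Lp.toTemperedDistribution_apply (E := Space d) (F := ℂ) (μ := volume) (p := 2) v h

/-- The operator on Schwartz functions defined by a bounded operator of `L²`. -/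
theorem exists_distribution_of_clm
    (S : Lp ℂ 2 (volume : Measure (Space d)) →L[ℂ] Lp ℂ 2 (volume : Measure (Space d)))
    (U : 𝓢(Space d, ℂ) → Space d → ℂ) (hU : ∀ g : 𝓢(Space d, ℂ), S (g.toLp 2) =ᵐ[volume] U g) :
    ∃ V : 𝓢(Space d, ℂ) →L[ℂ] 𝓢'(Space d, ℂ), (∀ g, IsGivenBy (V g) (U g)) ∧ IsBoundedL2 V := by
  let V : 𝓢(Space d, ℂ) →L[ℂ] 𝓢'(Space d, ℂ) :=
    (Lp.toTemperedDistributionCLM ℂ (volume : Measure (Space d)) 2).comp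
      (S.comp (SchwartzMap.toLpCLM ℂ ℂ 2 volume))
  have hV : ∀ g : 𝓢(Space d, ℂ), V g = Lp.toTemperedDistribution (S (g.toLp 2)) := fun g => rfl
  refine ⟨V, fun g => ?_, S, hV⟩
  rw [hV]
  exact isGivenBy_toTemperedDistribution (hU g)

variable {ι : Type*} [Fintype ι] [DecidableEq ι]

theorem moll_add_right {κ f f' : Space d → ℂ} {B B' : ℝ} (hκ : Integrable κ)
    (hf : Measurable f) (hB : ∀ x, ‖f x‖ ≤ B) (hf' : Measurable f') (hB' : ∀ x, ‖f' x‖ ≤ B')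
    (t : ℝ) (x : Space d) :
    moll κ (fun y => f y + f' y) t x = moll κ f t x + moll κ f' t x := by
  simp only [moll, mul_add]
  exact integral_add (integrable_mul_bounded hκ hf hB t x)
    (integrable_mul_bounded hκ hf' hB' t x)

theorem moll_const_mul_right (κ f : Space d → ℂ) (a : ℂ) (t : ℝ) (x : Space d) :
    moll κ (fun y => a * f y) t x = a * moll κ f t x := by
  simp only [moll, ← integral_const_mul]
  congr 1; ext w; ring

theorem prod_moll_update (φ f : ι → Space d → ℂ) (p : ι) (g : Space d → ℂ) (t : ℝ)
    (y : ι → Space d) :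
    ∏ i, moll (φ i) (Function.update f p g i) t (y i) =
      moll (φ p) g t (y p) * ∏ i ∈ Finset.univ.erase p, moll (φ i) (f i) t (y i) := by
  rw [← Finset.mul_prod_erase _ _ (Finset.mem_univ p), Function.update_self]
  congr 1
  exact Finset.prod_congr rfl fun i hi => by
    rw [Function.update_of_ne (Finset.ne_of_mem_erase hi)]

theorem update_forall {ι : Type*} [DecidableEq ι] {f : ι → Space d → ℂ} {p : ι} {g : Space d → ℂ}
    {P : ι → (Space d → ℂ) → Prop} (hf : ∀ i, i ≠ p → P i (f i)) (hg : P p g) (i : ι) :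
    P i (Function.update f p g i) := by
  by_cases h : i = p
  · subst h; rwa [Function.update_self]
  · rw [Function.update_of_ne h]; exact hf i h

theorem exists_bound_update {ι : Type*} [DecidableEq ι] {f : ι → Space d → ℂ} {M : ι → ℝ} {p : ι}
    (hM : ∀ i, i ≠ p → ∀ x, ‖f i x‖ ≤ M i) (g : 𝓢(Space d, ℂ)) :
    ∃ B : ι → ℝ, ∀ i x, ‖Function.update f p g i x‖ ≤ B i := by
  obtain ⟨b, -, hb⟩ := g.decay 0 0
  have : ∀ i, ∃ B, ∀ x, ‖Function.update f p g i x‖ ≤ B := fun i =>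
    update_forall (P := fun _ f => ∃ B, ∀ x, ‖f x‖ ≤ B) (fun i hi => ⟨M i, hM i hi⟩)
      ⟨b, fun x => by simpa using hb x⟩ i
  exact ⟨fun i => (this i).choose, fun i => (this i).choose_spec⟩

section Linear

variable {Ψ : 𝓢(Space d, ℂ)} {φ : ι → 𝓢(Space d, ℂ)} {f : ι → Space d → ℂ} {M : ι → ℝ} {p : ι}
  {c : ι → ℝ}

theorem slice_update_add (hf : ∀ i, i ≠ p → Measurable (f i))
    (hM : ∀ i, i ≠ p → ∀ x, ‖f i x‖ ≤ M i) (g g' : 𝓢(Space d, ℂ)) (t : ℝ) (x : Space d) :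
    slice Ψ (fun i => φ i) c (Function.update f p (g + g' : 𝓢(Space d, ℂ))) t x =
      slice Ψ (fun i => φ i) c (Function.update f p g) t x +
      slice Ψ (fun i => φ i) c (Function.update f p g') t x := by
  have hint : ∀ g : 𝓢(Space d, ℂ), Integrable fun u => Ψ u *
      ∏ i, moll (φ i) (Function.update f p g i) t (x - (c i * t) • u) := fun g => by
    obtain ⟨B, hB⟩ := exists_bound_update hM g
    exact integrable_slice (φ := fun i => φ i) Ψ.integrable (fun i => (φ i).integrable)
      (fun i => (φ i).continuous.measurable)
      (update_forall (P := fun _ f => Measurable f) hf g.continuous.measurable) hB c t x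
  obtain ⟨b, -, hb⟩ := g.decay 0 0
  obtain ⟨b', -, hb'⟩ := g'.decay 0 0
  rw [slice, slice, slice, ← integral_add (hint g) (hint g')]
  congr 1; ext u
  simp only [prod_moll_update (fun i => φ i)]
  have := moll_add_right (φ p).integrable g.continuous.measurable (fun x => by simpa using hb x)
    g'.continuous.measurable (fun x => by simpa using hb' x) t (x - (c p * t) • u)
  have e : ((g + g' : 𝓢(Space d, ℂ)) : Space d → ℂ) = fun y => g y + g' y := rfl
  rw [e, this]; ring

theorem slice_update_smul (a : ℂ) (g : 𝓢(Space d, ℂ)) (t : ℝ) (x : Space d) :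
    slice Ψ (fun i => φ i) c (Function.update f p (a • g : 𝓢(Space d, ℂ))) t x =
      a * slice Ψ (fun i => φ i) c (Function.update f p g) t x := by
  rw [slice, slice, ← integral_const_mul]
  congr 1; ext u
  simp only [prod_moll_update (fun i => φ i)]
  have e : ((a • g : 𝓢(Space d, ℂ)) : Space d → ℂ) = fun y => a * g y := rfl
  rw [e, moll_const_mul_right]; ring

end Linear

/-- The average over all scales, as a function of the `p`-th entry, is bounded on `L²`. -/
theorem exists_clm_average (hd : 1 ≤ d) {Ψ : 𝓢(Space d, ℂ)} {φ : ι → 𝓢(Space d, ℂ)} (p : ι)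
    {a R : ℝ} (ha : 0 < a) (hΨ : ∀ ξ, ‖ξ‖ ≤ a → 𝓕 Ψ ξ = 0)
    (hR : ∀ i ξ, R < ‖ξ‖ → 𝓕 (φ i) ξ = 0) (c : ι → ℝ) {L : ℝ → ℂ} {A : ℝ} (hL : Measurable L)
    (hA : ∀ t > 0, ‖L t‖ ≤ A) {f : ι → Space d → ℂ} {M : ι → ℝ}
    (hf : ∀ i, i ≠ p → ContDiff ℝ ∞ (f i)) (hM : ∀ i, i ≠ p → ∀ x, ‖f i x‖ ≤ M i) :
    ∃ S : Lp ℂ 2 (volume : Measure (Space d)) →L[ℂ] Lp ℂ 2 (volume : Measure (Space d)),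
      ∀ g : 𝓢(Space d, ℂ), S (g.toLp 2) =ᵐ[volume] fun x => ∫ t in Ioi (0 : ℝ),
        L t * slice Ψ (fun i => φ i) c (Function.update f p g) t x / (t : ℂ) := by
  obtain ⟨C, hC, htr⟩ := exists_integral_truncation_le p ha hΨ hR c M hL hA
  set U : 𝓢(Space d, ℂ) → Space d → ℂ := fun g x => ∫ t in Ioi (0 : ℝ),
    L t * slice Ψ (fun i => φ i) c (Function.update f p g) t x / (t : ℂ) with hU
  have hcd : ∀ (g : 𝓢(Space d, ℂ)) (i : ι), ContDiff ℝ ∞ (Function.update f p g i) := fun g =>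
    update_forall (P := fun _ f => ContDiff ℝ ∞ f) hf (g.smooth ⊤)
  have hfm : ∀ i, i ≠ p → Measurable (f i) := fun i hi => (hf i hi).continuous.measurable
  have hm : ∀ (g : 𝓢(Space d, ℂ)) (i : ι), Measurable (Function.update f p g i) := fun g i =>
    (hcd g i).continuous.measurable
  have hΨ0 : 𝓕 Ψ 0 = 0 := hΨ 0 (by simpa using ha.le)
  have hint : ∀ (g : 𝓢(Space d, ℂ)) x, IntegrableOn (fun t => L t *
      slice Ψ (fun i => φ i) c (Function.update f p g) t x / (t : ℂ)) (Ioi 0) := fun g x => by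
    obtain ⟨B, hB⟩ := exists_bound_update hM g
    exact integrableOn_slice hd Ψ hΨ0 φ (hcd g) hB c (p := p)
      (by rw [Function.update_self]; exact g.integrable) hL hA x
  have hmeas : ∀ (g : 𝓢(Space d, ℂ)) (I : Set ℝ), StronglyMeasurable fun x =>
      ∫ t in I, L t * slice Ψ (fun i => φ i) c (Function.update f p g) t x / (t : ℂ) := by
    intro g I
    have : StronglyMeasurable fun q : Space d × ℝ => L q.2 *
        slice Ψ (fun i => φ i) c (Function.update f p g) q.2 q.1 / (q.2 : ℂ) := by
      refine Measurable.stronglyMeasurable ?_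
      have h1 := (measurable_slice Ψ.continuous.measurable
        (fun i => (φ i).continuous.measurable) (hm g) c).comp
          (f := fun q : Space d × ℝ => (q.2, q.1)) (measurable_snd.prodMk measurable_fst)
      exact ((hL.comp measurable_snd).mul h1).div
        (Complex.measurable_ofReal.comp measurable_snd)
    exact this.integral_prod_right
  have hbound : ∀ g, eLpNorm (U g) 2 volume ≤ ENNReal.ofReal (C * ‖g.toLp 2‖) := by
    intro g
    -- The interval from 2^{-N} to 2^N, written as 2N octaves above its left end.
    have hlim : ∀ x, Filter.Tendsto (fun N : ℕ => ∫ t in Ioc ((2 : ℝ)⁻¹ ^ N) (2 ^ (2 * N) * 2⁻¹ ^ N),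
        L t * slice Ψ (fun i => φ i) c (Function.update f p g) t x / (t : ℂ))
        Filter.atTop (nhds (U g x)) := by
      intro x
      have hun : ⋃ N : ℕ, Ioc ((2 : ℝ)⁻¹ ^ N) (2 ^ (2 * N) * 2⁻¹ ^ N) = Ioi 0 := by
        ext t
        simp only [mem_iUnion, mem_Ioc, mem_Ioi]
        refine ⟨fun ⟨N, h1, _⟩ => lt_trans (by positivity) h1, fun ht => ?_⟩
        obtain ⟨N1, h1⟩ := exists_pow_lt_of_lt_one ht (by norm_num : (2 : ℝ)⁻¹ < 1)
        obtain ⟨N2, h2⟩ := pow_unbounded_of_one_lt t (by norm_num : (1 : ℝ) < 2)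
        refine ⟨N1 + N2, ?_, ?_⟩
        · refine lt_of_le_of_lt ?_ h1
          exact pow_le_pow_of_le_one (by norm_num) (by norm_num) (Nat.le_add_right _ _)
        · rw [two_mul, pow_add, mul_assoc, ← mul_pow, mul_inv_cancel₀ two_ne_zero, one_pow,
            mul_one]
          exact h2.le.trans (pow_le_pow_right₀ (by norm_num) (Nat.le_add_left _ _))
      have hmono : Monotone fun N : ℕ => Ioc ((2 : ℝ)⁻¹ ^ N) (2 ^ (2 * N) * 2⁻¹ ^ N) := by
        intro N N' hN
        refine Ioc_subset_Ioc (pow_le_pow_of_le_one (by norm_num) (by norm_num) hN) ?_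
        simp only [two_mul, pow_add, ← mul_pow]
        exact pow_le_pow_right₀ (by norm_num) hN
      have := tendsto_setIntegral_of_monotone (μ := volume) (fun N => measurableSet_Ioc) hmono
        (f := fun t => L t * slice Ψ (fun i => φ i) c (Function.update f p g) t x / (t : ℂ))
        (by rw [hun]; exact hint g x)
      rwa [hun] at this
    -- Fatou's lemma: pointwise convergence of the truncations and their uniform bound suffice.
    refine (Lp.eLpNorm_lim_le_liminf_eLpNorm
      (fun N => (hmeas g _).aestronglyMeasurable) _ (Filter.Eventually.of_forall hlim)).trans ?_
    refine Filter.liminf_le_of_le (by isBoundedDefault) fun b hb => ?_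
    obtain ⟨N, hN⟩ := hb.exists
    exact hN.trans (htr _ g (hm g) (fun i hi x => by
      rw [Function.update_of_ne hi]; exact hM i hi x) (Function.update_self p _ f) _ _
      (by positivity))
  have hmem : ∀ g, MemLp (U g) 2 volume := fun g =>
    ⟨(hmeas g _).aestronglyMeasurable, (hbound g).trans_lt ENNReal.ofReal_lt_top⟩
  have hadd : ∀ g g', U (g + g') = U g + U g' := fun g g' => by
    ext x
    simp only [hU, Pi.add_apply]
    rw [← integral_add (hint g x) (hint g' x)]
    congr 1; ext t
    rw [slice_update_add hfm hM]; ring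
  have hsmul : ∀ (a : ℂ) g, U (a • g) = a • U g := fun a g => by
    ext x
    simp only [hU, Pi.smul_apply, smul_eq_mul]
    rw [← integral_const_mul]
    congr 1; ext t
    rw [slice_update_smul]; ring
  let T : 𝓢(Space d, ℂ) →ₗ[ℂ] Lp ℂ 2 (volume : Measure (Space d)) :=
    { toFun := fun g => (hmem g).toLp (U g)
      map_add' := fun g g' => by
        rw [← MemLp.toLp_add]
        exact MemLp.toLp_congr _ _ (by rw [hadd])
      map_smul' := fun a g => by
        rw [RingHom.id_apply, ← MemLp.toLp_const_smul]
        exact MemLp.toLp_congr _ _ (by rw [hsmul]) }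
  let e : 𝓢(Space d, ℂ) →ₗ[ℂ] Lp ℂ 2 (volume : Measure (Space d)) :=
    (SchwartzMap.toLpCLM ℂ ℂ 2 volume).toLinearMap
  have hdense : DenseRange e :=
    SchwartzMap.denseRange_toLpCLM (F := ℂ) (μ := (volume : Measure (Space d)))
      (p := 2) (by simp)
  have hTC : ∀ g, ‖T g‖ ≤ C * ‖e g‖ := fun g => by
    have e1 : ‖T g‖ = (eLpNorm (U g) 2 volume).toReal := Lp.norm_toLp _ (hmem g)
    rw [e1]
    exact ENNReal.toReal_le_of_le_ofReal (mul_nonneg hC (norm_nonneg _)) (hbound g)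
  refine ⟨T.extendOfNorm e, fun g => ?_⟩
  have : T.extendOfNorm e (g.toLp 2) = T g := LinearMap.extendOfNorm_eq hdense ⟨C, hTC⟩ g
  rw [this]
  exact (hmem g).coeFn_toLp

end

/-! ### Derivatives of averages and the integral over scales -/

section

variable {d : ℕ}

theorem exists_one_add_pow_mul_le {F : Type*} [NormedAddCommGroup F] [NormedSpace ℝ F]
    (κ : 𝓢(Space d, F)) (k : ℕ) : ∃ C, 0 ≤ C ∧ ∀ w, (1 + ‖w‖) ^ k * ‖κ w‖ ≤ C := by
  have h := fun w => SchwartzMap.one_add_le_sup_seminorm_apply (𝕜 := ℝ) (m := (k, 0)) le_rfl le_rfl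
    κ w
  simp only [norm_iteratedFDeriv_zero] at h
  exact ⟨_, le_trans (by positivity) (h 0), h⟩

theorem integrable_inv_one_add_pow : Integrable fun w : Space d => 1 / (1 + ‖w‖) ^ (d + 1) := by
  have := integrable_one_add_norm (E := Space d) (μ := volume) (r := (d + 1 : ℕ))
    (by rw [finrank_euclideanSpace, Fintype.card_fin]; exact_mod_cast Nat.lt_succ_self d)
  refine this.congr (Filter.Eventually.of_forall fun w => ?_)
  simp only
  rw [Real.rpow_neg (by positivity), Real.rpow_natCast, one_div]

/-- The derivative of an average of `f`. -/
def mollD (κ f : Space d → ℂ) (t : ℝ) (x : Space d) : Space d →L[ℝ] ℂ :=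
  t⁻¹ • ∫ w, f (x - t • w) • fderiv ℝ κ w

theorem integral_comp_inv_smul_sub {F : Type*} [NormedAddCommGroup F] [NormedSpace ℝ F]
    (G : Space d → F) {t : ℝ} (ht : 0 < t) (x : Space d) :
    ∫ w, G w = (1 / t ^ d) • ∫ y, G (t⁻¹ • (x - y)) := by
  rw [integral_sub_left_eq_self (fun y => G (t⁻¹ • y)) volume x,
    Measure.integral_comp_inv_smul volume G t, smul_smul]
  simp only [finrank_euclideanSpace, Fintype.card_fin]
  rw [abs_of_pos (by positivity), one_div, inv_mul_cancel₀ (by positivity), one_smul]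

theorem sub_smul_inv_smul_sub {t : ℝ} (ht : t ≠ 0) (x y : Space d) :
    x - t • t⁻¹ • (x - y) = y := by
  rw [smul_inv_smul₀ ht, sub_sub_cancel]

/-- The change of variables y = x − tw places x in the kernel, so f need only be bounded and
measurable. On the ball of radius t the rescaled argument moves by at most 1, which gives an
integrable majorant. -/
theorem hasFDerivAt_moll (κ : 𝓢(Space d, ℂ)) {f : Space d → ℂ} {M : ℝ} (hf : Measurable f)
    (hM : ∀ x, ‖f x‖ ≤ M) {t : ℝ} (ht : 0 < t) (x : Space d) :
    HasFDerivAt (moll κ f t) (mollD κ f t x) x := by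
  have hM0 : 0 ≤ M := (norm_nonneg _).trans (hM 0)
  obtain ⟨C, hC, hdec⟩ := exists_one_add_pow_mul_le (SchwartzMap.fderivCLM ℝ (Space d) ℂ κ) (d + 1)
  simp only [SchwartzMap.fderivCLM_apply] at hdec
  have e1 : moll κ f t = fun x => (1 / t ^ d) • ∫ y, κ (t⁻¹ • (x - y)) * f y := by
    ext x
    rw [moll, integral_comp_inv_smul_sub _ ht x]
    simp only [sub_smul_inv_smul_sub ht.ne']
  have e2 : mollD κ f t x =
      (1 / t ^ d) • ∫ y, f y • t⁻¹ • fderiv ℝ κ (t⁻¹ • (x - y)) := by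
    rw [mollD, integral_comp_inv_smul_sub _ ht x, smul_comm, ← integral_smul]
    simp only [sub_smul_inv_smul_sub ht.ne']
    congr 1; congr 1; ext1 y
    rw [smul_comm]
  rw [e1, e2]
  suffices h : HasFDerivAt (fun x => ∫ y, κ (t⁻¹ • (x - y)) * f y)
      (∫ y, f y • t⁻¹ • fderiv ℝ κ (t⁻¹ • (x - y))) x from h.const_smul (1 / t ^ d)
  have hκm := κ.continuous.measurable
  have hDm : Measurable fun w => fderiv ℝ κ w :=
    ((SchwartzMap.fderivCLM ℝ (Space d) ℂ κ).continuous).measurable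
  have hint : Integrable fun y => 1 / (1 + ‖t⁻¹ • (x - y)‖) ^ (d + 1) :=
    ((integrable_inv_one_add_pow (d := d)).comp_smul (inv_ne_zero ht.ne')).comp_sub_left x
  refine hasFDerivAt_integral_of_dominated_of_fderiv_le (s := Metric.ball x t)
    (F' := fun x y => f y • t⁻¹ • fderiv ℝ κ (t⁻¹ • (x - y)))
    (bound := fun y => M * t⁻¹ * (C * 2 ^ (d + 1)) * (1 / (1 + ‖t⁻¹ • (x - y)‖) ^ (d + 1)))
    (Metric.ball_mem_nhds x ht) (Filter.Eventually.of_forall fun x' => ?_) ?_ ?_ ?_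
    (hint.const_mul _) ?_
  · exact Measurable.aestronglyMeasurable (by fun_prop)
  · have h1 : Integrable fun y => κ (t⁻¹ • (x - y)) :=
      (κ.integrable.comp_smul (inv_ne_zero ht.ne')).comp_sub_left x
    exact h1.mul_bdd hf.aestronglyMeasurable (Filter.Eventually.of_forall hM)
  · have h1 : Measurable fun y => fderiv ℝ κ (t⁻¹ • (x - y)) := hDm.comp (by fun_prop)
    exact (hf.smul (h1.const_smul t⁻¹)).aestronglyMeasurable
  · refine Filter.Eventually.of_forall fun y x' hx' => ?_
    rw [norm_smul, norm_smul, Real.norm_of_nonneg (by positivity), ← mul_assoc, mul_assoc _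
      (C * 2 ^ (d + 1))]
    refine mul_le_mul (mul_le_mul_of_nonneg_right (hM y) (by positivity)) ?_ (norm_nonneg _)
      (by positivity)
    have h1 := hdec (t⁻¹ • (x' - y))
    have h2 : 1 + ‖t⁻¹ • (x - y)‖ ≤ 2 * (1 + ‖t⁻¹ • (x' - y)‖) := by
      have h3 : ‖t⁻¹ • (x - y)‖ ≤ ‖t⁻¹ • (x' - y)‖ + ‖t⁻¹ • (x - x')‖ := by
        rw [show t⁻¹ • (x - y) = t⁻¹ • (x' - y) + t⁻¹ • (x - x') by module]
        exact norm_add_le _ _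
      have h4 : ‖t⁻¹ • (x - x')‖ ≤ 1 := by
        rw [norm_smul, Real.norm_of_nonneg (by positivity), inv_mul_le_iff₀ ht, mul_one,
          ← dist_eq_norm, dist_comm]
        exact (Metric.mem_ball.1 hx').le
      linarith [norm_nonneg (t⁻¹ • (x' - y))]
    have h5 := pow_le_pow_left₀ (by positivity) h2 (d + 1)
    rw [mul_one_div, le_div_iff₀ (by positivity)]
    calc _ ≤ ‖fderiv ℝ κ (t⁻¹ • (x' - y))‖ * (2 * (1 + ‖t⁻¹ • (x' - y)‖)) ^ (d + 1) :=
          mul_le_mul_of_nonneg_left h5 (norm_nonneg _)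
      _ = ((1 + ‖t⁻¹ • (x' - y)‖) ^ (d + 1) * ‖fderiv ℝ κ (t⁻¹ • (x' - y))‖) * 2 ^ (d + 1) := by
          rw [mul_pow]; ring
      _ ≤ _ := mul_le_mul_of_nonneg_right h1 (by positivity)
  · refine Filter.Eventually.of_forall fun y x' _ => ?_
    have h1 : HasFDerivAt (fun x' : Space d => t⁻¹ • (x' - y))
        (t⁻¹ • ContinuousLinearMap.id ℝ (Space d)) x' :=
      ((hasFDerivAt_id x').sub_const y).const_smul t⁻¹
    have h2 := ((κ.differentiableAt (x := t⁻¹ • (x' - y))).hasFDerivAt.comp x' h1).mul_const (f y)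
    refine h2.congr_fderiv ?_
    ext v
    simp

theorem integrable_smul_fderiv (κ : 𝓢(Space d, ℂ)) {f : Space d → ℂ} {M : ℝ} (hf : Measurable f)
    (hM : ∀ x, ‖f x‖ ≤ M) (t : ℝ) (x : Space d) :
    Integrable fun w => f (x - t • w) • fderiv ℝ κ w := by
  have h1 : Integrable fun w => fderiv ℝ κ w :=
    (SchwartzMap.fderivCLM ℝ (Space d) ℂ κ).integrable (μ := volume)
  exact h1.bdd_smul M (hf.comp (by fun_prop)).aestronglyMeasurable
    (Filter.Eventually.of_forall fun w => hM _)

theorem mollD_apply (κ : 𝓢(Space d, ℂ)) {f : Space d → ℂ} {M : ℝ} (hf : Measurable f)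
    (hM : ∀ x, ‖f x‖ ≤ M) (t : ℝ) (x v : Space d) :
    mollD κ f t x v = (t⁻¹ : ℂ) * moll (∂_{v} κ : 𝓢(Space d, ℂ)) f t x := by
  rw [mollD, smul_apply, ContinuousLinearMap.integral_apply
    (integrable_smul_fderiv κ hf hM t x), Complex.real_smul, Complex.ofReal_inv]
  congr 1
  rw [moll]
  congr 1; ext w
  rw [SchwartzMap.lineDerivOp_apply_eq_fderiv, smul_apply, smul_eq_mul,
    mul_comm]

theorem norm_mollD_le (κ : 𝓢(Space d, ℂ)) {f : Space d → ℂ} {M : ℝ} (hM : ∀ x, ‖f x‖ ≤ M) {t : ℝ}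
    (ht : 0 < t) (x : Space d) :
    ‖mollD κ f t x‖ ≤ t⁻¹ * ((∫ w, ‖fderiv ℝ κ w‖) * M) := by
  rw [mollD, norm_smul, Real.norm_of_nonneg (by positivity)]
  refine mul_le_mul_of_nonneg_left ?_ (by positivity)
  rw [← integral_mul_const]
  have h1 : Integrable fun w => fderiv ℝ κ w :=
    (SchwartzMap.fderivCLM ℝ (Space d) ℂ κ).integrable (μ := volume)
  refine norm_integral_le_of_norm_le (h1.norm.mul_const _) (Filter.Eventually.of_forall fun w => ?_)
  rw [norm_smul, mul_comm]
  exact mul_le_mul_of_nonneg_left (hM _) (norm_nonneg _)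

theorem measurable_mollD (κ : 𝓢(Space d, ℂ)) {f : Space d → ℂ} (hf : Measurable f) :
    Measurable fun p : ℝ × Space d => mollD κ f p.1 p.2 := by
  have hDm : Measurable fun w => fderiv ℝ κ w :=
    ((SchwartzMap.fderivCLM ℝ (Space d) ℂ κ).continuous).measurable
  have : StronglyMeasurable fun q : (ℝ × Space d) × Space d =>
      f (q.1.2 - q.1.1 • q.2) • fderiv ℝ κ q.2 := by
    refine Measurable.stronglyMeasurable ?_
    exact (hf.comp (by fun_prop)).smul (hDm.comp measurable_snd)
  exact measurable_fst.inv.smul this.integral_prod_right.measurable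

theorem integral_Ioi_inv_add_pow {δ : ℝ} (hδ : 0 < δ) {k : ℕ} (hk : 1 ≤ k) :
    IntegrableOn (fun t : ℝ => 1 / (t + δ) ^ (k + 1)) (Ioi 0) ∧
      ∫ t in Ioi (0 : ℝ), 1 / (t + δ) ^ (k + 1) = 1 / (k * δ ^ k) := by
  have hk0 : (0 : ℝ) < k := by exact_mod_cast hk
  have hderiv : ∀ t ∈ Ici (0 : ℝ), HasDerivAt (fun t : ℝ => -(1 / (k * (t + δ) ^ k)))
      (1 / (t + δ) ^ (k + 1)) t := by
    intro t ht
    have ht0 : 0 < t + δ := by have : (0 : ℝ) ≤ t := ht; linarith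
    have h1 : HasDerivAt (fun t : ℝ => k * (t + δ) ^ k) (k * (k * (t + δ) ^ (k - 1) * 1)) t :=
      (((hasDerivAt_id t).add_const δ).pow k).const_mul (k : ℝ)
    have h2 := (h1.inv (by positivity)).neg
    simp only [one_div]
    refine h2.congr_deriv ?_
    obtain ⟨m, rfl⟩ : ∃ m, k = m + 1 := ⟨k - 1, by omega⟩
    simp only [Nat.add_sub_cancel]
    field_simp
    ring
  have hpos : ∀ t ∈ Ioi (0 : ℝ), 0 ≤ 1 / (t + δ) ^ (k + 1) := fun t ht => by
    have : (0 : ℝ) < t := ht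
    positivity
  have hlim : Filter.Tendsto (fun t : ℝ => -(1 / (k * (t + δ) ^ k))) Filter.atTop (nhds 0) := by
    rw [← neg_zero]
    refine Filter.Tendsto.neg ?_
    simp only [one_div]
    refine Filter.Tendsto.inv_tendsto_atTop (Filter.Tendsto.const_mul_atTop hk0 ?_)
    exact (Filter.tendsto_pow_atTop (by omega)).comp
      (Filter.tendsto_atTop_add_const_right _ δ Filter.tendsto_id)
  refine ⟨integrableOn_Ioi_deriv_of_nonneg' hderiv hpos hlim, ?_⟩
  rw [integral_Ioi_of_hasDerivAt_of_nonneg' hderiv hpos hlim]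
  simp

end

/-! ### The kernel: size estimates and formal derivatives -/

section

variable {d : ℕ}

/-- Decay of κ survives the shift by c u at the price of powers of 1 + |u|, which Ψ absorbs. The
division by 1 puts it in the shape of the hypothesis with dilation Λ = 1. -/
theorem exists_decay {F : Type*} [NormedAddCommGroup F] [NormedSpace ℝ F]
    (κ : 𝓢(Space d, F)) (c : ℝ) (k : ℕ) :
    ∃ E, 0 ≤ E ∧ ∀ w u, ‖κ (w - c • u)‖ * (1 + ‖w‖ / 1) ^ k ≤ E * (1 + ‖u‖) ^ k := by
  obtain ⟨C, hC, h⟩ := exists_one_add_pow_mul_le κ k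
  refine ⟨C * (1 + |c|) ^ k, by positivity, fun w u => ?_⟩
  have h1 : 1 + ‖w‖ / 1 ≤ (1 + ‖w - c • u‖) * ((1 + |c|) * (1 + ‖u‖)) := by
    have h2 : ‖w‖ ≤ ‖w - c • u‖ + |c| * ‖u‖ := by
      have := norm_add_le (w - c • u) (c • u)
      rwa [sub_add_cancel, norm_smul, Real.norm_eq_abs] at this
    have h3 : 1 + |c| * ‖u‖ ≤ (1 + |c|) * (1 + ‖u‖) := by
      nlinarith [norm_nonneg u, abs_nonneg c]
    have h4 := norm_nonneg (w - c • u)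
    have h5 : 0 ≤ |c| * ‖u‖ := by positivity
    rw [div_one]
    nlinarith
  have h6 := pow_le_pow_left₀ (by positivity) h1 k
  rw [mul_pow, mul_pow] at h6
  calc _ ≤ ‖κ (w - c • u)‖ * ((1 + ‖w - c • u‖) ^ k * ((1 + |c|) ^ k * (1 + ‖u‖) ^ k)) :=
        mul_le_mul_of_nonneg_left h6 (norm_nonneg _)
    _ = ((1 + ‖w - c • u‖) ^ k * ‖κ (w - c • u)‖) * ((1 + |c|) ^ k * (1 + ‖u‖) ^ k) := by ring
    _ ≤ C * ((1 + |c|) ^ k * (1 + ‖u‖) ^ k) := mul_le_mul_of_nonneg_right (h _) (by positivity)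
    _ = _ := by ring

/-- Since t(1 + t⁻¹D/Λ) = t + D/Λ ≥ t + δ, decay in the rescaled distance removes the singularity at
t = 0. -/
theorem div_pow_le_of_decay {a X t δ Λ D : ℝ} {k : ℕ} (ha : 0 ≤ a) (ht : 0 < t) (hδ : 0 < δ)
    (hD : δ ≤ D / Λ) (h : a * (1 + t⁻¹ * D / Λ) ^ k ≤ X) :
    a / t ^ k ≤ X * (1 / (t + δ) ^ k) := by
  rw [mul_one_div, div_le_div_iff₀ (by positivity) (by positivity)]
  have h1 : (t + δ) ^ k ≤ t ^ k * (1 + t⁻¹ * D / Λ) ^ k := by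
    rw [← mul_pow]
    refine pow_le_pow_left₀ (by positivity) ?_ k
    have : t * (1 + t⁻¹ * D / Λ) = t + D / Λ := by field_simp
    linarith
  calc a * (t + δ) ^ k ≤ a * (t ^ k * (1 + t⁻¹ * D / Λ) ^ k) := mul_le_mul_of_nonneg_left h1 ha
    _ = (a * (1 + t⁻¹ * D / Λ) ^ k) * t ^ k := by ring
    _ ≤ _ := mul_le_mul_of_nonneg_right h (by positivity)

variable {J : Type*} [Fintype J]

/-- The integrand of the kernels of the operator. -/
def kerIntegrand (Ψ : Space d → ℂ) (L : ℝ → ℂ) (f : J → Space d → ℂ) (c : J → ℝ) (c₀ : ℝ) (k : ℕ)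
    (φ : J → 𝓢(Space d, ℂ)) (κ : 𝓢(Space d, ℂ)) (x z : Space d) (q : ℝ × Space d) : ℂ :=
  L q.1 / (q.1 : ℂ) ^ k * Ψ q.2 * ((∏ j, moll (φ j) (f j) q.1 (x - (c j * q.1) • q.2)) *
    κ (q.1⁻¹ • (x - z) - c₀ • q.2))

/-- The measure `dt du` on `(0, ∞) × ℝ^d`. -/
def scaleMeasure (d : ℕ) : Measure (ℝ × Space d) := (volume.restrict (Ioi (0 : ℝ))).prod volume

/-- The kernels of the operator and of its derivatives. -/
def ker (Ψ : Space d → ℂ) (L : ℝ → ℂ) (f : J → Space d → ℂ) (c : J → ℝ) (c₀ : ℝ) (k : ℕ)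
    (φ : J → 𝓢(Space d, ℂ)) (κ : 𝓢(Space d, ℂ)) (x z : Space d) : ℂ :=
  ∫ q, kerIntegrand Ψ L f c c₀ k φ κ x z q ∂(scaleMeasure d)

theorem ae_scaleMeasure {P : ℝ × Space d → Prop} (h : ∀ t u, 0 < t → P (t, u)) :
    ∀ᵐ q ∂(scaleMeasure d), P q := by
  have h1 : ∀ᵐ t ∂(volume.restrict (Ioi (0 : ℝ))), 0 < t :=
    (ae_restrict_iff' measurableSet_Ioi).2 (Filter.Eventually.of_forall fun t ht => ht)
  have h2 : ∀ᵐ q ∂(scaleMeasure d), 0 < q.1 :=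
    (Measure.quasiMeasurePreserving_fst (μ := volume.restrict (Ioi (0 : ℝ)))
      (ν := (volume : Measure (Space d)))).ae h1
  filter_upwards [h2] with q hq
  exact h q.1 q.2 hq

section

variable {Ψ : 𝓢(Space d, ℂ)} {L : ℝ → ℂ} {f : J → Space d → ℂ} {c : J → ℝ} {c₀ A : ℝ}
  {M : J → ℝ} {k : ℕ} {φ : J → 𝓢(Space d, ℂ)} {κ : 𝓢(Space d, ℂ)} {x z : Space d}

theorem integrable_mul_one_add_pow (Ψ : 𝓢(Space d, ℂ)) (k : ℕ) :
    Integrable fun u => ‖Ψ u‖ * (1 + ‖u‖) ^ k := by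
  have h : Integrable fun u => 2 ^ (k - 1) * (‖u‖ ^ 0 * ‖Ψ u‖ + ‖u‖ ^ k * ‖Ψ u‖) :=
    ((Ψ.integrable_pow_mul volume 0).add (Ψ.integrable_pow_mul volume k)).const_mul _
  refine h.mono' (Ψ.continuous.norm.mul (by fun_prop)).aestronglyMeasurable
    (Filter.Eventually.of_forall fun u => ?_)
  rw [Real.norm_of_nonneg (by positivity)]
  have := add_pow_le (zero_le_one (α := ℝ)) (norm_nonneg u) k
  calc ‖Ψ u‖ * (1 + ‖u‖) ^ k ≤ ‖Ψ u‖ * (2 ^ (k - 1) * (1 ^ k + ‖u‖ ^ k)) :=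
        mul_le_mul_of_nonneg_left this (norm_nonneg _)
    _ = _ := by rw [one_pow, pow_zero]; ring

theorem integrable_majorant (Ψ : 𝓢(Space d, ℂ)) {δ : ℝ} (hδ : 0 < δ) (hk : 1 ≤ k) (l : ℕ) :
    Integrable (fun q : ℝ × Space d => 1 / (q.1 + δ) ^ (k + 1) * (‖Ψ q.2‖ * (1 + ‖q.2‖) ^ l))
      (scaleMeasure d) :=
  (integral_Ioi_inv_add_pow hδ hk).1.mul_prod (integrable_mul_one_add_pow Ψ l)

theorem integral_majorant (Ψ : 𝓢(Space d, ℂ)) {δ : ℝ} (hδ : 0 < δ) (hk : 1 ≤ k) (l : ℕ) :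
    ∫ q : ℝ × Space d, 1 / (q.1 + δ) ^ (k + 1) * (‖Ψ q.2‖ * (1 + ‖q.2‖) ^ l)
      ∂(scaleMeasure d) = 1 / (k * δ ^ k) * ∫ u, ‖Ψ u‖ * (1 + ‖u‖) ^ l := by
  rw [← (integral_Ioi_inv_add_pow hδ hk).2]
  exact integral_prod_mul (μ := volume.restrict (Ioi (0 : ℝ))) (ν := volume)
    (fun t : ℝ => 1 / (t + δ) ^ (k + 1)) (fun u : Space d => ‖Ψ u‖ * (1 + ‖u‖) ^ l)

theorem measurable_prod_moll {J : Type*} {f : J → Space d → ℂ} {c : J → ℝ}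
    {φ : J → 𝓢(Space d, ℂ)} (hf : ∀ j, Measurable (f j)) (s : Finset J) (x : Space d) :
    Measurable fun q : ℝ × Space d => ∏ j ∈ s, moll (φ j) (f j) q.1 (x - (c j * q.1) • q.2) :=
  Finset.measurable_fun_prod _ fun j _ =>
    (measurable_moll (φ j).continuous.measurable (hf j)).comp
      (g := fun p : ℝ × Space d => moll (φ j) (f j) p.1 p.2)
      (f := fun q : ℝ × Space d => (q.1, x - (c j * q.1) • q.2)) (by fun_prop)

theorem measurable_kerIntegrand (hL : Measurable L) (hf : ∀ j, Measurable (f j)) (x z : Space d) :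
    Measurable (kerIntegrand Ψ L f c c₀ k φ κ x z) := by
  have h1 := measurable_prod_moll (φ := φ) (c := c) hf Finset.univ x
  have hκ := κ.continuous.measurable
  have hΨ := Ψ.continuous.measurable
  unfold kerIntegrand
  fun_prop

theorem norm_kerIntegrand_le (hA : ∀ t > 0, ‖L t‖ ≤ A) (hM : ∀ j x, ‖f j x‖ ≤ M j) {E Λ δ : ℝ}
    (hE : ∀ w u, ‖κ (w - c₀ • u)‖ * (1 + ‖w‖ / Λ) ^ k ≤ E * (1 + ‖u‖) ^ k) (hδ : 0 < δ)
    (hxz : δ ≤ ‖x - z‖ / Λ) {t : ℝ} (ht : 0 < t) (u : Space d) :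
    ‖kerIntegrand Ψ L f c c₀ k φ κ x z (t, u)‖ ≤ A * (∏ j, (∫ w, ‖φ j w‖) * M j) * E *
      (1 / (t + δ) ^ k * (‖Ψ u‖ * (1 + ‖u‖) ^ k)) := by
  have hA0 : 0 ≤ A := (norm_nonneg _).trans (hA t ht)
  have h1 := div_pow_le_of_decay (norm_nonneg _) ht hδ hxz (a := ‖κ (t⁻¹ • (x - z) - c₀ • u)‖)
    (k := k) (X := E * (1 + ‖u‖) ^ k) (by
      have := hE (t⁻¹ • (x - z)) u
      rwa [norm_smul, Real.norm_of_nonneg (by positivity)] at this)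
  have h2 : ‖∏ j, moll (φ j) (f j) t (x - (c j * t) • u)‖ ≤ ∏ j, (∫ w, ‖φ j w‖) * M j := by
    rw [norm_prod]
    exact Finset.prod_le_prod (fun _ _ => norm_nonneg _) fun j _ =>
      norm_moll_le (φ j).integrable (hM j) _ _
  simp only [kerIntegrand, norm_mul, norm_div, norm_pow, Complex.norm_real,
    Real.norm_of_nonneg ht.le]
  calc _ = ‖L t‖ * ‖∏ j, moll (φ j) (f j) t (x - (c j * t) • u)‖ *
        (‖κ (t⁻¹ • (x - z) - c₀ • u)‖ / t ^ k) * ‖Ψ u‖ := by ring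
    _ ≤ A * (∏ j, (∫ w, ‖φ j w‖) * M j) * (E * (1 + ‖u‖) ^ k * (1 / (t + δ) ^ k)) * ‖Ψ u‖ := by
        refine mul_le_mul_of_nonneg_right ?_ (norm_nonneg _)
        have h3 := (norm_nonneg _).trans h2
        exact mul_le_mul (mul_le_mul (hA t ht) h2 (norm_nonneg _) hA0) h1 (by positivity)
          (by positivity)
    _ = _ := by ring

theorem integrable_kerIntegrand (hL : Measurable L) (hA : ∀ t > 0, ‖L t‖ ≤ A)
    (hf : ∀ j, Measurable (f j)) (hM : ∀ j x, ‖f j x‖ ≤ M j) (hk : 1 ≤ k) (hxz : x ≠ z) :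
    Integrable (kerIntegrand Ψ L f c c₀ (k + 1) φ κ x z) (scaleMeasure d) := by
  obtain ⟨E, -, hE⟩ := exists_decay κ c₀ (k + 1)
  have hδ : 0 < ‖x - z‖ := norm_pos_iff.2 (sub_ne_zero.2 hxz)
  refine ((integrable_majorant Ψ hδ hk (k + 1)).const_mul
    (A * (∏ j, (∫ w, ‖φ j w‖) * M j) * E)).mono'
    (measurable_kerIntegrand hL hf x z).aestronglyMeasurable (ae_scaleMeasure fun t u ht => ?_)
  exact norm_kerIntegrand_le hA hM hE hδ (by rw [div_one]) ht u

/-- Integration in t lowers the exponent by one: a kernel with t^{-(k+1)} has size δ^{-k}. The bound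
sees f only through M, φ through L¹ norms and κ through E; this is the source of the uniformity. -/
theorem norm_ker_le (hA : ∀ t > 0, ‖L t‖ ≤ A) (hM : ∀ j x, ‖f j x‖ ≤ M j) {E Λ δ : ℝ}
    (hE : ∀ w u, ‖κ (w - c₀ • u)‖ * (1 + ‖w‖ / Λ) ^ (k + 1) ≤ E * (1 + ‖u‖) ^ (k + 1))
    (hk : 1 ≤ k) (hδ : 0 < δ) (hxz : δ ≤ ‖x - z‖ / Λ) :
    ‖ker Ψ L f c c₀ (k + 1) φ κ x z‖ ≤ A * (∏ j, (∫ w, ‖φ j w‖) * M j) * E *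
      (1 / (k * δ ^ k) * ∫ u, ‖Ψ u‖ * (1 + ‖u‖) ^ (k + 1)) := by
  rw [← integral_majorant Ψ hδ hk, ← integral_const_mul]
  exact norm_integral_le_of_norm_le ((integrable_majorant Ψ hδ hk (k + 1)).const_mul _)
    (ae_scaleMeasure fun t u ht => norm_kerIntegrand_le hA hM hE hδ hxz ht u)

variable [DecidableEq J]

/-- The derivative of `kerIntegrand` in `(x, z)`. -/
def kerIntegrandD (Ψ : Space d → ℂ) (L : ℝ → ℂ) (f : J → Space d → ℂ) (c : J → ℝ) (c₀ : ℝ) (k : ℕ)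
    (φ : J → 𝓢(Space d, ℂ)) (κ : 𝓢(Space d, ℂ)) (x z : Space d) (q : ℝ × Space d) :
    Space d × Space d →L[ℝ] ℂ :=
  (L q.1 / (q.1 : ℂ) ^ k * Ψ q.2) •
    ((∏ j, moll (φ j) (f j) q.1 (x - (c j * q.1) • q.2)) • (q.1⁻¹ •
        (fderiv ℝ κ (q.1⁻¹ • (x - z) - c₀ • q.2)).comp
          (ContinuousLinearMap.fst ℝ _ _ - ContinuousLinearMap.snd ℝ _ _)) +
      κ (q.1⁻¹ • (x - z) - c₀ • q.2) • ∑ j,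
        (∏ i ∈ Finset.univ.erase j, moll (φ i) (f i) q.1 (x - (c i * q.1) • q.2)) •
          (mollD (φ j) (f j) q.1 (x - (c j * q.1) • q.2)).comp (ContinuousLinearMap.fst ℝ _ _))

theorem hasFDerivAt_kerIntegrand (hf : ∀ j, Measurable (f j)) (hM : ∀ j x, ‖f j x‖ ≤ M j)
    (p : Space d × Space d) {t : ℝ} (ht : 0 < t) (u : Space d) :
    HasFDerivAt (fun p : Space d × Space d => kerIntegrand Ψ L f c c₀ k φ κ p.1 p.2 (t, u))
      (kerIntegrandD Ψ L f c c₀ k φ κ p.1 p.2 (t, u)) p := by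
  have h1 : ∀ j, HasFDerivAt (fun p : Space d × Space d => moll (φ j) (f j) t
      (p.1 - (c j * t) • u)) ((mollD (φ j) (f j) t (p.1 - (c j * t) • u)).comp
        (ContinuousLinearMap.fst ℝ _ _)) p := fun j =>
    (hasFDerivAt_moll (φ j) (hf j) (hM j) ht _).comp p (hasFDerivAt_fst.sub_const _)
  have h2 := HasFDerivAt.finsetProd (u := Finset.univ) fun j _ => h1 j
  have h3 : HasFDerivAt (fun p : Space d × Space d => t⁻¹ • (p.1 - p.2) - c₀ • u)
      (t⁻¹ • (ContinuousLinearMap.fst ℝ (Space d) (Space d) -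
        ContinuousLinearMap.snd ℝ (Space d) (Space d))) p :=
    ((hasFDerivAt_fst.sub hasFDerivAt_snd).const_smul t⁻¹).sub_const _
  have h4 := (κ.differentiableAt (x := t⁻¹ • (p.1 - p.2) - c₀ • u)).hasFDerivAt.comp p h3
  have h5 := (h2.mul h4).const_mul (L t / (t : ℂ) ^ k * Ψ u)
  refine h5.congr_fderiv ?_
  simp only [kerIntegrandD, ContinuousLinearMap.comp_smul]
  rfl

/-- By Leibniz, each term is again a kernel integrand with one more factor 1/t and one Schwartz
kernel differentiated. The last kernel depends on x − z, hence the direction v.1 − v.2; the other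
factors depend on x alone. -/
theorem kerIntegrandD_apply (hf : ∀ j, Measurable (f j)) (hM : ∀ j x, ‖f j x‖ ≤ M j) {t : ℝ}
    (u : Space d) (v : Space d × Space d) :
    kerIntegrandD Ψ L f c c₀ k φ κ x z (t, u) v =
      kerIntegrand Ψ L f c c₀ (k + 1) φ (∂_{v.1 - v.2} κ : 𝓢(Space d, ℂ)) x z (t, u) +
      ∑ j, kerIntegrand Ψ L f c c₀ (k + 1)
        (Function.update φ j (∂_{v.1} (φ j) : 𝓢(Space d, ℂ))) κ x z (t, u) := by
  have hprod : ∀ j, (∏ i, moll (Function.update φ j (∂_{v.1} (φ j) : 𝓢(Space d, ℂ)) i) (f i) t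
      (x - (c i * t) • u)) = moll (∂_{v.1} (φ j) : 𝓢(Space d, ℂ)) (f j) t (x - (c j * t) • u) *
      ∏ i ∈ Finset.univ.erase j, moll (φ i) (f i) t (x - (c i * t) • u) := by
    intro j
    rw [← Finset.mul_prod_erase _ _ (Finset.mem_univ j), Function.update_self]
    congr 1
    exact Finset.prod_congr rfl fun i hi => by
      rw [Function.update_of_ne (Finset.ne_of_mem_erase hi)]
  simp only [kerIntegrandD, kerIntegrand, hprod, add_apply,
    FunLike.coe_smul, Pi.smul_apply, sum_apply,
    ContinuousLinearMap.comp_apply, sub_apply, ContinuousLinearMap.coe_fst',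
    ContinuousLinearMap.coe_snd', mollD_apply _ (hf _) (hM _), smul_eq_mul, Complex.real_smul,
    SchwartzMap.lineDerivOp_apply_eq_fderiv, Finset.mul_sum, mul_add, pow_succ, div_eq_mul_inv,
    mul_inv, Complex.ofReal_inv]
  congr 1
  · ring
  · exact Finset.sum_congr rfl fun j _ => by ring

end

end

/-! ### Differentiation of the kernel under the integral sign -/

section

variable {d : ℕ} {J : Type*} [Fintype J] [DecidableEq J]
  {Ψ : 𝓢(Space d, ℂ)} {L : ℝ → ℂ} {f : J → Space d → ℂ} {c : J → ℝ} {c₀ A : ℝ}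
  {M : J → ℝ} {k : ℕ} {φ : J → 𝓢(Space d, ℂ)} {κ : 𝓢(Space d, ℂ)} {x z : Space d}

theorem measurable_kerIntegrandD (hL : Measurable L) (hf : ∀ j, Measurable (f j))
    (x z : Space d) : Measurable (kerIntegrandD Ψ L f c c₀ k φ κ x z) := by
  have h1 := fun s : Finset J => measurable_prod_moll (φ := φ) (c := c) hf s x
  have hκ := κ.continuous.measurable
  have hΨ := Ψ.continuous.measurable
  have hD : Measurable fun q : ℝ × Space d => fderiv ℝ κ (q.1⁻¹ • (x - z) - c₀ • q.2) :=
    ((SchwartzMap.fderivCLM ℝ (Space d) ℂ κ).continuous).measurable.comp (by fun_prop)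
  have hcomp : ∀ B : Space d × Space d →L[ℝ] Space d,
      Measurable fun T : Space d →L[ℝ] ℂ => T.comp B := fun B =>
    (continuous_id.clm_comp continuous_const).measurable
  have hmD : ∀ j, Measurable fun q : ℝ × Space d =>
      mollD (φ j) (f j) q.1 (x - (c j * q.1) • q.2) := fun j =>
    (measurable_mollD (φ j) (hf j)).comp
      (g := fun p : ℝ × Space d => mollD (φ j) (f j) p.1 p.2)
      (f := fun q : ℝ × Space d => (q.1, x - (c j * q.1) • q.2)) (by fun_prop)
  unfold kerIntegrandD
  have hc1 : Measurable fun q : ℝ × Space d => L q.1 / (q.1 : ℂ) ^ k * Ψ q.2 := by fun_prop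
  have hc2 : Measurable fun q : ℝ × Space d => κ (q.1⁻¹ • (x - z) - c₀ • q.2) := by fun_prop
  refine hc1.smul (Measurable.add ?_ ?_)
  · exact (h1 Finset.univ).smul (measurable_fst.inv.smul ((hcomp _).comp hD))
  · refine hc2.smul (Finset.measurable_fun_sum _ fun j _ => ?_)
    exact (h1 _).smul ((hcomp _).comp (hmD j))

theorem exists_norm_kerIntegrandD_le (Ψ : 𝓢(Space d, ℂ)) (c : J → ℝ) (c₀ : ℝ) (k : ℕ)
    (φ : J → 𝓢(Space d, ℂ)) (κ : 𝓢(Space d, ℂ)) (hA : ∀ t > 0, ‖L t‖ ≤ A)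
    (hM : ∀ j x, ‖f j x‖ ≤ M j) :
    ∃ K, ∀ (x z : Space d) (δ : ℝ), 0 < δ → δ ≤ ‖x - z‖ → ∀ (t : ℝ) (u : Space d), 0 < t →
      ‖kerIntegrandD Ψ L f c c₀ k φ κ x z (t, u)‖ ≤
        K * (1 / (t + δ) ^ (k + 1) * (‖Ψ u‖ * (1 + ‖u‖) ^ (k + 1))) := by
  obtain ⟨E1, hE10, hE1⟩ := exists_decay (SchwartzMap.fderivCLM ℝ (Space d) ℂ κ) c₀ (k + 1)
  obtain ⟨E2, hE20, hE2⟩ := exists_decay κ c₀ (k + 1)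
  simp only [SchwartzMap.fderivCLM_apply] at hE1
  set P := ∏ j, (∫ w, ‖φ j w‖) * M j with hP
  set S := ∑ j, (∏ i ∈ Finset.univ.erase j, (∫ w, ‖φ i w‖) * M i) *
    ((∫ w, ‖fderiv ℝ (φ j) w‖) * M j) with hS
  refine ⟨A * (2 * P * E1 + S * E2), fun x z δ hδ hxz t u ht => ?_⟩
  have hA0 : 0 ≤ A := (norm_nonneg _).trans (hA t ht)
  have hM0 : ∀ j, 0 ≤ M j := fun j => (norm_nonneg _).trans (hM j 0)
  have hP0 : 0 ≤ P := Finset.prod_nonneg fun j _ =>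
    mul_nonneg (integral_nonneg fun _ => norm_nonneg _) (hM0 j)
  have hS0 : 0 ≤ S := Finset.sum_nonneg fun j _ => mul_nonneg (Finset.prod_nonneg fun j _ =>
    mul_nonneg (integral_nonneg fun _ => norm_nonneg _) (hM0 j))
    (mul_nonneg (integral_nonneg fun _ => norm_nonneg _) (hM0 j))
  set F := fderiv ℝ κ (t⁻¹ • (x - z) - c₀ • u) with hF
  have d1 : ‖F‖ / t ^ (k + 1) ≤ E1 * (1 + ‖u‖) ^ (k + 1) * (1 / (t + δ) ^ (k + 1)) :=
    div_pow_le_of_decay (D := ‖x - z‖) (Λ := 1) (norm_nonneg _) ht hδ (by rwa [div_one]) (by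
      have := hE1 (t⁻¹ • (x - z)) u
      rwa [norm_smul, Real.norm_of_nonneg (by positivity)] at this)
  have d2 : ‖κ (t⁻¹ • (x - z) - c₀ • u)‖ / t ^ (k + 1) ≤
      E2 * (1 + ‖u‖) ^ (k + 1) * (1 / (t + δ) ^ (k + 1)) :=
    div_pow_le_of_decay (D := ‖x - z‖) (Λ := 1) (norm_nonneg _) ht hδ (by rwa [div_one]) (by
      have := hE2 (t⁻¹ • (x - z)) u
      rwa [norm_smul, Real.norm_of_nonneg (by positivity)] at this)
  have hprod : ∀ s : Finset J, ‖∏ j ∈ s, moll (φ j) (f j) t (x - (c j * t) • u)‖ ≤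
      ∏ j ∈ s, (∫ w, ‖φ j w‖) * M j := fun s => by
    rw [norm_prod]
    exact Finset.prod_le_prod (fun _ _ => norm_nonneg _) fun j _ =>
      norm_moll_le (φ j).integrable (hM j) _ _
  have hfst : ‖ContinuousLinearMap.fst ℝ (Space d) (Space d)‖ ≤ 1 :=
    ContinuousLinearMap.norm_fst_le ..
  have hsnd : ‖ContinuousLinearMap.snd ℝ (Space d) (Space d)‖ ≤ 1 :=
    ContinuousLinearMap.norm_snd_le ..
  have n1 : ‖(∏ j, moll (φ j) (f j) t (x - (c j * t) • u)) • (t⁻¹ • F.comp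
      (ContinuousLinearMap.fst ℝ (Space d) (Space d) -
        ContinuousLinearMap.snd ℝ (Space d) (Space d)))‖ ≤ P * (t⁻¹ * (‖F‖ * 2)) := by
    rw [norm_smul, norm_smul, Real.norm_of_nonneg (by positivity)]
    refine mul_le_mul (hprod _) (mul_le_mul_of_nonneg_left ?_ (by positivity)) (by positivity) hP0
    refine (ContinuousLinearMap.opNorm_comp_le _ _).trans
      (mul_le_mul_of_nonneg_left ?_ (norm_nonneg _))
    exact (norm_sub_le _ _).trans (by linarith)
  have n2 : ‖∑ j, (∏ i ∈ Finset.univ.erase j, moll (φ i) (f i) t (x - (c i * t) • u)) •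
      (mollD (φ j) (f j) t (x - (c j * t) • u)).comp
        (ContinuousLinearMap.fst ℝ (Space d) (Space d))‖ ≤ t⁻¹ * S := by
    refine (norm_sum_le _ _).trans ?_
    rw [hS, Finset.mul_sum]
    refine Finset.sum_le_sum fun j _ => ?_
    rw [norm_smul]
    have h1 := norm_mollD_le (φ j) (hM j) ht (x - (c j * t) • u)
    have h2 : ‖(mollD (φ j) (f j) t (x - (c j * t) • u)).comp
        (ContinuousLinearMap.fst ℝ (Space d) (Space d))‖ ≤
        t⁻¹ * ((∫ w, ‖fderiv ℝ (φ j) w‖) * M j) := by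
      refine (ContinuousLinearMap.opNorm_comp_le _ _).trans ?_
      exact (mul_le_of_le_one_right (norm_nonneg _) hfst).trans h1
    refine (mul_le_mul (hprod _) h2 (norm_nonneg _) ((norm_nonneg _).trans (hprod _))).trans
      (le_of_eq (by ring))
  rw [kerIntegrandD, norm_smul, norm_mul, norm_div, norm_pow, Complex.norm_real,
    Real.norm_of_nonneg ht.le]
  calc _ ≤ A / t ^ k * ‖Ψ u‖ * (P * (t⁻¹ * (‖F‖ * 2)) +
        ‖κ (t⁻¹ • (x - z) - c₀ • u)‖ * (t⁻¹ * S)) := by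
        refine mul_le_mul ?_ ((norm_add_le _ _).trans (add_le_add n1 ?_)) (norm_nonneg _)
          (by positivity)
        · exact mul_le_mul_of_nonneg_right (div_le_div_of_nonneg_right (hA t ht) (by positivity))
            (norm_nonneg _)
        · rw [norm_smul]; exact mul_le_mul_of_nonneg_left n2 (norm_nonneg _)
    _ = A * ‖Ψ u‖ * (2 * P * (‖F‖ / t ^ (k + 1)) +
        S * (‖κ (t⁻¹ • (x - z) - c₀ • u)‖ / t ^ (k + 1))) := by
        simp only [pow_succ, div_eq_mul_inv, mul_inv]; ring
    _ ≤ A * ‖Ψ u‖ * (2 * P * (E1 * (1 + ‖u‖) ^ (k + 1) * (1 / (t + δ) ^ (k + 1))) +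
        S * (E2 * (1 + ‖u‖) ^ (k + 1) * (1 / (t + δ) ^ (k + 1)))) := by
        gcongr
    _ = _ := by ring

theorem hasFDerivAt_ker (hL : Measurable L) (hA : ∀ t > 0, ‖L t‖ ≤ A)
    (hf : ∀ j, Measurable (f j)) (hM : ∀ j x, ‖f j x‖ ≤ M j) (hk : 1 ≤ k) (hxz : x ≠ z) :
    HasFDerivAt (fun p : Space d × Space d => ker Ψ L f c c₀ (k + 1) φ κ p.1 p.2)
      (∫ q, kerIntegrandD Ψ L f c c₀ (k + 1) φ κ x z q ∂(scaleMeasure d)) (x, z) ∧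
    Integrable (kerIntegrandD Ψ L f c c₀ (k + 1) φ κ x z) (scaleMeasure d) := by
  obtain ⟨K, hK⟩ := exists_norm_kerIntegrandD_le Ψ c c₀ (k + 1) φ κ hA hM
  have hD : 0 < ‖x - z‖ := norm_pos_iff.2 (sub_ne_zero.2 hxz)
  have hδ : 0 < ‖x - z‖ / 2 := half_pos hD
  have hint := (integrable_majorant (k := k + 1) Ψ hδ (by omega) (k + 1 + 1)).const_mul K
  -- Each variable moves by less than a quarter of the distance, so one majorant with δ = ‖x − z‖/2
  -- serves the whole ball.
  have hball : ∀ p ∈ Metric.ball (x, z) (‖x - z‖ / 4), ‖x - z‖ / 2 ≤ ‖p.1 - p.2‖ := by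
    intro p hp
    rw [Metric.mem_ball, dist_comm, Prod.dist_eq, max_lt_iff, dist_eq_norm, dist_eq_norm] at hp
    have h1 : ‖x - z‖ ≤ ‖p.1 - p.2‖ + ‖x - p.1‖ + ‖z - p.2‖ := by
      have e : x - z = (p.1 - p.2) + (x - p.1) - (z - p.2) := by abel
      calc ‖x - z‖ = ‖(p.1 - p.2) + (x - p.1) - (z - p.2)‖ := by rw [← e]
        _ ≤ _ := (norm_sub_le _ _).trans (add_le_add_left (norm_add_le _ _) _)
    linarith [hp.1, hp.2]
  set F : Space d × Space d → ℝ × Space d → ℂ := fun p q =>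
    kerIntegrand Ψ L f c c₀ (k + 1) φ κ p.1 p.2 q with hF
  set F' : Space d × Space d → ℝ × Space d → (Space d × Space d →L[ℝ] ℂ) := fun p q =>
    kerIntegrandD Ψ L f c c₀ (k + 1) φ κ p.1 p.2 q with hF'
  have hFm : ∀ p, AEStronglyMeasurable (F p) (scaleMeasure d) := fun p =>
    (measurable_kerIntegrand hL hf p.1 p.2).aestronglyMeasurable
  have hFi : Integrable (F (x, z)) (scaleMeasure d) := integrable_kerIntegrand hL hA hf hM hk hxz
  have hF'm : AEStronglyMeasurable (F' (x, z)) (scaleMeasure d) :=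
    (measurable_kerIntegrandD hL hf x z).aestronglyMeasurable
  have hb : ∀ᵐ q ∂(scaleMeasure d), ∀ p ∈ Metric.ball (x, z) (‖x - z‖ / 4), ‖F' p q‖ ≤
      K * (1 / (q.1 + ‖x - z‖ / 2) ^ (k + 1 + 1) * (‖Ψ q.2‖ * (1 + ‖q.2‖) ^ (k + 1 + 1))) :=
    ae_scaleMeasure fun t u ht p hp => hK p.1 p.2 _ hδ (hball p hp) t u ht
  have hd : ∀ᵐ q ∂(scaleMeasure d), ∀ p ∈ Metric.ball (x, z) (‖x - z‖ / 4),
      HasFDerivAt (fun p => F p q) (F' p q) p :=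
    ae_scaleMeasure fun t u ht p _ => hasFDerivAt_kerIntegrand hf hM p ht u
  have hball0 : Metric.ball (x, z) (‖x - z‖ / 4) ∈ nhds (x, z) :=
    Metric.ball_mem_nhds (x, z) (by positivity)
  have hi' : Integrable (F' (x, z)) (scaleMeasure d) :=
    hint.mono' hF'm (ae_scaleMeasure fun t u ht => hK x z _ hδ (by linarith) t u ht)
  refine ⟨?_, hi'⟩
  have key := hasFDerivAt_integral_of_dominated_of_fderiv_le hball0
    (Filter.Eventually.of_forall hFm) hFi hF'm hb hint hd
  exact key

theorem fderiv_ker_apply (hL : Measurable L) (hA : ∀ t > 0, ‖L t‖ ≤ A)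
    (hf : ∀ j, Measurable (f j)) (hM : ∀ j x, ‖f j x‖ ≤ M j) (hk : 1 ≤ k) (hxz : x ≠ z)
    (v : Space d × Space d) :
    fderiv ℝ (fun p : Space d × Space d => ker Ψ L f c c₀ (k + 1) φ κ p.1 p.2) (x, z) v =
      ker Ψ L f c c₀ (k + 2) φ (∂_{v.1 - v.2} κ : 𝓢(Space d, ℂ)) x z +
      ∑ j, ker Ψ L f c c₀ (k + 2)
        (Function.update φ j (∂_{v.1} (φ j) : 𝓢(Space d, ℂ))) κ x z := by
  obtain ⟨h1, h2⟩ := hasFDerivAt_ker (Ψ := Ψ) (c := c) (c₀ := c₀) (φ := φ) (κ := κ) hL hA hf hM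
    hk hxz
  have hi : ∀ (φ : J → 𝓢(Space d, ℂ)) (κ : 𝓢(Space d, ℂ)), Integrable
      (kerIntegrand Ψ L f c c₀ (k + 2) φ κ x z) (scaleMeasure d) := fun φ κ =>
    integrable_kerIntegrand hL hA hf hM (by omega) hxz
  rw [h1.fderiv, ContinuousLinearMap.integral_apply h2]
  simp only [ker]
  rw [← integral_finsetSum _ fun j _ => hi _ _, ← integral_add (hi _ _)
    (integrable_finsetSum _ fun j _ => hi _ _)]
  congr 1; ext q
  exact kerIntegrandD_apply hf hM q.2 v

end

/-! ### Kernel derivatives of all orders -/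

section

variable {d : ℕ}

/-- The composition `D_1^{β_1} ⋯ D_d^{β_d}`. -/
def mixedOp {X : Type*} (D : Fin d → X → X) (β : MultiIndex d) (a : X) : X :=
  (List.finRange d).foldr (fun i h => (D i)^[β i] h) a

/-- Induction over the order of differentiation, done once: a relation graded by the number of
derivatives passes from one derivative to all multi-indices. -/
theorem mixedOp_rel {X Y : Type*} (R : ℕ → X → Y → Prop) {D : Fin d → X → X} {E : Fin d → Y → Y}
    (h : ∀ i r a b, R r a b → R (r + 1) (D i a) (E i b)) (β : MultiIndex d) {r : ℕ} {a : X} {b : Y}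
    (hab : R r a b) : R (r + length β) (mixedOp D β a) (mixedOp E β b) := by
  have hit : ∀ i n r a b, R r a b → R (r + n) ((D i)^[n] a) ((E i)^[n] b) := by
    intro i n
    induction n with
    | zero => exact fun r a b h => h
    | succ n ih =>
      intro r a b hab
      rw [Function.iterate_succ', Function.iterate_succ']
      exact h i _ _ _ (ih r a b hab)
  have hl : ∀ l : List (Fin d), R (r + (l.map β).sum)
      (l.foldr (fun i h => (D i)^[β i] h) a) (l.foldr (fun i h => (E i)^[β i] h) b) := by
    intro l
    induction l with
    | nil => exact hab
    | cons i l ih =>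
      simp only [List.map_cons, List.sum_cons, List.foldr_cons]
      rw [add_comm (β i), ← add_assoc]
      exact hit i (β i) _ _ _ ih
  have := hl (List.finRange d)
  rwa [← Fin.sum_univ_def] at this

theorem mixedOp_zero {X : Type*} (D : Fin d → X → X) (a : X) : mixedOp D 0 a = a := by
  have hl : ∀ l : List (Fin d), l.foldr (fun i h => (D i)^[(0 : MultiIndex d) i] h) a = a := by
    intro l
    induction l with
    | nil => rfl
    | cons i l ih => rw [List.foldr_cons, ih]; rfl
  exact hl _

/-- The partial derivative in the second variable. -/
def partialRight (i : Fin d) (G : Space d → Space d → ℂ) : Space d → Space d → ℂ :=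
  fun x => partialD i (G x)

/-- The partial derivative in the first variable. -/
def partialLeft (i : Fin d) (G : Space d → Space d → ℂ) : Space d → Space d → ℂ :=
  fun x z => partialD i (fun x' => G x' z) x

theorem kernelDeriv_eq (α β : MultiIndex d) (G : Space d → Space d → ℂ) :
    kernelDeriv α β G = mixedOp partialLeft α (mixedOp partialRight β G) := by
  have h1 : ∀ (G : Space d → Space d → ℂ) x, mixedOp partialRight β G x = mixedPartial β (G x) :=
    fun G x => mixedOp_rel (D := partialRight) (E := partialD) (fun _ G g => G x = g)
      (fun i r G g h => by simp only [partialRight, h]) β (r := 0) rfl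
  have h2 : ∀ (G : Space d → Space d → ℂ) z, (fun x => mixedOp partialLeft α G x z) =
      mixedPartial α (fun x => G x z) :=
    fun G z => mixedOp_rel (D := partialLeft) (E := partialD) (fun _ G g => (fun x => G x z) = g)
      (fun i r G g h => by simp only [partialLeft, h]) α (r := 0) rfl
  ext x z
  have := congrFun (h2 (mixedOp partialRight β G) z) x
  rw [this]
  simp only [kernelDeriv, h1]

theorem isOpen_offDiag : IsOpen {p : Space d × Space d | p.1 ≠ p.2} :=
  isOpen_ne_fun continuous_fst continuous_snd

section

variable {G H : Space d → Space d → ℂ} {x z : Space d}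

/-- Agreement off the diagonal suffices because that set is open; thus iterated derivatives can be
replaced by explicit kernels without control on the diagonal. -/
theorem partialRight_eq (hGH : ∀ x z, x ≠ z → G x z = H x z) (hxz : x ≠ z)
    (hH : DifferentiableAt ℝ (fun p : Space d × Space d => H p.1 p.2) (x, z)) (i : Fin d) :
    partialRight i G x z =
      fderiv ℝ (fun p : Space d × Space d => H p.1 p.2) (x, z) (0, EuclideanSpace.single i 1) := by
  have h1 : G x =ᶠ[nhds z] H x := by
    filter_upwards [isOpen_ne.mem_nhds hxz.symm] with z' hz'
    exact hGH x z' (Ne.symm hz')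
  have h2 : HasFDerivAt (H x) ((fderiv ℝ (fun p : Space d × Space d => H p.1 p.2) (x, z)).comp
      (ContinuousLinearMap.inr ℝ (Space d) (Space d))) z :=
    hH.hasFDerivAt.comp z (hasFDerivAt_prodMk_right x z)
  rw [partialRight, partialD, h1.fderiv_eq, h2.fderiv]
  rfl

theorem partialLeft_eq (hGH : ∀ x z, x ≠ z → G x z = H x z) (hxz : x ≠ z)
    (hH : DifferentiableAt ℝ (fun p : Space d × Space d => H p.1 p.2) (x, z)) (i : Fin d) :
    partialLeft i G x z =
      fderiv ℝ (fun p : Space d × Space d => H p.1 p.2) (x, z) (EuclideanSpace.single i 1, 0) := by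
  have h1 : (fun x' => G x' z) =ᶠ[nhds x] fun x' => H x' z := by
    filter_upwards [isOpen_ne.mem_nhds hxz] with x' hx'
    exact hGH x' z hx'
  have h2 : HasFDerivAt (fun x' => H x' z)
      ((fderiv ℝ (fun p : Space d × Space d => H p.1 p.2) (x, z)).comp
        (ContinuousLinearMap.inl ℝ (Space d) (Space d))) x :=
    hH.hasFDerivAt.comp (f := fun x' : Space d => (x', z)) x (hasFDerivAt_prodMk_left x z)
  rw [partialLeft, partialD, h1.fderiv_eq, h2.fderiv]
  rfl

end

variable {J : Type*} [Fintype J]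
  {Ψ : 𝓢(Space d, ℂ)} {L : ℝ → ℂ} {f : J → Space d → ℂ} {c : J → ℝ} {c₀ A : ℝ}
  {M : J → ℝ} {k : ℕ} {φ : J → 𝓢(Space d, ℂ)} {κ : 𝓢(Space d, ℂ)}
  {H : Space d → Space d → ℂ}

/-- The space spanned by the kernels of homogeneity `-(k - 1)`. -/
def kerSpan (Ψ : Space d → ℂ) (L : ℝ → ℂ) (f : J → Space d → ℂ) (c : J → ℝ) (c₀ : ℝ) (k : ℕ) :
    Submodule ℂ (Space d → Space d → ℂ) :=
  Submodule.span ℂ {H | ∃ φ κ, H = ker Ψ L f c c₀ k φ κ}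

theorem exists_norm_kerSpan_le (hA : ∀ t > 0, ‖L t‖ ≤ A) (hM : ∀ j x, ‖f j x‖ ≤ M j) (hk : 1 ≤ k)
    (hH : H ∈ kerSpan Ψ L f c c₀ (k + 1)) :
    ∃ C, ∀ x z, x ≠ z → ‖H x z‖ ≤ C * (1 / ‖x - z‖ ^ k) := by
  induction hH using Submodule.span_induction with
  | mem H h =>
    obtain ⟨φ, κ, rfl⟩ := h
    obtain ⟨E, -, hE⟩ := exists_decay κ c₀ (k + 1)
    refine ⟨A * (∏ j, (∫ w, ‖φ j w‖) * M j) * E *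
      (1 / k * ∫ u, ‖Ψ u‖ * (1 + ‖u‖) ^ (k + 1)), fun x z hxz => ?_⟩
    refine (norm_ker_le hA hM hE hk (norm_pos_iff.2 (sub_ne_zero.2 hxz))
      (by rw [div_one])).trans (le_of_eq ?_)
    rw [one_div_mul_eq_div]
    ring
  | zero => exact ⟨0, by simp⟩
  | add H H' _ _ h h' =>
    obtain ⟨C, hC⟩ := h
    obtain ⟨C', hC'⟩ := h'
    refine ⟨C + C', fun x z hxz => (norm_add_le _ _).trans ?_⟩
    rw [add_mul]; exact add_le_add (hC x z hxz) (hC' x z hxz)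
  | smul a H _ h =>
    obtain ⟨C, hC⟩ := h
    refine ⟨‖a‖ * C, fun x z hxz => ?_⟩
    rw [Pi.smul_apply, Pi.smul_apply, norm_smul, mul_assoc]
    exact mul_le_mul_of_nonneg_left (hC x z hxz) (norm_nonneg _)

/-- The spans for successive exponents are closed under differentiation off the diagonal, which
drives both the smoothness and the bounds for arbitrary (α, β). -/
theorem kerSpan_fderiv (hL : Measurable L) (hA : ∀ t > 0, ‖L t‖ ≤ A)
    (hf : ∀ j, Measurable (f j)) (hM : ∀ j x, ‖f j x‖ ≤ M j) (hk : 1 ≤ k)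
    (hH : H ∈ kerSpan Ψ L f c c₀ (k + 1)) :
    (∀ x z, x ≠ z → DifferentiableAt ℝ (fun p : Space d × Space d => H p.1 p.2) (x, z)) ∧
    ∀ v, ∃ H' ∈ kerSpan Ψ L f c c₀ (k + 2), ∀ x z, x ≠ z →
      fderiv ℝ (fun p : Space d × Space d => H p.1 p.2) (x, z) v = H' x z := by
  classical
  induction hH using Submodule.span_induction with
  | mem H h =>
    obtain ⟨φ, κ, rfl⟩ := h
    refine ⟨fun x z hxz => (hasFDerivAt_ker hL hA hf hM hk hxz).1.differentiableAt, fun v =>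
      ⟨ker Ψ L f c c₀ (k + 2) φ (∂_{v.1 - v.2} κ : 𝓢(Space d, ℂ)) +
        ∑ j, ker Ψ L f c c₀ (k + 2)
          (Function.update φ j (∂_{v.1} (φ j) : 𝓢(Space d, ℂ))) κ, ?_, fun x z hxz => ?_⟩⟩
    · exact Submodule.add_mem _ (Submodule.subset_span ⟨_, _, rfl⟩)
        (Submodule.sum_mem _ fun j _ => Submodule.subset_span ⟨_, _, rfl⟩)
    · rw [fderiv_ker_apply hL hA hf hM hk hxz]
      simp only [Pi.add_apply, Finset.sum_apply]
  | zero =>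
    refine ⟨fun x z _ => differentiableAt_const (0 : ℂ), fun v => ⟨0, Submodule.zero_mem _,
      fun x z _ => ?_⟩⟩
    simp
  | add H H' _ _ h h' =>
    refine ⟨fun x z hxz => (h.1 x z hxz).add (h'.1 x z hxz), fun v => ?_⟩
    obtain ⟨K, hK, e⟩ := h.2 v
    obtain ⟨K', hK', e'⟩ := h'.2 v
    refine ⟨K + K', Submodule.add_mem _ hK hK', fun x z hxz => ?_⟩
    have := fderiv_add (h.1 x z hxz) (h'.1 x z hxz)
    rw [Pi.add_apply, Pi.add_apply, ← e x z hxz, ← e' x z hxz, ← add_apply, ← this]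
    rfl
  | smul a H _ h =>
    refine ⟨fun x z hxz => (h.1 x z hxz).const_smul a, fun v => ?_⟩
    obtain ⟨K, hK, e⟩ := h.2 v
    refine ⟨a • K, Submodule.smul_mem _ a hK, fun x z hxz => ?_⟩
    have := fderiv_const_smul (h.1 x z hxz) a
    rw [Pi.smul_apply, Pi.smul_apply, ← e x z hxz, ← smul_apply, ← this]
    rfl

theorem contDiffOn_kerSpan (hL : Measurable L) (hA : ∀ t > 0, ‖L t‖ ≤ A)
    (hf : ∀ j, Measurable (f j)) (hM : ∀ j x, ‖f j x‖ ≤ M j) (n : ℕ) (hk : 1 ≤ k)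
    (hH : H ∈ kerSpan Ψ L f c c₀ (k + 1)) :
    ContDiffOn ℝ n (fun p : Space d × Space d => H p.1 p.2) {p | p.1 ≠ p.2} := by
  induction n generalizing k H with
  | zero =>
    rw [Nat.cast_zero, contDiffOn_zero]
    exact fun p hp => ((kerSpan_fderiv hL hA hf hM hk hH).1 p.1 p.2
      hp).continuousAt.continuousWithinAt
  | succ n ih =>
    obtain ⟨h1, h2⟩ := kerSpan_fderiv hL hA hf hM hk hH
    rw [Nat.cast_add, Nat.cast_one, contDiffOn_succ_iff_fderiv_of_isOpen isOpen_offDiag]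
    refine ⟨fun p hp => (h1 p.1 p.2 hp).differentiableWithinAt, by simp, ?_⟩
    rw [contDiffOn_clm_apply]
    intro v
    obtain ⟨H', hH', e⟩ := h2 v
    exact (ih (by omega) hH').congr fun p hp => e p.1 p.2 hp

theorem exists_norm_kernelDeriv_le (hL : Measurable L) (hA : ∀ t > 0, ‖L t‖ ≤ A)
    (hf : ∀ j, Measurable (f j)) (hM : ∀ j x, ‖f j x‖ ≤ M j) (hk : 1 ≤ k)
    (hH : H ∈ kerSpan Ψ L f c c₀ (k + 1)) (α β : MultiIndex d) :
    ∃ C, ∀ x z, x ≠ z →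
      ‖kernelDeriv α β H x z‖ ≤ C * (1 / ‖x - z‖ ^ (k + length β + length α)) := by
  -- The relation records that G is, off the diagonal, a kernel of size ‖x − z‖^{-r}; the second
  -- component is trivial.
  let R : ℕ → (Space d → Space d → ℂ) → Unit → Prop := fun r G _ =>
    1 ≤ r ∧ ∃ H ∈ kerSpan Ψ L f c c₀ (r + 1), ∀ x z, x ≠ z → G x z = H x z
  have hR0 : R k H () := ⟨hk, H, hH, fun _ _ _ => rfl⟩
  have hR1 : ∀ (i : Fin d) r G u, R r G u → R (r + 1) (partialRight i G) (id u) := by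
    rintro i r G u ⟨hr, H, hH, hGH⟩
    obtain ⟨h1, h2⟩ := kerSpan_fderiv hL hA hf hM hr hH
    obtain ⟨H', hH', e⟩ := h2 (0, EuclideanSpace.single i 1)
    exact ⟨by omega, H', hH', fun x z hxz => by
      rw [partialRight_eq hGH hxz (h1 x z hxz), e x z hxz]⟩
  have hR2 : ∀ (i : Fin d) r G u, R r G u → R (r + 1) (partialLeft i G) (id u) := by
    rintro i r G u ⟨hr, H, hH, hGH⟩
    obtain ⟨h1, h2⟩ := kerSpan_fderiv hL hA hf hM hr hH
    obtain ⟨H', hH', e⟩ := h2 (EuclideanSpace.single i 1, 0)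
    exact ⟨by omega, H', hH', fun x z hxz => by
      rw [partialLeft_eq hGH hxz (h1 x z hxz), e x z hxz]⟩
  have h1 := mixedOp_rel (E := fun _ => id) (b := ()) R hR1 β hR0
  have h2 := mixedOp_rel (E := fun _ => id) (b := mixedOp (fun _ => id) β ()) R hR2 α h1
  obtain ⟨hr, H', hH', e⟩ := h2
  obtain ⟨C, hC⟩ := exists_norm_kerSpan_le hA hM hr hH'
  refine ⟨C, fun x z hxz => ?_⟩
  rw [kernelDeriv_eq, e x z hxz]
  exact hC x z hxz

end

/-! ### Uniform constants and association with the operator -/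

section

variable {d : ℕ}

theorem lineDerivOp_eq_dil {κ η : 𝓢(Space d, ℂ)} {a : ℂ} {l : ℝ}
    (h : ∀ w, κ w = a * dil l η w) (v w : Space d) :
    (∂_{v} κ : 𝓢(Space d, ℂ)) w = a * (l⁻¹ : ℝ) * dil l (∂_{v} η : 𝓢(Space d, ℂ)) w := by
  have h1 := (η.differentiableAt (x := l⁻¹ • w)).hasFDerivAt.comp w
    ((hasFDerivAt_id (𝕜 := ℝ) w).const_smul l⁻¹)
  have h2 := (h1.const_mul (((1 / |l| ^ d : ℝ) : ℂ))).const_mul a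
  have h3 : HasFDerivAt κ _ w := h2.congr_of_eventuallyEq (Filter.Eventually.of_forall h)
  rw [SchwartzMap.lineDerivOp_apply_eq_fderiv, h3.fderiv, dil,
    SchwartzMap.lineDerivOp_apply_eq_fderiv]
  simp only [FunLike.coe_smul, Pi.smul_apply, ContinuousLinearMap.comp_apply, smul_eq_mul,
    ContinuousLinearMap.id_apply, map_smul, Complex.real_smul]
  ring

/-- In the variable w/l the shift is ρu, of length at most |u| because ρ ≤ 1. Measuring decay in
‖w‖/|l| thus gives a bound whose only dependence on l is the power |l|^{-(d+r)}. -/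
theorem norm_mul_one_add_pow_le_of_eq_dil {κ η : 𝓢(Space d, ℂ)} {l ρ C : ℝ} {r k : ℕ} (hl : l ≠ 0)
    (hρ : ρ ∈ Ioc (0 : ℝ) 1) (hη : ∀ w, (1 + ‖w‖) ^ k * ‖η w‖ ≤ C)
    (h : ∀ w, κ w = ((l⁻¹ : ℝ) : ℂ) ^ r * dil l η w) (w u : Space d) :
    ‖κ (w - (ρ * l) • u)‖ * (1 + ‖w‖ / |l|) ^ k ≤ C / |l| ^ (d + r) * (1 + ‖u‖) ^ k := by
  have hl' : 0 < |l| := abs_pos.2 hl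
  set v := l⁻¹ • w - ρ • u with hv
  have e1 : l⁻¹ • (w - (ρ * l) • u) = v := by
    rw [hv, smul_sub, smul_smul]
    congr 2
    field_simp
  have e2 : ‖κ (w - (ρ * l) • u)‖ = ‖η v‖ / |l| ^ (d + r) := by
    rw [h, dil, e1, norm_mul, norm_mul, norm_pow, Complex.norm_real, Complex.norm_real,
      Real.norm_eq_abs, Real.norm_eq_abs, abs_inv, abs_of_pos (show 0 < 1 / |l| ^ d by positivity), pow_add,
      inv_pow]
    field_simp
  have e3 : 1 + ‖w‖ / |l| ≤ (1 + ‖v‖) * (1 + ‖u‖) := by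
    have h1 : ‖w‖ / |l| = ‖v + ρ • u‖ := by
      rw [hv, sub_add_cancel, norm_smul, norm_inv, Real.norm_eq_abs, div_eq_inv_mul]
    have h2 : ‖v + ρ • u‖ ≤ ‖v‖ + ‖u‖ := by
      refine (norm_add_le _ _).trans (add_le_add_right ?_ _)
      rw [norm_smul, Real.norm_of_nonneg hρ.1.le]
      exact mul_le_of_le_one_left (norm_nonneg _) hρ.2
    nlinarith [norm_nonneg v, norm_nonneg u]
  rw [e2, div_mul_eq_mul_div, div_mul_eq_mul_div]
  refine div_le_div_of_nonneg_right ?_ (by positivity)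
  calc _ ≤ ‖η v‖ * ((1 + ‖v‖) * (1 + ‖u‖)) ^ k :=
        mul_le_mul_of_nonneg_left (pow_le_pow_left₀ (by positivity) e3 k) (norm_nonneg _)
    _ = ((1 + ‖v‖) ^ k * ‖η v‖) * (1 + ‖u‖) ^ k := by rw [mul_pow]; ring
    _ ≤ _ := mul_le_mul_of_nonneg_right (hη v) (by positivity)

variable {J : Type*} [Fintype J]

theorem ker_eq_zero {Ψ : Space d → ℂ} {L : ℝ → ℂ} {f : J → Space d → ℂ} {c : J → ℝ} {c₀ : ℝ}
    {k : ℕ} {φ : J → 𝓢(Space d, ℂ)} {κ : 𝓢(Space d, ℂ)} {j : J} (hj : φ j = 0) (x z : Space d) :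
    ker Ψ L f c c₀ k φ κ x z = 0 := by
  have : ∀ q, kerIntegrand Ψ L f c c₀ k φ κ x z q = 0 := fun q => by
    rw [kerIntegrand, Finset.prod_eq_zero (Finset.mem_univ j), zero_mul, mul_zero]
    simp [moll, hj]
  simp only [ker, this, integral_zero]

/-- The constants of the `y`-derivatives of the kernel do not depend on the dilations. -/
theorem exists_norm_kernelDeriv_zero_le (hd : 1 ≤ d) (Ψ η : 𝓢(Space d, ℂ)) (β : MultiIndex d) :
    ∃ C, ∀ (L : ℝ → ℂ) (f : J → Space d → ℂ) (c : J → ℝ) (l ρ A : ℝ) (M : J → ℝ)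
      (φ : J → 𝓢(Space d, ℂ)) (κ : 𝓢(Space d, ℂ)), Measurable L → (∀ t > 0, ‖L t‖ ≤ A) →
      (∀ j, Measurable (f j)) → (∀ j x, ‖f j x‖ ≤ M j) → l ≠ 0 → ρ ∈ Ioc (0 : ℝ) 1 →
      (∀ w, κ w = dil l η w) → ∀ x z, x ≠ z →
      ‖kernelDeriv 0 β (ker Ψ L f c (ρ * l) (d + 1) φ κ) x z‖ ≤
        A * (∏ j, (∫ w, ‖φ j w‖) * M j) * C * (1 / ‖x - z‖ ^ (d + length β)) := by
  classical
  -- The direction 0 − e_i is v.1 − v.2 for the vector v = (0, e_i) of a derivative in the second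
  -- variable.
  let D : Fin d → 𝓢(Space d, ℂ) → 𝓢(Space d, ℂ) := fun i κ =>
    ∂_{(0 : Space d) - EuclideanSpace.single i 1} κ
  obtain ⟨C, -, hC⟩ := exists_one_add_pow_mul_le (mixedOp D β η) (d + length β + 1)
  refine ⟨C * (1 / (d + length β : ℕ) * ∫ u, ‖Ψ u‖ * (1 + ‖u‖) ^ (d + length β + 1)), ?_⟩
  intro L f c l ρ A M φ κ hL hA hf hM hl hρ hκ x z hxz
  let R : ℕ → (Space d → Space d → ℂ) → 𝓢(Space d, ℂ) → Prop := fun r G κ' =>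
    1 ≤ r ∧ ∀ x z, x ≠ z → G x z = ker Ψ L f c (ρ * l) (r + 1) φ κ' x z
  have hR : ∀ i r G κ', R r G κ' → R (r + 1) (partialRight i G) (D i κ') := by
    rintro i r G κ' ⟨hr, hG⟩
    refine ⟨by omega, fun x z hxz => ?_⟩
    rw [partialRight_eq hG hxz (hasFDerivAt_ker hL hA hf hM hr hxz).1.differentiableAt,
      fderiv_ker_apply hL hA hf hM hr hxz, Finset.sum_eq_zero, add_zero]
    -- The remaining Leibniz terms differentiate some φ_j in the direction v.1 = 0, hence vanish: no
    -- derivative reaches the factors with f_j.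
    intro j _
    refine ker_eq_zero (j := j) ?_ x z
    rw [Function.update_self, LineDeriv.lineDerivOp_left_zero]
  have h1 : R (d + length β) (mixedOp partialRight β _) (mixedOp D β κ) :=
    mixedOp_rel R hR β (r := d) (a := ker Ψ L f c (ρ * l) (d + 1) φ κ) (b := κ)
      ⟨hd, fun _ _ _ => rfl⟩
  let S : ℕ → 𝓢(Space d, ℂ) → 𝓢(Space d, ℂ) → Prop := fun r κ' η' =>
    ∀ w, κ' w = ((l⁻¹ : ℝ) : ℂ) ^ r * dil l η' w
  have hS : ∀ i r κ' η', S r κ' η' → S (r + 1) (D i κ') (D i η') := fun i r κ' η' h w => by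
    rw [pow_succ]
    exact lineDerivOp_eq_dil h _ w
  have h2 : S (0 + length β) (mixedOp D β κ) (mixedOp D β η) :=
    mixedOp_rel S hS β (r := 0) fun w => by rw [pow_zero, one_mul, hκ]
  rw [zero_add] at h2
  rw [kernelDeriv_eq, mixedOp_zero, h1.2 x z hxz]
  have hl' : 0 < |l| := abs_pos.2 hl
  have hD : 0 < ‖x - z‖ := norm_pos_iff.2 (sub_ne_zero.2 hxz)
  -- The distance is measured in units of |l|: δ^{-(d+|β|)} contributes |l|^{d+|β|}, which cancels
  -- the factor from the decay constant.
  refine (norm_ker_le (Λ := |l|) (δ := ‖x - z‖ / |l|) hA hM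
    (norm_mul_one_add_pow_le_of_eq_dil hl hρ hC h2) (by omega) (by positivity) le_rfl).trans
    (le_of_eq ?_)
  have hn : ((d + length β : ℕ) : ℝ) ≠ 0 := by
    have : d + length β ≠ 0 := by omega
    exact_mod_cast this
  rw [div_pow]
  field_simp

section

variable {Ψ : 𝓢(Space d, ℂ)} {L : ℝ → ℂ} {f : J → Space d → ℂ} {c : J → ℝ} {c₀ A : ℝ}
  {M : J → ℝ} {k : ℕ} {φ : J → 𝓢(Space d, ℂ)} {κ g : 𝓢(Space d, ℂ)} {x : Space d}

/-- A whole ball of radius δ around x avoids the support of g, so ‖x − z‖ ≥ δ wherever g z ≠ 0 and a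
single majorant works for all such z. -/
theorem integrable_kerIntegrand_mul (hL : Measurable L) (hA : ∀ t > 0, ‖L t‖ ≤ A)
    (hf : ∀ j, Measurable (f j)) (hM : ∀ j x, ‖f j x‖ ≤ M j) (hk : 1 ≤ k) (hx : x ∉ tsupport g) :
    Integrable (fun p : (ℝ × Space d) × Space d =>
      kerIntegrand Ψ L f c c₀ (k + 1) φ κ x p.2 p.1 * g p.2) ((scaleMeasure d).prod volume) := by
  obtain ⟨E, -, hE⟩ := exists_decay κ c₀ (k + 1)
  obtain ⟨δ, hδ, hball⟩ := Metric.isOpen_iff.1 (isClosed_tsupport g).isOpen_compl x hx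
  have hm : Measurable fun p : (ℝ × Space d) × Space d =>
      kerIntegrand Ψ L f c c₀ (k + 1) φ κ x p.2 p.1 * g p.2 := by
    have h1 : Measurable fun p : (ℝ × Space d) × Space d =>
        ∏ j, moll (φ j) (f j) p.1.1 (x - (c j * p.1.1) • p.1.2) :=
      (measurable_prod_moll (φ := φ) (c := c) hf Finset.univ x).comp measurable_fst
    have hκ := κ.continuous.measurable
    have hΨ := Ψ.continuous.measurable
    have hg := g.continuous.measurable
    unfold kerIntegrand
    fun_prop
  have hint := ((integrable_majorant Ψ hδ hk (k + 1)).const_mul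
    (A * (∏ j, (∫ w, ‖φ j w‖) * M j) * E)).mul_prod (g.integrable (μ := volume)).norm
  refine hint.mono' hm.aestronglyMeasurable ?_
  have hpos : ∀ᵐ p ∂((scaleMeasure d).prod (volume : Measure (Space d))), 0 < p.1.1 :=
    (Measure.quasiMeasurePreserving_fst (μ := scaleMeasure d)
      (ν := (volume : Measure (Space d)))).ae (ae_scaleMeasure (P := fun q => 0 < q.1)
        fun t u ht => ht)
  filter_upwards [hpos] with p hp
  rw [norm_mul]
  by_cases hz : g p.2 = 0
  · rw [hz, norm_zero, mul_zero, mul_zero]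
  refine mul_le_mul_of_nonneg_right ?_ (norm_nonneg _)
  refine norm_kerIntegrand_le hA hM hE hδ ?_ hp p.1.2
  by_contra! hlt
  rw [div_one, norm_sub_rev, ← dist_eq_norm] at hlt
  exact hball hlt (subset_tsupport _ hz)

/-- Explains the exponent d + 1: the power t^{-d} normalises the last average, and one more comes
from dt/t. -/
theorem integral_kerIntegrand_mul {t : ℝ} (ht : 0 < t) (u : Space d) :
    ∫ z, kerIntegrand Ψ L f c c₀ (d + 1) φ κ x z (t, u) * g z =
      L t / (t : ℂ) * (Ψ u * ((∏ j, moll (φ j) (f j) t (x - (c j * t) • u)) *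
        moll κ g t (x - (c₀ * t) • u))) := by
  have h1 : ∀ z, t⁻¹ • (x - (c₀ * t) • u - z) = t⁻¹ • (x - z) - c₀ • u := fun z => by
    rw [sub_right_comm, smul_sub, smul_smul]
    congr 2
    field_simp
  have h2 : moll κ g t (x - (c₀ * t) • u) =
      (1 / t ^ d) • ∫ z, κ (t⁻¹ • (x - z) - c₀ • u) * g z := by
    rw [moll, integral_comp_inv_smul_sub _ ht (x - (c₀ * t) • u)]
    simp only [sub_smul_inv_smul_sub ht.ne']
    simp only [h1]
  rw [h2, Complex.real_smul, ← integral_const_mul, ← integral_const_mul, ← integral_const_mul,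
    ← integral_const_mul]
  congr 1; ext z
  simp only [kerIntegrand]
  push_cast
  simp only [pow_succ, div_eq_mul_inv, mul_inv]
  ring

theorem integral_ker_mul (hd : 1 ≤ d) (hL : Measurable L) (hA : ∀ t > 0, ‖L t‖ ≤ A)
    (hf : ∀ j, Measurable (f j)) (hM : ∀ j x, ‖f j x‖ ≤ M j) (hx : x ∉ tsupport g) :
    ∫ z, ker Ψ L f c c₀ (d + 1) φ κ x z * g z = ∫ t in Ioi (0 : ℝ), L t *
      (∫ u, Ψ u * ((∏ j, moll (φ j) (f j) t (x - (c j * t) • u)) *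
        moll κ g t (x - (c₀ * t) • u))) / (t : ℂ) := by
  have : SFinite (scaleMeasure d) := by unfold scaleMeasure; infer_instance
  have hI := integrable_kerIntegrand_mul (Ψ := Ψ) (c := c) (c₀ := c₀) (φ := φ) (κ := κ) hL hA hf hM
    hd hx
  have hI2 : Integrable (fun q => ∫ z, kerIntegrand Ψ L f c c₀ (d + 1) φ κ x z q * g z)
      ((volume.restrict (Ioi (0 : ℝ))).prod (volume : Measure (Space d))) := hI.integral_prod_left
  calc _ = ∫ z, ∫ q, kerIntegrand Ψ L f c c₀ (d + 1) φ κ x z q * g z ∂(scaleMeasure d) := by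
        simp only [ker, integral_mul_const]
    _ = ∫ q, (∫ z, kerIntegrand Ψ L f c c₀ (d + 1) φ κ x z q * g z) ∂(scaleMeasure d) :=
        (integral_integral_swap hI).symm
    _ = ∫ t in Ioi (0 : ℝ), ∫ u, ∫ z, kerIntegrand Ψ L f c c₀ (d + 1) φ κ x z (t, u) * g z :=
        integral_prod _ hI2
    _ = _ := setIntegral_congr_fun measurableSet_Ioi fun t ht => by
        simp only [integral_kerIntegrand_mul (mem_Ioi.1 ht), integral_const_mul]
        ring

end

end

/-! ### Spectra of the dilated kernels and the model operator -/

section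

variable {d : ℕ}

theorem integral_norm_dil (κ : Space d → ℂ) {l : ℝ} (hl : l ≠ 0) :
    ∫ w, ‖dil l κ w‖ = ∫ w, ‖κ w‖ := by
  have hl' : 0 < |l| := abs_pos.2 hl
  have h : ∀ w, ‖dil l κ w‖ = 1 / |l| ^ d * ‖κ (l⁻¹ • w)‖ := fun w => by
    rw [dil, norm_mul, Complex.norm_real, Real.norm_of_nonneg (by positivity)]
  simp only [h]
  rw [integral_const_mul, Measure.integral_comp_inv_smul volume (fun w => ‖κ w‖) l,
    finrank_euclideanSpace_fin, abs_pow, smul_eq_mul, ← mul_assoc,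
    one_div_mul_cancel (by positivity), one_mul]

theorem exists_fourier_eq_zero_of_corona {Ψ : 𝓢(Space d, ℂ)} (hΨ : SpectrumInCorona Ψ) :
    ∃ a, 0 < a ∧ ∀ ξ, ‖ξ‖ ≤ a → 𝓕 Ψ ξ = 0 := by
  obtain ⟨a, b, ha, -, h⟩ := hΨ
  refine ⟨a / 2, half_pos ha, fun ξ hξ => ?_⟩
  exact image_eq_zero_of_notMem_tsupport fun hmem => by linarith [(h hmem).1]

/-- Dilation changes the spectral radius r_i into r_i/|λ_i|. The resulting R depends on λ, which is
harmless because it enters only the L² bound. -/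
theorem exists_fourier_dil_eq_zero {ι : Type*} [Finite ι] {Φ φ : ι → 𝓢(Space d, ℂ)}
    (hΦ : ∀ i, SpectrumBounded (Φ i)) {lam : ι → ℝ} (hlam : ∀ i, lam i ≠ 0)
    (hφ : ∀ i, (φ i : Space d → ℂ) = dil (lam i) (Φ i)) :
    ∃ R, ∀ i ξ, R < ‖ξ‖ → 𝓕 (φ i) ξ = 0 := by
  choose r hr using hΦ
  obtain ⟨R, hR⟩ := (Set.finite_range fun i => r i / |lam i|).bddAbove
  refine ⟨R, fun i ξ hξ => ?_⟩
  have h1 : r i / |lam i| < ‖ξ‖ := (hR (mem_range_self i)).trans_lt hξ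
  rw [div_lt_iff₀ (abs_pos.2 (hlam i))] at h1
  rw [SchwartzMap.fourier_coe, hφ, fourier_dil _ (hlam i), ← SchwartzMap.fourier_coe]
  refine image_eq_zero_of_notMem_tsupport fun hmem => ?_
  have := hr i hmem
  rw [mem_closedBall_zero_iff, norm_smul, Real.norm_eq_abs] at this
  linarith

section

variable {m : ℕ} {Ψ : 𝓢(Space d, ℂ)} {Φ : Fin (m + 1) → 𝓢(Space d, ℂ)} {L : ℝ → ℂ} {B : ℝ}
  {lam ρ : Fin (m + 1) → ℝ} {f : Fin m → Space d → ℂ} {M : Fin m → ℝ}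
  {φ : Fin (m + 1) → 𝓢(Space d, ℂ)}

theorem integral_ker_mul_eq_modelU (hd : 1 ≤ d) (hL : Measurable L) (hB : ∀ t > 0, ‖L t‖ ≤ B)
    (hlam : ∀ i, lam i ≠ 0) (hf : ∀ j, Measurable (f j)) (hM : ∀ j x, ‖f j x‖ ≤ M j)
    (hφ : ∀ i, (φ i : Space d → ℂ) = dil (lam i) (Φ i)) {g : 𝓢(Space d, ℂ)} {x : Space d}
    (hx : x ∉ tsupport g) :
    ∫ z, ker Ψ L f (fun j => ρ j.castSucc * lam j.castSucc) (ρ (Fin.last m) * lam (Fin.last m))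
      (d + 1) (fun j => φ j.castSucc) (φ (Fin.last m)) x z * g z =
    modelU Ψ Φ ρ lam L (Fin.snoc (α := fun _ => Space d → ℂ) f g) x := by
  rw [integral_ker_mul hd hL hB hf hM hx, modelU_eq hlam]
  simp only [slice, Fin.prod_univ_castSucc, Fin.snoc_castSucc, Fin.snoc_last, hφ]

end

end

end Paraproduct

end

/-- With `n = m + 1`, the fixed functions are `f_1, …, f_m` and the variable one is `g = f_n`. -/
theorem proposition5p3 {d m : ℕ} (hd : 1 ≤ d)
    (Ψ : 𝓢(Paraproduct.Space d, ℂ)) (hΨ : Paraproduct.SpectrumInCorona Ψ)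
    (Φ : Fin (m + 1) → 𝓢(Paraproduct.Space d, ℂ))
    (hΦ : ∀ i, Paraproduct.SpectrumBounded (Φ i)) :
    ∃ C : Paraproduct.MultiIndex d → ℝ,
      ∀ (L : ℝ → ℂ) (B : ℝ), Measurable L → (∀ t > 0, ‖L t‖ ≤ B) →
      ∀ lam : Fin (m + 1) → ℝ, (∀ i, lam i ≠ 0) →
      ∀ ρ : Fin (m + 1) → ℝ, (∀ i, ρ i ∈ Ioc (0 : ℝ) 1) →
      ∀ (f : Fin m → Paraproduct.Space d → ℂ) (M : Fin m → ℝ),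
        (∀ j, ContDiff ℝ ∞ (f j)) → (∀ j x, ‖f j x‖ ≤ M j) →
      (∀ (g : 𝓢(Paraproduct.Space d, ℂ)) (x : Paraproduct.Space d),
        Paraproduct.ModelConverges Ψ Φ ρ lam L
          (Fin.snoc (α := fun _ => Paraproduct.Space d → ℂ) f g) x) ∧
      ∃ V : 𝓢(Paraproduct.Space d, ℂ) →L[ℂ] 𝓢'(Paraproduct.Space d, ℂ),
        (∀ g : 𝓢(Paraproduct.Space d, ℂ), Paraproduct.IsGivenBy (V g)
          (Paraproduct.modelU Ψ Φ ρ lam L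
            (Fin.snoc (α := fun _ => Paraproduct.Space d → ℂ) f g))) ∧
        ∃ A : Paraproduct.MultiIndex d → Paraproduct.MultiIndex d → ℝ,
          (∀ β, A 0 β ≤ C β * B * ∏ j, M j) ∧
          ∀ N : ℕ, Paraproduct.IsCalderonZygmund N A V := by
  classical
  obtain ⟨a, ha, hΨa⟩ := Paraproduct.exists_fourier_eq_zero_of_corona hΨ
  choose C hC using Paraproduct.exists_norm_kernelDeriv_zero_le (J := Fin m) hd Ψ (Φ (Fin.last m))
  -- Fixed before λ and ρ: the L¹ norms of the dilated kernels equal those of Φ.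
  refine ⟨fun β => (∏ j : Fin m, ∫ w, ‖Φ j.castSucc w‖) * C β, ?_⟩
  intro L B hL hB lam hlam ρ hρ f M hf hM
  have hfm : ∀ j, Measurable (f j) := fun j => (hf j).continuous.measurable
  choose φ hφ using fun i => Paraproduct.exists_schwartz_dil (Φ i) (hlam i)
  obtain ⟨R, hR⟩ := Paraproduct.exists_fourier_dil_eq_zero hΦ hlam hφ
  refine ⟨fun g x => ?_, ?_⟩
  · obtain ⟨K, -, hK⟩ := Paraproduct.exists_one_add_pow_mul_le g 0
    simp only [pow_zero, one_mul] at hK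
    refine Paraproduct.modelConverges (B := Fin.snoc (α := fun _ => ℝ) M K) (p := Fin.last m) hd
      ?_ hlam ?_ ?_ ?_ hL hB x
    · exact hΨa 0 (by rw [norm_zero]; exact ha.le)
    · refine Fin.lastCases ?_ fun j => ?_
      · rw [Fin.snoc_last]; exact g.smooth _
      · rw [Fin.snoc_castSucc]; exact hf j
    · refine Fin.lastCases ?_ fun j => ?_
      · rw [Fin.snoc_last, Fin.snoc_last]; exact hK
      · rw [Fin.snoc_castSucc, Fin.snoc_castSucc]; exact hM j
    · rw [Fin.snoc_last]; exact g.integrable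
  have hU : ∃ S : Lp ℂ 2 (volume : Measure (Paraproduct.Space d)) →L[ℂ]
      Lp ℂ 2 (volume : Measure (Paraproduct.Space d)), ∀ g : 𝓢(Paraproduct.Space d, ℂ),
      S (g.toLp 2) =ᵐ[volume] Paraproduct.modelU Ψ Φ ρ lam L
        (Fin.snoc (α := fun _ => Paraproduct.Space d → ℂ) f g) := by
    obtain ⟨S, hS⟩ := Paraproduct.exists_clm_average hd (Fin.last m) ha hΨa hR
      (fun i => ρ i * lam i) hL hB
      (f := Fin.snoc (α := fun _ => Paraproduct.Space d → ℂ) f 0)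
      (M := Fin.snoc (α := fun _ => ℝ) M 0)
      (Fin.lastCases (fun h => absurd rfl h) fun j _ => by rw [Fin.snoc_castSucc]; exact hf j)
      (Fin.lastCases (fun h => absurd rfl h) fun j _ => by
        rw [Fin.snoc_castSucc, Fin.snoc_castSucc]; exact hM j)
    refine ⟨S, fun g => (hS g).trans (Filter.EventuallyEq.of_eq ?_)⟩
    ext x
    rw [Paraproduct.modelU_eq hlam, Fin.update_snoc_last]
    simp only [hφ]
  obtain ⟨S, hS⟩ := hU
  obtain ⟨V, hV, hV2⟩ := Paraproduct.exists_distribution_of_clm S _ hS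
  set K := Paraproduct.ker Ψ L f (fun j => ρ j.castSucc * lam j.castSucc)
    (ρ (Fin.last m) * lam (Fin.last m)) (d + 1) (fun j => φ j.castSucc) (φ (Fin.last m)) with hKdef
  have hKs : K ∈ Paraproduct.kerSpan Ψ L f (fun j => ρ j.castSucc * lam j.castSucc)
      (ρ (Fin.last m) * lam (Fin.last m)) (d + 1) := Submodule.subset_span ⟨_, _, rfl⟩
  choose A hA using Paraproduct.exists_norm_kernelDeriv_le hL hB hfm hM hd hKs
  -- For α = 0 the uniform constants, otherwise those of the span argument, which may depend on all
  -- the data; neither depends on N.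
  refine ⟨V, hV, fun α β => if α = 0 then (∏ j : Fin m, ∫ w, ‖Φ j.castSucc w‖) * C β * B * ∏ j, M j
    else A α β, fun β => by simp, fun N => ⟨hV2, K, ⟨?_, fun α β _ _ x y hxy => ?_⟩, ?_⟩⟩
  · exact_mod_cast Paraproduct.contDiffOn_kerSpan hL hB hfm hM (2 * N) hd hKs
  · split_ifs with hα
    · subst hα
      refine (hC β L f _ (lam (Fin.last m)) (ρ (Fin.last m)) B M _ _ hL hB hfm hM (hlam _) (hρ _)
        (fun w => by rw [hφ]) x y hxy).trans (le_of_eq ?_)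
      have h0 : Paraproduct.length (0 : Paraproduct.MultiIndex d) = 0 := by
        simp [Paraproduct.length]
      simp only [hφ, Paraproduct.integral_norm_dil _ (hlam _), Finset.prod_mul_distrib, h0,
        add_zero]
      ring
    · exact hA α β x y hxy
  · intro g h _ _ hdisj
    rw [(hV g h).2]
    congr 1; ext x
    by_cases hx : h x = 0
    · rw [hx, zero_mul, zero_mul]
    -- Where h does not vanish, x is off the support of g, and the kernel integral is the model
    -- operator pointwise.
    · have hxg : x ∉ tsupport g := fun hmem =>
        hdisj.le_bot ⟨hmem, subset_tsupport _ hx⟩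
      rw [Paraproduct.integral_ker_mul_eq_modelU hd hL hB hlam hfm hM hφ hxg]
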